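/- **Theorem (finiteness).** Let $\Gamma\subset\mathbb C$ be a lattice, $\mathbb T=\mathbb C/\Gamma$ the corresponding 2-torus with coordinate $z=x+iy$, and let $X:\mathbb T\to\mathbb R^4\simeq\mathbb C^2$ be a smooth conformal Lagrangian immersion (regarded as a $\Gamma$-periodic map on $\mathbb C$) which is Hamiltonian stationary, i.e. the first variation of the area of $X$ along the vector field $-J\nabla h$ vanishes for every $h\in C^\infty_c(\mathbb R^4,\mathbb R)$. Then $X$ is of finite type. Here the terms are as follows. Identify $\mathbb R^4$ with the quaternions by $(x^1,x^2,x^3,x^4)\mapsto x^1+ix^2+jx^3+kx^4$, let $L_p,R_p$ be the matrices of left and right multiplication by $p$, so that $J=L_i$ and the symplectic form is $\omega=\langle J\cdot,\cdot\rangle=dx^1\wedge dx^2+dx^3\wedge dx^4$, and let $(\epsilon_1,\dots,\epsilon_4)$ be the canonical basis. Let $$\mathfrak g=\{(aL_i+b_1R_i+b_2R_j+b_3R_k,\,t)\;:\;a,b_1,b_2,b_3\in\mathbb R,\ t\in\mathbb R^4\},\qquad [(\eta,t),(\eta',t')]=(\eta\eta'-\eta'\eta,\ \eta t'-\eta' t),$$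 the Lie algebra of the group $\mathcal G$ of affine isometries preserving $\omega$, and let $\tau(\eta,t)=(-L_j\eta L_j,-L_jt)$, an automorphism of order 4 of $\mathfrak g^{\mathbb C}$; $\mathfrak g^{\mathbb C}_k$ is its eigenspace for the eigenvalue $i^k$ and $[\cdot]_k$ the projection on it ($k=-1,0,1,2$). A *lift* of $X$ is a smooth map $U=(F,X):\mathbb C\to\mathcal G$ with $F:\mathbb C\to\{G\in SO(4):GL_i=L_iG\}$ such that the oriented Lagrangian planes spanned by $(F\epsilon_1,F\epsilon_3)$ and by $(\partial_xX,\partial_yX)$ have the same Lagrangian angle $\Theta$, where $e^{i\Theta(e_1,e_3)}=(dx^1+i\,dx^2)\wedge(dx^3+i\,dx^4)(e_1,e_3)$ for a direct orthonormal basis $(e_1,e_3)$ of the plane. Its Maurer–Cartan form is $\alpha=U^{-1}dU=(F^{-1}dF,F^{-1}dX)$. Writing $\alpha_k=[\alpha]_k$, $\alpha_k'=\alpha_k(\partial_z)\,dz$, $\alpha_k''=\alpha_k(\partial_{\bar z})\,d\bar z$, its extended form is $$\alpha_\lambda=\lambda^{-2}\alpha_2'+\lambda^{-1}\alpha_{-1}'+\alpha_0+\lambda\alpha_1''+\lambda^2\alpha_2'',\qquad\lambda\in\mathbb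 C^*.$$ $\Lambda^d\mathfrak g_\tau$ is the space of Laurent polynomial loops $\xi_\lambda=\sum_{n=-d}^d\lambda^n\hat\xi_n$ such that $\xi_\lambda\in\mathfrak g$ and $\xi_{i\lambda}=\tau(\xi_\lambda)$ for all $|\lambda|=1$. Let $\mathfrak g_0=\mathrm{span}_{\mathbb R}(R_i,R_j,R_k)$, $\epsilon=\frac12(\epsilon_1-i\epsilon_3)$, $\mathfrak b=\{\zeta\in\mathfrak g_0^{\mathbb C}:\zeta\epsilon\in\mathbb R\epsilon\}$, let $\pi$ be the projection on $\mathfrak g_0$ in $\mathfrak g_0^{\mathbb C}=\mathfrak g_0\oplus\mathfrak b$, and $r(\zeta)=\frac12(\pi(\zeta)-i\,\pi(i\zeta))$. $X$ is *of finite type* if for some lift of $X$, with Maurer–Cartan form $\alpha$, there are $d\in4\mathbb N+2$ and a smooth map $\xi_\lambda:\mathbb C\to\Lambda^d\mathfrak g_\tau$ (an adapted polynomial Killing field) such that $$d\xi_\lambda=[\xi_\lambda,\alpha_\lambda]\quad(\lambda\in\mathbb C^*)\qquad\text{and}\qquad\alpha(\partial_z)=\hat\xi_{-d}+\hat\xi_{-d+1}+r(\hat\xi_{-d+2}).$$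 -/

import Mathlib

open scoped ContDiff Gradient Matrix

noncomputable section

namespace HamStat

/-! ### Euclidean symplectic 4-space -/

/-- Euclidean 4-space with coordinates `x 0, x 1, x 2, x 3`; it is identified with `ℂ²` through
`(x 0 + i x 1, x 2 + i x 3)`. -/
abbrev E4 : Type := EuclideanSpace ℝ (Fin 4)

/-- The standard complex structure of `ℝ⁴ ≃ ℂ²` (multiplication by `i`). -/
def J (x : E4) : E4 := !₂[-x 1, x 0, -x 3, x 2]

/-- The standard symplectic form `dx⁰ ∧ dx¹ + dx² ∧ dx³`. -/
def sympl (x y : E4) : ℝ := x 0 * y 1 - x 1 * y 0 + (x 2 * y 3 - x 3 * y 2)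

/-- The complex 2-form `(dx⁰ + i dx¹) ∧ (dx² + i dx³)`. On an orthonormal basis `(u, v)` of an
oriented Lagrangian plane its value is `exp (iΘ)`, where `Θ` is the Lagrangian angle. -/
def expAngle (u v : E4) : ℂ :=
  ((u 0 : ℂ) + Complex.I * u 1) * ((v 2 : ℂ) + Complex.I * v 3)
    - ((v 0 : ℂ) + Complex.I * v 1) * ((u 2 : ℂ) + Complex.I * u 3)

/-! ### Lagrangian maps and Hamiltonian stationarity -/

/-- The pull-back of the symplectic form by `X` vanishes. -/
def IsLagrangian (X : ℂ → E4) : Prop :=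
  ∀ z v w : ℂ, sympl (fderiv ℝ X z v) (fderiv ℝ X z w) = 0

/-- The area of a map `Y` from the torus `ℂ / (ℤ b₀ + ℤ b₁)`, given as a periodic map on `ℂ`:
the integral of `|∂Y/∂x ∧ ∂Y/∂y|` over a fundamental parallelogram. -/
def area (b : Module.Basis (Fin 2) ℝ ℂ) (Y : ℂ → E4) : ℝ :=
  ∫ z in ZSpan.fundamentalDomain b,
    Real.sqrt (‖fderiv ℝ Y z 1‖ ^ 2 * ‖fderiv ℝ Y z Complex.I‖ ^ 2
      - (inner ℝ (fderiv ℝ Y z 1) (fderiv ℝ Y z Complex.I)) ^ 2)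

/-- The Hamiltonian vector field `-J∇h` of a function `h` on `ℝ⁴`. -/
def hamField (h : E4 → ℝ) (p : E4) : E4 := -J (∇ h p)

/-- `X` is a critical point of the area for all Hamiltonian variations: the first variation of the
area along `-J∇h` vanishes for every compactly supported smooth function `h` on `ℝ⁴`. -/
def IsHamiltonianStationary (b : Module.Basis (Fin 2) ℝ ℂ) (X : ℂ → E4) : Prop :=
  ∀ h : E4 → ℝ, ContDiff ℝ ∞ h → HasCompactSupport h →
    HasDerivAt (fun t : ℝ => area b (fun z => X z + t • hamField h (X z))) 0 0

/-! ### The Lie algebra of the group of symplectic isometries -/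

/-- Left multiplication by `i` on the quaternions; this is the matrix of `J`. -/
def Li (R : Type) [Ring R] : Matrix (Fin 4) (Fin 4) R :=
  !![0, -1, 0, 0; 1, 0, 0, 0; 0, 0, 0, -1; 0, 0, 1, 0]

/-- Left multiplication by `j` on the quaternions. -/
def Lj (R : Type) [Ring R] : Matrix (Fin 4) (Fin 4) R :=
  !![0, 0, -1, 0; 0, 0, 0, 1; 1, 0, 0, 0; 0, -1, 0, 0]

/-- Right multiplication by `i` on the quaternions. -/
def Ri (R : Type) [Ring R] : Matrix (Fin 4) (Fin 4) R :=
  !![0, -1, 0, 0; 1, 0, 0, 0; 0, 0, 0, 1; 0, 0, -1, 0]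

/-- Right multiplication by `j` on the quaternions. -/
def Rj (R : Type) [Ring R] : Matrix (Fin 4) (Fin 4) R :=
  !![0, 0, -1, 0; 0, 0, 0, -1; 1, 0, 0, 0; 0, 1, 0, 0]

/-- Right multiplication by `k` on the quaternions. -/
def Rk (R : Type) [Ring R] : Matrix (Fin 4) (Fin 4) R :=
  !![0, 0, 0, -1; 0, 0, 1, 0; 0, -1, 0, 0; 1, 0, 0, 0]

/-- The rotation group `{G ∈ SO(4) ; G Lᵢ = Lᵢ G} ≃ U(2)`. -/
def rotGroup : Set (Matrix (Fin 4) (Fin 4) ℝ) :=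
  {G | G ∈ Matrix.specialOrthogonalGroup (Fin 4) ℝ ∧ G * Li ℝ = Li ℝ * G}

/-- Pairs `(η, t)` of a complex `4 × 4` matrix and a complex vector (complexified infinitesimal
affine transformations of `ℝ⁴`). -/
abbrev AffC : Type := Matrix (Fin 4) (Fin 4) ℂ × (Fin 4 → ℂ)

/-- The Lie bracket `[(η, t), (η', t')] = (ηη' - η'η, ηt' - η't)`. -/
def br (p q : AffC) : AffC := (p.1 * q.1 - q.1 * p.1, p.1 *ᵥ q.2 - q.1 *ᵥ p.2)

/-- The real Lie algebra `𝔤` of the group of affine isometries of `ℝ⁴` that preserve the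
symplectic form, inside its complexification. -/
def gReal : Set AffC :=
  {p | ∃ (a b₁ b₂ b₃ : ℝ) (t : Fin 4 → ℝ),
    p = ((a : ℂ) • Li ℂ + (b₁ : ℂ) • Ri ℂ + (b₂ : ℂ) • Rj ℂ + (b₃ : ℂ) • Rk ℂ,
      fun i => (t i : ℂ))}

/-- The automorphism `τ` of order four: conjugation by `(-Lⱼ, 0)`; recall `Lⱼ² = -1`. -/
def tau (p : AffC) : AffC := (-(Lj ℂ * p.1 * Lj ℂ), -(Lj ℂ *ᵥ p.2))

/-- The projection `[·]ₖ` on the eigenspace of `τ` for the eigenvalue `iᵏ`, along the other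
eigenspaces: `¼ ∑ₘ i^(-km) τᵐ`. -/
def eigProj (k : ℤ) (p : AffC) : AffC :=
  (1 / 4 : ℂ) • ∑ m ∈ Finset.range 4, (Complex.I ^ (-(k * m))) • tau^[m] p

theorem tau_four (p : AffC) : tau^[4] p = p := by
  have hL : Lj ℂ * Lj ℂ = -1 := by
    ext i j; fin_cases i <;> fin_cases j <;> simp [Lj, Matrix.mul_apply, Fin.sum_univ_four]
  have h2 : ∀ q : AffC, tau (tau q) = (q.1, -q.2) := by
    intro q
    simp only [tau, Prod.mk.injEq]
    constructor
    · have : Lj ℂ * -(Lj ℂ * q.1 * Lj ℂ) * Lj ℂ = -((Lj ℂ * Lj ℂ) * q.1 * (Lj ℂ * Lj ℂ)) := by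
        noncomm_ring
      rw [this, hL]; simp
    · rw [Matrix.mulVec_neg, Matrix.mulVec_mulVec, hL, Matrix.neg_mulVec]; simp
  change tau (tau (tau (tau p))) = p
  rw [h2, h2]; simp

theorem tau_smul (c : ℂ) (p : AffC) : tau (c • p) = c • tau p := by
  simp [tau, Matrix.mulVec_smul]

theorem tau_add (p q : AffC) : tau (p + q) = tau p + tau q := by
  simp [tau, Matrix.mulVec_add, mul_add, add_mul, add_comm]

theorem tau_eigProj (k : ℤ) (p : AffC) :
    tau (eigProj k p) = (Complex.I ^ k) • eigProj k p := by
  have hI : Complex.I ≠ 0 := Complex.I_ne_zero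
  have h4 : tau (tau (tau (tau p))) = p := tau_four p
  have e1 : Complex.I ^ k * Complex.I ^ (-k) = 1 := by
    rw [← zpow_add₀ hI]; simp
  have e2 : Complex.I ^ k * Complex.I ^ (-(k * 2)) = Complex.I ^ (-k) := by
    rw [← zpow_add₀ hI]; congr 1; ring
  have e3 : Complex.I ^ k * Complex.I ^ (-(k * 3)) = Complex.I ^ (-(k * 2)) := by
    rw [← zpow_add₀ hI]; congr 1; ring
  have e4 : Complex.I ^ k = Complex.I ^ (-(k * 3)) := by
    have : Complex.I ^ k = Complex.I ^ (-(k * 3)) * (Complex.I ^ (4 : ℤ)) ^ k := by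
      rw [← zpow_mul, ← zpow_add₀ hI]; congr 1; ring
    rw [this, show Complex.I ^ (4 : ℤ) = 1 from by exact_mod_cast Complex.I_pow_four]
    simp
  simp only [eigProj, Finset.sum_range_succ, Finset.sum_range_zero, zero_add, tau_smul, tau_add,
    Function.iterate_succ, Function.iterate_zero, Function.comp, id, h4, Nat.cast_zero, mul_zero,
    neg_zero, zpow_zero, one_smul, Nat.cast_one, mul_one, Nat.cast_ofNat]
  rw [smul_comm (Complex.I ^ k)]
  congr 1
  simp only [smul_add, smul_smul, e1, e2, e3, one_smul]
  rw [← e4]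
  abel

theorem sum_eigProj (p : AffC) :
    eigProj (-1) p + eigProj 0 p + eigProj 1 p + eigProj 2 p = p := by
  have hI2 : Complex.I ^ (-2 : ℤ) = -1 := by
    rw [zpow_neg, show Complex.I ^ (2 : ℤ) = -1 from by exact_mod_cast Complex.I_sq]; norm_num
  have h1 : Complex.I ^ (-1 : ℤ) = -Complex.I := by rw [zpow_neg_one, Complex.inv_I]
  have h3 : Complex.I ^ (-3 : ℤ) = Complex.I := by
    rw [show (-3 : ℤ) = -2 + -1 from rfl, zpow_add₀ Complex.I_ne_zero, hI2, h1]; simp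
  have h4 : Complex.I ^ (-4 : ℤ) = 1 := by
    rw [show (-4 : ℤ) = -2 + -2 from rfl, zpow_add₀ Complex.I_ne_zero, hI2]; simp
  have h6 : Complex.I ^ (-6 : ℤ) = -1 := by
    rw [show (-6 : ℤ) = -4 + -2 from rfl, zpow_add₀ Complex.I_ne_zero, hI2, h4]; simp
  have g2 : Complex.I ^ (2 : ℤ) = -1 := by exact_mod_cast Complex.I_sq
  have g3 : Complex.I ^ (3 : ℤ) = -Complex.I := by exact_mod_cast Complex.I_pow_three
  simp only [eigProj, Finset.sum_range_succ, Finset.sum_range_zero, zero_add,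
    Function.iterate_succ, Function.iterate_zero, Function.comp, id, Nat.cast_zero, mul_zero,
    neg_zero, zpow_zero, one_smul, Nat.cast_one, mul_one, Nat.cast_ofNat, zero_mul, one_mul,
    neg_mul, neg_neg, zpow_one]
  norm_num [hI2, h1, h3, h4, h6, g2, g3]
  module

/-! ### The splitting of the complexified algebra `𝔤₀` and the operator `r` -/

/-- The real Lie algebra `𝔤₀` spanned by `Rᵢ, Rⱼ, Rₖ`. -/
def g0 : Set (Matrix (Fin 4) (Fin 4) ℂ) :=
  {κ | ∃ b₁ b₂ b₃ : ℝ, κ = (b₁ : ℂ) • Ri ℂ + (b₂ : ℂ) • Rj ℂ + (b₃ : ℂ) • Rk ℂ}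

/-- The complexification of `𝔤₀`. -/
def g0C : Set (Matrix (Fin 4) (Fin 4) ℂ) :=
  {κ | ∃ c₁ c₂ c₃ : ℂ, κ = c₁ • Ri ℂ + c₂ • Rj ℂ + c₃ • Rk ℂ}

/-- The isotropic vector `ε = ½ (1, 0, -i, 0)`. -/
def eps : Fin 4 → ℂ := ![1 / 2, 0, -Complex.I / 2, 0]

/-- The Lie algebra of the subgroup of the complexified group of `𝔤₀` that leaves the half-line
`ℝ₊ ε` invariant. -/
def borel : Set (Matrix (Fin 4) (Fin 4) ℂ) :=
  {κ | κ ∈ g0C ∧ ∃ s : ℝ, κ *ᵥ eps = (s : ℂ) • eps}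

/-- The projection on `𝔤₀` along `borel` in the complexification of `𝔤₀`
(see `projG0_iff` below). An element `c₁ Rᵢ + c₂ Rⱼ + c₃ Rₖ` has first column
`(0, c₁, c₂, c₃)`. -/
def projG0 (ζ : Matrix (Fin 4) (Fin 4) ℂ) : Matrix (Fin 4) (Fin 4) ℂ :=
  (((ζ 1 0).re + (ζ 3 0).im : ℝ) : ℂ) • Ri ℂ + (((ζ 2 0).re : ℝ) : ℂ) • Rj ℂ
    + (((ζ 3 0).re - (ζ 1 0).im : ℝ) : ℂ) • Rk ℂ

theorem mem_borel_iff (c₁ c₂ c₃ : ℂ) :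
    c₁ • Ri ℂ + c₂ • Rj ℂ + c₃ • Rk ℂ ∈ borel ↔ c₁ = Complex.I * c₃ ∧ c₂.re = 0 := by
  have key : ∀ s : ℝ, (c₁ • Ri ℂ + c₂ • Rj ℂ + c₃ • Rk ℂ) *ᵥ eps = (s : ℂ) • eps ↔
      (c₁ = Complex.I * c₃ ∧ Complex.I * c₂ = s) := by
    intro s
    have hI := Complex.I_mul_I
    have hv : (c₁ • Ri ℂ + c₂ • Rj ℂ + c₃ • Rk ℂ) *ᵥ eps =
        ![Complex.I * c₂ / 2, (c₁ - Complex.I * c₃) / 2, c₂ / 2,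
          (c₃ + Complex.I * c₁) / 2] := by
      ext i
      fin_cases i <;>
        simp [Ri, Rj, Rk, eps, Matrix.mulVec, dotProduct, Fin.sum_univ_four] <;> ring
    rw [hv]
    constructor
    · intro h
      have h0 := congrFun h 0
      have h1 := congrFun h 1
      simp [eps] at h0 h1
      constructor
      · linear_combination h1
      · linear_combination 2 * h0
    · rintro ⟨h1, h2⟩
      have h3 : c₂ = -Complex.I * s := by linear_combination -Complex.I * h2 + c₂ * hI
      ext i
      fin_cases i
      · simp [eps]; linear_combination h2 / 2
      · simp [eps]; linear_combination h1
      · simp [eps]; linear_combination h3 / 2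
      · simp [eps]; linear_combination Complex.I * h1 + c₃ * hI
  simp only [borel, Set.mem_ofPred_eq, key]
  constructor
  · rintro ⟨-, s, h1, h2⟩
    refine ⟨h1, ?_⟩
    have := congrArg Complex.im h2
    simpa using this
  · rintro ⟨h1, h2⟩
    refine ⟨⟨c₁, c₂, c₃, rfl⟩, -c₂.im, h1, ?_⟩
    apply Complex.ext <;> simp [h2]

/-- In the complexification of `𝔤₀`, which is the direct sum of `𝔤₀` and `borel`, `projG0 ζ` is the
unique element of `𝔤₀` that differs from `ζ` by an element of `borel`. -/
theorem projG0_iff {ζ κ : Matrix (Fin 4) (Fin 4) ℂ} (hζ : ζ ∈ g0C) (hκ : κ ∈ g0) :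
    ζ - κ ∈ borel ↔ κ = projG0 ζ := by
  obtain ⟨c₁, c₂, c₃, rfl⟩ := hζ
  obtain ⟨b₁, b₂, b₃, rfl⟩ := hκ
  have hsub : c₁ • Ri ℂ + c₂ • Rj ℂ + c₃ • Rk ℂ
      - ((b₁ : ℂ) • Ri ℂ + (b₂ : ℂ) • Rj ℂ + (b₃ : ℂ) • Rk ℂ) =
      (c₁ - b₁) • Ri ℂ + (c₂ - b₂) • Rj ℂ + (c₃ - b₃) • Rk ℂ := by module
  rw [hsub, mem_borel_iff]
  have hp : projG0 (c₁ • Ri ℂ + c₂ • Rj ℂ + c₃ • Rk ℂ) =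
      ((c₁.re + c₃.im : ℝ) : ℂ) • Ri ℂ + ((c₂.re : ℝ) : ℂ) • Rj ℂ
        + ((c₃.re - c₁.im : ℝ) : ℂ) • Rk ℂ := by
    simp [projG0, Ri, Rj, Rk]
  rw [hp]
  constructor
  · rintro ⟨h1, h2⟩
    have hre := congrArg Complex.re h1
    have him := congrArg Complex.im h1
    simp at hre him h2
    have e1 : b₁ = c₁.re + c₃.im := by linarith
    have e2 : b₂ = c₂.re := by linarith
    have e3 : b₃ = c₃.re - c₁.im := by linarith
    rw [e1, e2, e3]
  · intro h
    have h10 := congrFun (congrFun h 1) 0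
    have h20 := congrFun (congrFun h 2) 0
    have h30 := congrFun (congrFun h 3) 0
    simp [Ri, Rj, Rk] at h10 h20 h30
    have e1 : b₁ = c₁.re + c₃.im := by exact_mod_cast h10
    have e3 : b₃ = c₃.re - c₁.im := by exact_mod_cast h30
    subst e1 h20 e3
    refine ⟨?_, by simp⟩
    apply Complex.ext <;> simp

/-- The complex-linear operator `r(ζ) = ½ (π(ζ) - i π(iζ))`, where `π` is the projection on `𝔤₀`
along `borel`; it acts on the rotation component of elements `(ζ, 0)`, `ζ ∈ 𝔤₀ ⊗ ℂ`. -/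
def rOp (p : AffC) : AffC :=
  ((1 / 2 : ℂ) • (projG0 p.1 - Complex.I • projG0 (Complex.I • p.1)), 0)

/-! ### Lifts and Maurer-Cartan forms -/

/-- `(F, X)` is a lifted conformal Lagrangian immersion (up to a constant left translation, which
does not change its Maurer-Cartan form): `F` is a smooth map to the rotation group and the plane
spanned by `(F ε₁, F ε₃)` has the same Lagrangian angle as the tangent plane of `X`. -/
structure IsLift (F : ℂ → Matrix (Fin 4) (Fin 4) ℝ) (X : ℂ → E4) : Prop where
  smooth : ∀ i j, ContDiff ℝ ∞ (fun z => F z i j)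
  mem_rotGroup : ∀ z, F z ∈ rotGroup
  angle : ∀ z,
    expAngle (‖fderiv ℝ X z 1‖⁻¹ • fderiv ℝ X z 1)
        (‖fderiv ℝ X z Complex.I‖⁻¹ • fderiv ℝ X z Complex.I)
      = expAngle (WithLp.toLp 2 fun i => F z i 0) (WithLp.toLp 2 fun i => F z i 2)

/-- The Maurer-Cartan form `α = U⁻¹ dU = (F⁻¹ dF, F⁻¹ dX)` of `U = (F, X)`, at the point `z` and
on the real tangent vector `v` (with values in `𝔤`, seen in the complexification). -/
def maurerCartan (F : ℂ → Matrix (Fin 4) (Fin 4) ℝ) (X : ℂ → E4) (z v : ℂ) : AffC :=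
  (((F z)⁻¹ * Matrix.of fun i j => fderiv ℝ (fun w => F w i j) z v).map Complex.ofReal,
    fun i => (((F z)⁻¹ *ᵥ fun j => fderiv ℝ X z v j) i : ℝ))

/-- `θ(∂/∂z) = ½ (θ(∂/∂x) - i θ(∂/∂y))` for a form `θ` at a point. -/
def onDz (θ : ℂ → AffC) : AffC := (1 / 2 : ℂ) • (θ 1 - Complex.I • θ Complex.I)

/-- `θ(∂/∂z̄) = ½ (θ(∂/∂x) + i θ(∂/∂y))` for a form `θ` at a point. -/
def onDzbar (θ : ℂ → AffC) : AffC := (1 / 2 : ℂ) • (θ 1 + Complex.I • θ Complex.I)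

/-- The extended form `α_μ = μ⁻² α₂' + μ⁻¹ α₋₁' + α₀ + μ α₁'' + μ² α₂''` evaluated on the real
tangent vector `v`, with `dz(v) = v`, `dz̄(v) = conj v`, `α' = α(∂/∂z) dz`, `α'' = α(∂/∂z̄) dz̄`. -/
def extended (θ : ℂ → AffC) (μ v : ℂ) : AffC :=
  (μ ^ (-2 : ℤ) * v) • eigProj 2 (onDz θ) + (μ ^ (-1 : ℤ) * v) • eigProj (-1) (onDz θ)
    + (v • eigProj 0 (onDz θ) + (starRingEnd ℂ v) • eigProj 0 (onDzbar θ))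
    + (μ * starRingEnd ℂ v) • eigProj 1 (onDzbar θ)
    + (μ ^ 2 * starRingEnd ℂ v) • eigProj 2 (onDzbar θ)

/-! ### Polynomial Killing fields and finite type -/

/-- The value at `μ` of the Laurent polynomial loop `∑_{n=-d}^{d} μⁿ cₙ`. -/
def loopEval (d : ℕ) (c : ℤ → AffC) (μ : ℂ) : AffC :=
  ∑ n ∈ Finset.Icc (-(d : ℤ)) d, (μ ^ n) • c n

/-- The loop `∑_{n=-d}^{d} μⁿ cₙ` belongs to the space of polynomial loops of degree `d` in the
twisted loop algebra of `𝔤`: on the unit circle it is `𝔤`-valued and `τ`-equivariant. -/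
def IsTwistedLoop (d : ℕ) (c : ℤ → AffC) : Prop :=
  ∀ μ : ℂ, ‖μ‖ = 1 →
    loopEval d c μ ∈ gReal ∧ loopEval d c (Complex.I * μ) = tau (loopEval d c μ)

/-- The differential of an `AffC`-valued map at `z` on the real tangent vector `v`. -/
def dAff (f : ℂ → AffC) (z v : ℂ) : AffC :=
  (Matrix.of fun i j => fderiv ℝ (fun w => (f w).1 i j) z v,
    fun i => fderiv ℝ (fun w => (f w).2 i) z v)

/-- `ξ_μ(z) = ∑_{n=-d}^{d} μⁿ ξ n z` is a polynomial Killing field of degree `d` adapted to the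
lift `(F, X)`. -/
structure IsAdaptedPolynomialKillingField (F : ℂ → Matrix (Fin 4) (Fin 4) ℝ) (X : ℂ → E4)
    (d : ℕ) (ξ : ℤ → ℂ → AffC) : Prop where
  smooth_rot : ∀ n i j, ContDiff ℝ ∞ (fun z => (ξ n z).1 i j)
  smooth_trans : ∀ n i, ContDiff ℝ ∞ (fun z => (ξ n z).2 i)
  twisted : ∀ z, IsTwistedLoop d (fun n => ξ n z)
  /-- the equation `dξ_μ = [ξ_μ, α_μ]` -/
  lax : ∀ μ : ℂ, μ ≠ 0 → ∀ z v : ℂ,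
    dAff (fun w => loopEval d (fun n => ξ n w) μ) z v
      = br (loopEval d (fun n => ξ n z) μ) (extended (maurerCartan F X z) μ v)
  adapted : ∀ z, onDz (maurerCartan F X z)
    = ξ (-(d : ℤ)) z + ξ (-(d : ℤ) + 1) z + rOp (ξ (-(d : ℤ) + 2) z)

/-- `X` is of finite type: for some lift of `X` and some `d ∈ 4ℕ + 2` there is an adapted
polynomial Killing field of degree `d`. -/
def IsFiniteType (X : ℂ → E4) : Prop :=
  ∃ F : ℂ → Matrix (Fin 4) (Fin 4) ℝ, IsLift F X ∧
    ∃ (m : ℕ) (ξ : ℤ → ℂ → AffC), IsAdaptedPolynomialKillingField F X (4 * m + 2) ξ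

end HamStat

end

noncomputable section

namespace HamStat

/-! Write β for the Lagrangian angle of X. The mean curvature vector of a Lagrangian immersion is
essentially J∇β, so the first variation of the area along `-J∇h` is minus the integral of Δβ · h(X);
stationarity makes this vanish for all h (`IsConfLag.integral_divMaslov_mul`). Since X need not be
injective, the values of Δβ at different preimages of one point could a priori cancel. They do not.
By Baire's theorem every nonempty open set contains a point z₀ near which X stays inside the sheet
around each other preimage of X z₀ (`IsConfLag.exists_generic`). Comparing two such sheets is a
conformal change of parameter, possibly orientation-reversing, and it multiplies Δβ by a positive
factor (`IsConfLag.divMaslov_comp`). A bump function in ℝ⁴ then detects the common sign, and Δβ = 0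
follows.

On a torus, Δβ = 0 makes ∂β/∂z a bounded entire function, so β is affine
(`IsConfLag.exists_affine_angle`). The lift F = exp(β Lᵢ/2) has the Maurer–Cartan form ((b dz + b̄
dz̄) Lᵢ, u dz + ū dz̄) with b constant, Lⱼ u = i u and the linear equation ∂u/∂z̄ = b Lᵢ ū
(`IsConfLag.dzb_spinor`). Hence ∂²u/∂z∂z̄ = -|b|² u.

The half angle makes u periodic only for the doubled lattice. Still, a Laplace eigenspace on a torus
involves finitely many characters, so a monic polynomial Q satisfies Q(∂²/∂z²) u = 0
(`exists_annihilator`). This is what makes the Killing field a polynomial. The field is sought with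
coefficients (ρₙ Lᵢ, tₙ), ρₙ constant; as multiples of Lᵢ commute, the Lax equation reduces to a
linear recursion for the tₙ (`IsKillingCoeff`). It is solved by the Horner quotients of Q applied to
u and their z-derivatives (`transSeq`): the sequence stops at n = -1 because Q(∂²/∂z²) u = 0, and at
n = -(4 deg Q + 2) because the higher quotients vanish. Adding the conjugate reflected sequence
makes the loop real. If b = 0, then u is constant and a loop of degree two suffices. -/

theorem two_le_infty : (2 : WithTop ℕ∞) ≤ ∞ := WithTop.coe_le_coe.2 le_top

/-! ### Directional and Wirtinger derivatives of smooth maps on the plane. -/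

section Calculus

variable {E F : Type*} [NormedAddCommGroup E] [NormedSpace ℝ E] [NormedAddCommGroup F]
  [NormedSpace ℝ F]

/-- The directional derivative of `f : ℂ → E` along the constant vector field `v`. -/
def dv (v : ℂ) (f : ℂ → E) : ℂ → E := fun z => fderiv ℝ f z v

theorem differentiableAt_of_smooth {f : ℂ → E} (hf : ContDiff ℝ ∞ f) (z : ℂ) :
    DifferentiableAt ℝ f z :=
  (hf.differentiable (by simp)) z

theorem contDiff_dv {f : ℂ → E} (hf : ContDiff ℝ ∞ f) (v : ℂ) : ContDiff ℝ ∞ (dv v f) :=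
  (hf.fderiv_right (m := ∞) (by simp)).clm_apply contDiff_const

theorem dv_add {f g : ℂ → E} (hf : ContDiff ℝ ∞ f) (hg : ContDiff ℝ ∞ g) (v : ℂ) :
    dv v (fun z => f z + g z) = fun z => dv v f z + dv v g z := by
  ext z
  simp [dv, fderiv_fun_add (differentiableAt_of_smooth hf z) (differentiableAt_of_smooth hg z)]

theorem dv_sub {f g : ℂ → E} (hf : ContDiff ℝ ∞ f) (hg : ContDiff ℝ ∞ g) (v : ℂ) :
    dv v (fun z => f z - g z) = fun z => dv v f z - dv v g z := by
  ext z
  simp [dv, fderiv_fun_sub (differentiableAt_of_smooth hf z) (differentiableAt_of_smooth hg z)]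

theorem dv_neg (f : ℂ → E) (v : ℂ) : dv v (fun z => -f z) = fun z => -dv v f z := by
  ext z
  simp [dv, fderiv_fun_neg]

theorem dv_const (c : E) (v : ℂ) : dv v (fun _ => c) = fun _ => 0 := by
  ext z
  simp [dv]

theorem dv_clm {f : ℂ → E} (hf : ContDiff ℝ ∞ f) (L : E →L[ℝ] F) (v : ℂ) :
    dv v (fun z => L (f z)) = fun z => L (dv v f z) := by
  ext z
  have := (L.hasFDerivAt.comp z (differentiableAt_of_smooth hf z).hasFDerivAt).fderiv
  simp only [Function.comp_def] at this
  simp [dv, this]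

theorem dv_const_smul {𝕜 : Type*} [NormedField 𝕜] [NormedSpace 𝕜 E] [SMulCommClass ℝ 𝕜 E]
    [ContinuousConstSMul 𝕜 E] {f : ℂ → E} (hf : ContDiff ℝ ∞ f) (c : 𝕜) (v : ℂ) :
    dv v (fun z => c • f z) = fun z => c • dv v f z := by
  ext z
  simp [dv, fderiv_fun_const_smul (differentiableAt_of_smooth hf z)]

theorem dv_mul {A : Type*} [NormedCommRing A] [NormedAlgebra ℝ A] {f g : ℂ → A}
    (hf : ContDiff ℝ ∞ f) (hg : ContDiff ℝ ∞ g) (v : ℂ) :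
    dv v (fun z => f z * g z) = fun z => dv v f z * g z + f z * dv v g z := by
  ext z
  simp [dv, fderiv_fun_mul (differentiableAt_of_smooth hf z) (differentiableAt_of_smooth hg z)]
  ring

theorem dv_comm {f : ℂ → E} (hf : ContDiff ℝ ∞ f) (v w : ℂ) :
    dv v (dv w f) = dv w (dv v f) := by
  have key : ∀ v w z, dv v (dv w f) z = fderiv ℝ (fderiv ℝ f) z v w := by
    intro v w z
    have h : DifferentiableAt ℝ (fderiv ℝ f) z :=
      ((hf.fderiv_right (m := ∞) (by simp)).differentiable (by simp)) z
    have h1 := h.hasFDerivAt.clm_apply (hasFDerivAt_const w z)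
    have h2 := h1.fderiv
    change fderiv ℝ (fun y => fderiv ℝ f y w) z v = _
    rw [h2]
    simp
  ext z
  rw [key, key]
  have := (hf.contDiffAt (x := z)).isSymmSndFDerivAt
    (by simpa using two_le_infty)
  exact this v w

theorem dv_eq_re_im (f : ℂ → E) (v z : ℂ) :
    dv v f z = v.re • dv 1 f z + v.im • dv Complex.I f z := by
  have : v = v.re • (1 : ℂ) + v.im • Complex.I := by
    simp [Complex.re_add_im]
  simp only [dv]
  conv_lhs => rw [this]
  rw [map_add, map_smul, map_smul]

theorem dv_periodic {f : ℂ → E} {γ : ℂ} (hf : ∀ z, f (z + γ) = f z) (v z : ℂ) :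
    dv v f (z + γ) = dv v f z := by
  simp only [dv]
  rw [← fderiv_comp_add_right]
  simp only [hf]

theorem dv_conj {f : ℂ → ℂ} (hf : ContDiff ℝ ∞ f) (v : ℂ) :
    dv v (fun z => starRingEnd ℂ (f z)) = fun z => starRingEnd ℂ (dv v f z) :=
  dv_clm hf Complex.conjCLE.toContinuousLinearMap v

theorem contDiff_conj {f : ℂ → ℂ} (hf : ContDiff ℝ ∞ f) :
    ContDiff ℝ ∞ (fun z => starRingEnd ℂ (f z)) :=
  Complex.conjCLE.toContinuousLinearMap.contDiff.comp hf

end Calculus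

section Wirtinger

variable {E F : Type*} [NormedAddCommGroup E] [NormedSpace ℂ E] [NormedAddCommGroup F]
  [NormedSpace ℂ F]

/-- The Wirtinger derivative `∂/∂z`. -/
def dz (f : ℂ → E) : ℂ → E :=
  fun z => (1 / 2 : ℂ) • (dv 1 f z - Complex.I • dv Complex.I f z)

/-- The Wirtinger derivative `∂/∂z̄`. -/
def dzb (f : ℂ → E) : ℂ → E :=
  fun z => (1 / 2 : ℂ) • (dv 1 f z + Complex.I • dv Complex.I f z)

theorem contDiff_const_smulC {f : ℂ → E} (hf : ContDiff ℝ ∞ f) (c : ℂ) :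
    ContDiff ℝ ∞ (fun z => c • f z) := by
  have : ContDiff ℝ ∞ (fun x : E => c • x) :=
    ((c • ContinuousLinearMap.id ℂ E).restrictScalars ℝ).contDiff
  exact this.comp hf

theorem contDiff_dz {f : ℂ → E} (hf : ContDiff ℝ ∞ f) : ContDiff ℝ ∞ (dz f) :=
  contDiff_const_smulC ((contDiff_dv hf _).sub (contDiff_const_smulC (contDiff_dv hf _) _)) _

theorem contDiff_dzb {f : ℂ → E} (hf : ContDiff ℝ ∞ f) : ContDiff ℝ ∞ (dzb f) :=
  contDiff_const_smulC ((contDiff_dv hf _).add (contDiff_const_smulC (contDiff_dv hf _) _)) _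

theorem dv_eq_dz_dzb (f : ℂ → E) (v z : ℂ) :
    dv v f z = v • dz f z + (starRingEnd ℂ v) • dzb f z := by
  rw [dv_eq_re_im]
  have h1 : ∀ x : E, v.re • x = (v.re : ℂ) • x := fun x => by simp
  have h2 : ∀ x : E, v.im • x = (v.im : ℂ) • x := fun x => by simp
  rw [h1, h2]
  have e1 : v = v.re + v.im * Complex.I := (Complex.re_add_im v).symm
  have e2 : starRingEnd ℂ v = v.re - v.im * Complex.I := by
    apply Complex.ext <;> simp
  have hI := Complex.I_mul_I
  simp only [dz, dzb]
  rw [e2]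
  generalize dv 1 f z = p
  generalize dv Complex.I f z = q
  conv_rhs => enter [1, 1]; rw [e1]
  match_scalars
  · ring
  · linear_combination (v.im : ℂ) * hI

theorem dz_add {f g : ℂ → E} (hf : ContDiff ℝ ∞ f) (hg : ContDiff ℝ ∞ g) :
    dz (fun z => f z + g z) = fun z => dz f z + dz g z := by
  ext z
  simp only [dz, dv_add hf hg]
  module

theorem dzb_add {f g : ℂ → E} (hf : ContDiff ℝ ∞ f) (hg : ContDiff ℝ ∞ g) :
    dzb (fun z => f z + g z) = fun z => dzb f z + dzb g z := by
  ext z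
  simp only [dzb, dv_add hf hg]
  module

theorem dz_const_smul {f : ℂ → E} (hf : ContDiff ℝ ∞ f) (c : ℂ) :
    dz (fun z => c • f z) = fun z => c • dz f z := by
  ext z
  simp only [dz, dv_const_smul hf]
  module

theorem dzb_const_smul {f : ℂ → E} (hf : ContDiff ℝ ∞ f) (c : ℂ) :
    dzb (fun z => c • f z) = fun z => c • dzb f z := by
  ext z
  simp only [dzb, dv_const_smul hf]
  module

theorem dz_clm {f : ℂ → E} (hf : ContDiff ℝ ∞ f) (L : E →L[ℂ] F) :
    dz (fun z => L (f z)) = fun z => L (dz f z) := by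
  ext z
  have := fun v => dv_clm hf (L.restrictScalars ℝ) v
  simp only [ContinuousLinearMap.coe_restrictScalars'] at this
  simp only [dz, this, map_smul, map_sub]

theorem dzb_clm {f : ℂ → E} (hf : ContDiff ℝ ∞ f) (L : E →L[ℂ] F) :
    dzb (fun z => L (f z)) = fun z => L (dzb f z) := by
  ext z
  have := fun v => dv_clm hf (L.restrictScalars ℝ) v
  simp only [ContinuousLinearMap.coe_restrictScalars'] at this
  simp only [dzb, this, map_smul, map_add]

theorem dz_const (c : E) : dz (fun _ => c) = fun _ => 0 := by
  ext z; simp [dz, dv_const]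

theorem dzb_const (c : E) : dzb (fun _ => c) = fun _ => 0 := by
  ext z; simp [dzb, dv_const]

theorem dz_dzb_comm {f : ℂ → E} (hf : ContDiff ℝ ∞ f) : dz (dzb f) = dzb (dz f) := by
  have h1 := contDiff_dv hf 1
  have h2 := contDiff_dv hf Complex.I
  have a1 : ∀ v, dv v (dzb f) = fun z => (1 / 2 : ℂ) • (dv v (dv 1 f) z
      + Complex.I • dv v (dv Complex.I f) z) := by
    intro v
    unfold dzb
    rw [dv_const_smul (h1.add (contDiff_const_smulC h2 _)), dv_add h1 (contDiff_const_smulC h2 _),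
      dv_const_smul h2]
  have a2 : ∀ v, dv v (dz f) = fun z => (1 / 2 : ℂ) • (dv v (dv 1 f) z
      - Complex.I • dv v (dv Complex.I f) z) := by
    intro v
    unfold dz
    rw [dv_const_smul (h1.sub (contDiff_const_smulC h2 _)), dv_sub h1 (contDiff_const_smulC h2 _),
      dv_const_smul h2]
  ext z
  conv_lhs => unfold dz
  conv_rhs => unfold dzb
  simp only [a1, a2, dv_comm hf Complex.I 1]
  module

/-- A smooth function with vanishing `∂/∂z̄` is holomorphic. -/
theorem differentiable_of_dzb_eq_zero {f : ℂ → ℂ} (hf : ContDiff ℝ ∞ f)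
    (h : ∀ z, dzb f z = 0) : Differentiable ℂ f := by
  intro z
  have hd := (differentiableAt_of_smooth hf z).hasFDerivAt
  have h2 : ((dz f z • (1 : ℂ →L[ℂ] ℂ)).restrictScalars ℝ) = fderiv ℝ f z := by
    refine ContinuousLinearMap.ext fun v => ?_
    have := dv_eq_dz_dzb f v z
    simp only [h, smul_zero, add_zero] at this
    simp only [dv] at this
    rw [this]
    simp [mul_comm]
  exact (hasFDerivAt_of_restrictScalars ℝ hd h2).differentiableAt

end Wirtinger

end HamStat

/-! ### Integration of periodic functions and Liouville's theorem. -/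

namespace HamStat

open MeasureTheory
open scoped Pointwise

/-- Periodicity with respect to the lattice spanned by a real basis of `ℂ`. -/
def IsPeriodic {E : Type*} (b : Module.Basis (Fin 2) ℝ ℂ) (f : ℂ → E) : Prop :=
  ∀ γ ∈ Submodule.span ℤ (Set.range b), ∀ z : ℂ, f (z + γ) = f z

section Torus

instance (b : Module.Basis (Fin 2) ℝ ℂ) :
    Countable (Submodule.span ℤ (Set.range b)).toAddSubgroup :=
  inferInstanceAs (Countable (Submodule.span ℤ (Set.range b)))

variable {E : Type*} {b : Module.Basis (Fin 2) ℝ ℂ}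

theorem IsPeriodic.fract {f : ℂ → E} (hf : IsPeriodic b f) (z : ℂ) :
    f (ZSpan.fract b z) = f z := by
  have h := hf _ (ZSpan.floor b z).2 (ZSpan.fract b z)
  rw [← h, ZSpan.fract_apply]
  simp

theorem isCompact_closure_fundamentalDomain (b : Module.Basis (Fin 2) ℝ ℂ) :
    IsCompact (closure (ZSpan.fundamentalDomain b)) :=
  (ZSpan.fundamentalDomain_isBounded b).isCompact_closure

variable [NormedAddCommGroup E]

theorem IsPeriodic.exists_bound {f : ℂ → E} (hf : IsPeriodic b f) (hc : Continuous f) :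
    ∃ C, ∀ z, ‖f z‖ ≤ C := by
  obtain ⟨C, hC⟩ := (isCompact_closure_fundamentalDomain b).exists_bound_of_continuousOn
    hc.continuousOn
  exact ⟨C, fun z => hf.fract z ▸ hC _ (subset_closure (ZSpan.fract_mem_fundamentalDomain b z))⟩

theorem integrableOn_fundamentalDomain {f : ℂ → E} (hc : Continuous f) :
    IntegrableOn f (ZSpan.fundamentalDomain b) :=
  (hc.continuousOn.integrableOn_compact (isCompact_closure_fundamentalDomain b)).mono_set
    subset_closure

theorem IsPeriodic.dv [NormedSpace ℝ E] {f : ℂ → E} (hf : IsPeriodic b f) (v : ℂ) :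
    IsPeriodic b (dv v f) :=
  fun γ hγ z => dv_periodic (hf γ hγ) v z

/-- A translate of a fundamental domain is again a fundamental domain, and a lattice-invariant
function has the same integral over both. -/
theorem IsPeriodic.integral_translate [NormedSpace ℝ E] {f : ℂ → E} (hf : IsPeriodic b f)
    (w : ℂ) :
    ∫ z in ZSpan.fundamentalDomain b, f (z + w) = ∫ z in ZSpan.fundamentalDomain b, f z := by
  have h0 : IsAddFundamentalDomain (Submodule.span ℤ (Set.range b)).toAddSubgroup
      (ZSpan.fundamentalDomain b) (volume : Measure ℂ) := ZSpan.isAddFundamentalDomain' b volume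
  have h1 := h0.vadd_of_comm w
  have hinv : ∀ (g : (Submodule.span ℤ (Set.range b)).toAddSubgroup) (x : ℂ), f (g +ᵥ x) = f x := by
    intro g x
    have := hf g g.2 x
    rw [← this, add_comm]
    rfl
  rw [h0.setIntegral_eq h1 hinv]
  have h2 := (measurePreserving_add_right (volume : Measure ℂ) w).setIntegral_image_emb
    (measurableEmbedding_addRight w) f (ZSpan.fundamentalDomain b)
  rw [← h2]
  have h3 : w +ᵥ ZSpan.fundamentalDomain b = (fun x => x + w) '' ZSpan.fundamentalDomain b := by
    refine Set.image_congr fun x _ => ?_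
    exact add_comm w x
  rw [h3]

/-- The integral of `f (z + s • v)` over the domain does not depend on s; differentiating under the
integral at s = 0 gives the claim without any boundary terms. -/
theorem IsPeriodic.integral_dv [NormedSpace ℝ E] [CompleteSpace E] {f : ℂ → E}
    (hf : IsPeriodic b f) (hs : ContDiff ℝ ∞ f) (v : ℂ) :
    ∫ z in ZSpan.fundamentalDomain b, HamStat.dv v f z = 0 := by
  have hc := (contDiff_dv hs v).continuous
  obtain ⟨C, hC⟩ := (hf.dv v).exists_bound hc
  have hfin : IsFiniteMeasure (volume.restrict (ZSpan.fundamentalDomain b) : Measure ℂ) :=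
    ⟨by simpa using (ZSpan.fundamentalDomain_isBounded b).measure_lt_top⟩
  have key := (hasDerivAt_integral_of_dominated_loc_of_deriv_le
    (μ := volume.restrict (ZSpan.fundamentalDomain b)) (x₀ := (0 : ℝ)) (s := Set.univ)
    (F := fun s z => f (z + s • v)) (F' := fun s z => HamStat.dv v f (z + s • v))
    (bound := fun _ => C) Filter.univ_mem
    (Filter.Eventually.of_forall fun s =>
      (hs.continuous.comp (continuous_add_const _)).aestronglyMeasurable)
    (by simpa using! integrableOn_fundamentalDomain hs.continuous)
    ((hc.comp (continuous_add_const _)).aestronglyMeasurable)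
    (Filter.Eventually.of_forall fun z s _ => hC _)
    (integrable_const C)
    (Filter.Eventually.of_forall fun z s _ => by
      have h1 := (differentiableAt_of_smooth hs (z + s • v)).hasFDerivAt
      have h2 : HasDerivAt (fun s : ℝ => z + s • v) v s := by
        simpa using ((hasDerivAt_id s).smul_const v).const_add z
      exact h1.comp_hasDerivAt s h2)).2
  have hconst : (fun s : ℝ => ∫ z in ZSpan.fundamentalDomain b, f (z + s • v))
      = fun _ => ∫ z in ZSpan.fundamentalDomain b, f z :=
    funext fun s => hf.integral_translate _
  rw [hconst] at key
  simpa using key.unique (hasDerivAt_const _ _)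

/-- Vanishing almost everywhere on the domain spreads to the whole plane by invariance of the zero
set, and then to every point by continuity. -/
theorem IsPeriodic.eq_zero_of_integral_eq_zero {f : ℂ → ℝ} (hf : IsPeriodic b f)
    (hc : Continuous f) (h0 : ∀ z, 0 ≤ f z) (hi : ∫ z in ZSpan.fundamentalDomain b, f z = 0) :
    ∀ z, f z = 0 := by
  have hd : IsAddFundamentalDomain (Submodule.span ℤ (Set.range b)).toAddSubgroup
      (ZSpan.fundamentalDomain b) (volume : Measure ℂ) := ZSpan.isAddFundamentalDomain' b volume
  have h1 := (integral_eq_zero_iff_of_nonneg (fun z => h0 z)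
    (integrableOn_fundamentalDomain (b := b) hc)).1 hi
  have h2 : volume ({z | f z ≠ 0} ∩ ZSpan.fundamentalDomain b) = 0 := by
    rw [← Measure.restrict_apply (isOpen_ne_fun hc continuous_const).measurableSet]
    exact h1
  have h3 : volume {z | f z ≠ 0} = 0 := by
    refine hd.measure_zero_of_invariant _ (fun g => ?_) h2
    ext x
    rw [Set.mem_vadd_set_iff_neg_vadd_mem]
    have := hf (-g) (-g).2 x
    simp only [Set.mem_ofPred_eq]
    rw [← this, add_comm]
    rfl
  have h4 : f =ᵐ[volume] fun _ => 0 := h3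
  exact congrFun ((Continuous.ae_eq_iff_eq volume hc continuous_const).1 h4)

end Torus

section Liouville

variable {b : Module.Basis (Fin 2) ℝ ℂ}

theorem IsPeriodic.const_of_dzb_eq_zero {f : ℂ → ℂ} (hf : IsPeriodic b f)
    (hs : ContDiff ℝ ∞ f) (h : ∀ z, dzb f z = 0) (z w : ℂ) : f z = f w := by
  obtain ⟨C, hC⟩ := hf.exists_bound hs.continuous
  refine (differentiable_of_dzb_eq_zero hs h).apply_eq_apply_of_bounded ?_ z w
  exact isBounded_iff_forall_norm_le.2 ⟨C, by rintro _ ⟨x, rfl⟩; exact hC x⟩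

end Liouville

end HamStat

/-! ### Fourier coefficients on the torus and finiteness of Laplace eigenspaces. -/

namespace HamStat

open MeasureTheory

section Fourier

variable {b : Module.Basis (Fin 2) ℝ ℂ}

/-- The projection of `ℂ` on the standard torus in the coordinates given by a basis. -/
def toTorus (b : Module.Basis (Fin 2) ℝ ℂ) (z : ℂ) : UnitAddTorus (Fin 2) :=
  fun i => (b.repr z i : UnitAddCircle)

theorem continuous_repr (b : Module.Basis (Fin 2) ℝ ℂ) (i : Fin 2) :
    Continuous fun z => b.repr z i :=
  (LinearMap.continuous_of_finiteDimensional (b.coord i) : _)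

theorem continuous_toTorus (b : Module.Basis (Fin 2) ℝ ℂ) : Continuous (toTorus b) :=
  continuous_pi fun i => (AddCircle.continuous_mk' 1).comp (continuous_repr b i)

theorem IsPeriodic.exists_lift {f : ℂ → ℂ} (hf : IsPeriodic b f) (hc : Continuous f) :
    ∃ g : C(UnitAddTorus (Fin 2), ℂ), ∀ z, g (toTorus b z) = f z := by
  have hq : IsOpenQuotientMap
      (Pi.map (fun (_ : Fin 2) (x : ℝ) => (x : UnitAddCircle))) :=
    IsOpenQuotientMap.piMap fun _ => QuotientAddGroup.isOpenQuotientMap_mk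
  let q : C(Fin 2 → ℝ, UnitAddTorus (Fin 2)) := ⟨_, hq.continuous⟩
  have hq' : Topology.IsQuotientMap q := hq.isQuotientMap
  have hcont : Continuous fun x : Fin 2 → ℝ => f (b.equivFun.symm x) :=
    hc.comp (LinearMap.continuous_of_finiteDimensional b.equivFun.symm.toLinearMap)
  have hfac : Function.FactorsThrough (⟨_, hcont⟩ : C(Fin 2 → ℝ, ℂ)) q := by
    intro x y hxy
    have h1 : ∀ i, ∃ n : ℤ, x i = y i + n := by
      intro i
      have h2 : (x i : UnitAddCircle) = (y i : UnitAddCircle) := congrFun hxy i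
      rw [← sub_eq_zero, ← AddCircle.coe_sub, AddCircle.coe_eq_zero_iff] at h2
      obtain ⟨n, hn⟩ := h2
      exact ⟨n, by simp only [zsmul_eq_mul, mul_one] at hn; linarith⟩
    choose n hn using h1
    have h3 : b.equivFun.symm x = b.equivFun.symm y + ∑ i, n i • b i := by
      simp only [Module.Basis.equivFun_symm_apply, hn, add_smul, Finset.sum_add_distrib]
      simp
    change f _ = f _
    rw [h3]
    exact hf _ (Submodule.sum_mem _ fun i _ =>
      Submodule.smul_mem _ _ (Submodule.subset_span ⟨i, rfl⟩)) _
  refine ⟨hq'.lift _ hfac, fun z => ?_⟩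
  have h := DFunLike.congr_fun (hq'.lift_comp _ hfac) (b.equivFun z)
  have h' : q (b.equivFun z) = toTorus b z := rfl
  rw [← h']
  refine h.trans ?_
  change f (b.equivFun.symm (b.equivFun z)) = f z
  rw [LinearEquiv.symm_apply_apply]

/-- Integration against f is a continuous functional on continuous functions of the standard torus.
It kills the characters, whose span is dense in the uniform norm, hence it is zero. -/
theorem IsPeriodic.eq_zero_of_coeff {f : ℂ → ℂ} (hf : IsPeriodic b f) (hc : Continuous f)
    (h : ∀ n : Fin 2 → ℤ,
      ∫ z in ZSpan.fundamentalDomain b, f z * UnitAddTorus.mFourier n (toTorus b z) = 0) :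
    ∀ z, f z = 0 := by
  have hfin : IsFiniteMeasure (volume.restrict (ZSpan.fundamentalDomain b) : Measure ℂ) :=
    ⟨by simpa using (ZSpan.fundamentalDomain_isBounded b).measure_lt_top⟩
  obtain ⟨C, hC⟩ := hf.exists_bound hc
  have hint : ∀ P : C(UnitAddTorus (Fin 2), ℂ),
      IntegrableOn (fun z => f z * P (toTorus b z)) (ZSpan.fundamentalDomain b) := fun P =>
    integrableOn_fundamentalDomain (hc.mul (P.continuous.comp (continuous_toTorus b)))
  let Λ : C(UnitAddTorus (Fin 2), ℂ) →L[ℂ] ℂ := LinearMap.mkContinuous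
    { toFun := fun P => ∫ z in ZSpan.fundamentalDomain b, f z * P (toTorus b z)
      map_add' := fun P R => by
        simp only [ContinuousMap.add_apply, mul_add]
        exact integral_add (hint P) (hint R)
      map_smul' := fun c P => by
        simp only [ContinuousMap.smul_apply, smul_eq_mul, RingHom.id_apply]
        rw [← integral_const_mul]
        congr 1; ext z; ring }
    (C * (volume.restrict (ZSpan.fundamentalDomain b)).real Set.univ) (fun P => by
      have : ∀ z, ‖f z * P (toTorus b z)‖ ≤ C * ‖P‖ := fun z => by
        rw [norm_mul]
        exact mul_le_mul (hC z) (P.norm_coe_le_norm _) (norm_nonneg _)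
          ((norm_nonneg _).trans (hC z))
      refine (norm_integral_le_of_norm_le_const (Filter.Eventually.of_forall this)).trans ?_
      exact le_of_eq (by ring))
  have hΛ : ∀ P, Λ P = ∫ z in ZSpan.fundamentalDomain b, f z * P (toTorus b z) := fun P => rfl
  have hker : ∀ P, Λ P = 0 := by
    intro P
    have h1 : (Submodule.span ℂ (Set.range (UnitAddTorus.mFourier (d := Fin 2)))) ≤
        LinearMap.ker Λ.toLinearMap := by
      rw [Submodule.span_le]
      rintro _ ⟨n, rfl⟩
      exact h n
    have h2 := Submodule.topologicalClosure_minimal _ h1 Λ.isClosed_ker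
    rw [UnitAddTorus.span_mFourier_closure_eq_top] at h2
    exact h2 (Submodule.mem_top (x := P))
  obtain ⟨g, hg⟩ := hf.exists_lift hc
  -- Tested on the conjugate of f itself, the functional gives the integral of |f|².
  have h1 := hker (star g)
  rw [hΛ] at h1
  have h2 : ∀ z, f z * (star g) (toTorus b z) = ((‖f z‖ ^ 2 : ℝ) : ℂ) := by
    intro z
    rw [ContinuousMap.star_apply, hg]
    simpa using Complex.mul_conj' (f z)
  simp only [h2] at h1
  rw [integral_complex_ofReal] at h1
  have hp : IsPeriodic b fun z => ‖f z‖ ^ 2 := fun γ hγ z => by simp only [hf γ hγ z]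
  have h3 := hp.eq_zero_of_integral_eq_zero (hc.norm.pow 2) (fun z => by positivity)
    (by exact_mod_cast h1)
  intro z
  simpa using h3 z

/-- The linear form `z ↦ ∑ i, n i * zᵢ` in the coordinates given by a basis. -/
def dualForm (b : Module.Basis (Fin 2) ℝ ℂ) (n : Fin 2 → ℤ) : ℂ →L[ℝ] ℝ :=
  LinearMap.toContinuousLinearMap (∑ i, (n i : ℝ) • b.coord i)

theorem dualForm_basis (n : Fin 2 → ℤ) (i : Fin 2) : dualForm b n (b i) = n i := by
  fin_cases i <;> simp [dualForm, Fin.sum_univ_two]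

theorem mFourier_toTorus (n : Fin 2 → ℤ) (z : ℂ) :
    UnitAddTorus.mFourier n (toTorus b z) =
      Complex.exp (2 * Real.pi * Complex.I * dualForm b n z) := by
  simp only [UnitAddTorus.mFourier, toTorus, ContinuousMap.coe_mk, Fin.prod_univ_two,
    fourier_coe_apply, ← Complex.exp_add]
  congr 1
  simp [dualForm, Fin.sum_univ_two]
  ring

/-- The frequency of a character with respect to `∂/∂z`. -/
def freq (b : Module.Basis (Fin 2) ℝ ℂ) (n : Fin 2 → ℤ) : ℂ :=
  Real.pi * Complex.I * (dualForm b n 1 - Complex.I * dualForm b n Complex.I)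

theorem contDiff_character (n : Fin 2 → ℤ) :
    ContDiff ℝ ∞ fun z => UnitAddTorus.mFourier n (toTorus b z) := by
  simp only [mFourier_toTorus]
  exact (contDiff_const.mul (Complex.ofRealCLM.contDiff.comp (dualForm b n).contDiff)).cexp

theorem isPeriodic_character (n : Fin 2 → ℤ) :
    IsPeriodic b fun z => UnitAddTorus.mFourier n (toTorus b z) := by
  intro γ hγ z
  have : toTorus b (z + γ) = toTorus b z := by
    funext i
    obtain ⟨m, hm⟩ : ∃ m : ℤ, b.repr γ i = m := by
      have := (b.mem_span_iff_repr_mem ℤ γ).1 hγ i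
      obtain ⟨m, hm⟩ := this
      exact ⟨m, by simpa using hm.symm⟩
    simp only [toTorus, map_add, Finsupp.coe_add, Pi.add_apply, hm]
    rw [← sub_eq_zero, ← AddCircle.coe_sub, AddCircle.coe_eq_zero_iff]
    exact ⟨m, by simp⟩
  simp only [this]

theorem dv_character (n : Fin 2 → ℤ) (v z : ℂ) :
    dv v (fun z => UnitAddTorus.mFourier n (toTorus b z)) z =
      2 * Real.pi * Complex.I * dualForm b n v * UnitAddTorus.mFourier n (toTorus b z) := by
  simp only [mFourier_toTorus, dv]
  have h1 : HasFDerivAt (fun z : ℂ => 2 * Real.pi * Complex.I * (dualForm b n z : ℂ))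
      ((2 * Real.pi * Complex.I : ℂ) • (Complex.ofRealCLM ∘L dualForm b n)) z :=
    ((Complex.ofRealCLM ∘L dualForm b n).hasFDerivAt).const_smul (2 * Real.pi * Complex.I : ℂ)
  rw [h1.cexp.fderiv]
  simp
  ring

theorem normSq_freq (n : Fin 2 → ℤ) :
    Complex.normSq (freq b n) =
      Real.pi ^ 2 * (dualForm b n 1 ^ 2 + dualForm b n Complex.I ^ 2) := by
  simp [freq, Complex.normSq_apply]
  ring

/-- The integers `n i` are the values of the dual form on the basis vectors, so Cauchy–Schwarz
bounds them once the length of the form is fixed. -/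
theorem finite_freq (b : Module.Basis (Fin 2) ℝ ℂ) (μ : ℝ) :
    {n : Fin 2 → ℤ | Complex.normSq (freq b n) = μ}.Finite := by
  have hpi := Real.pi_pos
  have hb : ∀ n : Fin 2 → ℤ, Complex.normSq (freq b n) = μ → ∀ i,
      (n i : ℝ) ^ 2 ≤ Complex.normSq (b i) * (μ / Real.pi ^ 2) := by
    intro n hn i
    rw [normSq_freq] at hn
    have h1 : (n i : ℝ) = (b i).re * dualForm b n 1 + (b i).im * dualForm b n Complex.I := by
      rw [← dualForm_basis (b := b)]
      conv_lhs => rw [← Complex.re_add_im (b i),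
        show ((b i).re : ℂ) + (b i).im * Complex.I = (b i).re • (1 : ℂ) + (b i).im • Complex.I by
          simp]
      rw [map_add, map_smul, map_smul, smul_eq_mul, smul_eq_mul]
    have h2 : μ / Real.pi ^ 2 = dualForm b n 1 ^ 2 + dualForm b n Complex.I ^ 2 := by
      rw [← hn]; field_simp
    rw [h1, h2, Complex.normSq_apply]
    nlinarith [sq_nonneg ((b i).re * dualForm b n Complex.I - (b i).im * dualForm b n 1)]
  refine Set.Finite.subset (Set.Finite.pi' (t := fun i => {m : ℤ | (m : ℝ) ^ 2 ≤
    Complex.normSq (b i) * (μ / Real.pi ^ 2)}) fun i => ?_) (fun n hn i => Set.mem_ofPred_eq ▸ hb n hn i)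
  obtain ⟨N, hN⟩ := exists_nat_ge (Complex.normSq (b i) * (μ / Real.pi ^ 2))
  refine (Set.finite_Icc (-(N : ℤ)) N).subset fun m hm => ?_
  have h3 : (m : ℝ) ^ 2 ≤ N := le_trans hm hN
  have h4 : m ^ 2 ≤ (N : ℤ) := by exact_mod_cast h3
  constructor <;> nlinarith

theorem IsPeriodic.dz {f : ℂ → ℂ} (hf : IsPeriodic b f) : IsPeriodic b (dz f) :=
  fun γ hγ z => by simp only [HamStat.dz, hf.dv _ γ hγ z]

theorem IsPeriodic.dzb {f : ℂ → ℂ} (hf : IsPeriodic b f) : IsPeriodic b (dzb f) :=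
  fun γ hγ z => by simp only [HamStat.dzb, hf.dv _ γ hγ z]

theorem IsPeriodic.mul {f g : ℂ → ℂ} (hf : IsPeriodic b f) (hg : IsPeriodic b g) :
    IsPeriodic b fun z => f z * g z :=
  fun γ hγ z => by simp only [hf γ hγ z, hg γ hγ z]

theorem IsPeriodic.integral_dv_mul {f g : ℂ → ℂ} (hf : IsPeriodic b f) (hg : IsPeriodic b g)
    (hfs : ContDiff ℝ ∞ f) (hgs : ContDiff ℝ ∞ g) (v : ℂ) :
    ∫ z in ZSpan.fundamentalDomain b, HamStat.dv v f z * g z =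
      -∫ z in ZSpan.fundamentalDomain b, f z * HamStat.dv v g z := by
  have h := (hf.mul hg).integral_dv (hfs.mul hgs) v
  rw [dv_mul hfs hgs] at h
  have h1 : Continuous fun z => HamStat.dv v f z * g z :=
    (contDiff_dv hfs v).continuous.mul hgs.continuous
  have h2 : Continuous fun z => f z * HamStat.dv v g z :=
    hfs.continuous.mul (contDiff_dv hgs v).continuous
  have h3 := integral_add (integrableOn_fundamentalDomain (b := b) h1)
    (integrableOn_fundamentalDomain (b := b) h2)
  exact eq_neg_of_add_eq_zero_left (h3.symm.trans h)

/-- The Fourier coefficient of a periodic function. -/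
def coeff (b : Module.Basis (Fin 2) ℝ ℂ) (f : ℂ → ℂ) (n : Fin 2 → ℤ) : ℂ :=
  ∫ z in ZSpan.fundamentalDomain b, f z * UnitAddTorus.mFourier n (toTorus b z)

theorem coeff_dv {f : ℂ → ℂ} (hf : IsPeriodic b f) (hs : ContDiff ℝ ∞ f) (n : Fin 2 → ℤ)
    (v : ℂ) : coeff b (dv v f) n = -(2 * Real.pi * Complex.I * dualForm b n v) * coeff b f n := by
  unfold coeff
  rw [hf.integral_dv_mul (isPeriodic_character n) hs (contDiff_character n), neg_mul,
    ← integral_const_mul]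
  congr 2
  ext z
  rw [dv_character]
  ring

theorem coeff_lincomb {f g : ℂ → ℂ} (hf : Continuous f) (hg : Continuous g) (n : Fin 2 → ℤ)
    (c c' : ℂ) :
    coeff b (fun z => c * f z + c' * g z) n = c * coeff b f n + c' * coeff b g n := by
  have hχ := (contDiff_character (b := b) n).continuous
  have h1 : Continuous fun z => c * (f z * UnitAddTorus.mFourier n (toTorus b z)) :=
    continuous_const.mul (hf.mul hχ)
  have h2 : Continuous fun z => c' * (g z * UnitAddTorus.mFourier n (toTorus b z)) :=
    continuous_const.mul (hg.mul hχ)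
  unfold coeff
  rw [← integral_const_mul, ← integral_const_mul]
  refine Eq.trans ?_ (integral_add (integrableOn_fundamentalDomain (b := b) h1)
    (integrableOn_fundamentalDomain (b := b) h2))
  congr 1
  ext z
  ring

theorem coeff_dz {f : ℂ → ℂ} (hf : IsPeriodic b f) (hs : ContDiff ℝ ∞ f) (n : Fin 2 → ℤ) :
    coeff b (dz f) n = -freq b n * coeff b f n := by
  have h : dz f = fun z => (1 / 2 : ℂ) * dv 1 f z + (-(Complex.I / 2)) * dv Complex.I f z := by
    ext z; simp [dz]; ring
  rw [h, coeff_lincomb (contDiff_dv hs _).continuous (contDiff_dv hs _).continuous,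
    coeff_dv hf hs, coeff_dv hf hs]
  simp only [freq]
  ring

theorem coeff_dzb {f : ℂ → ℂ} (hf : IsPeriodic b f) (hs : ContDiff ℝ ∞ f) (n : Fin 2 → ℤ) :
    coeff b (dzb f) n = starRingEnd ℂ (freq b n) * coeff b f n := by
  have h : dzb f = fun z => (1 / 2 : ℂ) * dv 1 f z + (Complex.I / 2) * dv Complex.I f z := by
    ext z; simp [dzb]; ring
  rw [h, coeff_lincomb (contDiff_dv hs _).continuous (contDiff_dv hs _).continuous,
    coeff_dv hf hs, coeff_dv hf hs]
  simp [freq]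
  ring

theorem contDiff_iterate_dz {E : Type*} [NormedAddCommGroup E] [NormedSpace ℂ E] {f : ℂ → E}
    (hs : ContDiff ℝ ∞ f) (k : ℕ) : ContDiff ℝ ∞ (dz^[k] f) := by
  induction k with
  | zero => exact hs
  | succ k ih => rw [Function.iterate_succ_apply']; exact contDiff_dz ih

theorem IsPeriodic.iterate_dz {f : ℂ → ℂ} (hf : IsPeriodic b f) (k : ℕ) :
    IsPeriodic b (HamStat.dz^[k] f) := by
  induction k with
  | zero => exact hf
  | succ k ih => rw [Function.iterate_succ_apply']; exact ih.dz

theorem coeff_iterate_dz {f : ℂ → ℂ} (hf : IsPeriodic b f) (hs : ContDiff ℝ ∞ f)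
    (n : Fin 2 → ℤ) (k : ℕ) : coeff b (dz^[k] f) n = (-freq b n) ^ k * coeff b f n := by
  induction k with
  | zero => simp
  | succ k ih =>
    rw [Function.iterate_succ_apply', coeff_dz (hf.iterate_dz k) (contDiff_iterate_dz hs k), ih]
    ring

/-- Periodic eigenfunctions of the Laplacian for a given eigenvalue are annihilated by a common
monic polynomial in `∂²/∂z²`. -/
theorem exists_annihilator (b : Module.Basis (Fin 2) ℝ ℂ) (μ : ℝ) :
    ∃ Q : Polynomial ℂ, Q.Monic ∧ ∀ f : ℂ → ℂ, IsPeriodic b f → ContDiff ℝ ∞ f →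
      (∀ z, dz (dzb f) z = -(μ : ℂ) * f z) →
      ∀ z, ∑ k ∈ Finset.range (Q.natDegree + 1), Q.coeff k * dz^[2 * k] f z = 0 := by
  classical
  -- Q has the squared frequencies on the circle |ω|² = μ as roots. Working with ∂²/∂z² makes the
  -- sign in `coeff_dz` irrelevant.
  let S := (finite_freq b μ).toFinset
  refine ⟨∏ n ∈ S, (Polynomial.X - Polynomial.C (freq b n ^ 2)),
    Polynomial.monic_prod_of_monic _ _ fun n _ => Polynomial.monic_X_sub_C _, ?_⟩
  set Q := ∏ n ∈ S, (Polynomial.X - Polynomial.C (freq b n ^ 2)) with hQ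
  intro f hf hs hlap
  have hper : IsPeriodic b fun z =>
      ∑ k ∈ Finset.range (Q.natDegree + 1), Q.coeff k * dz^[2 * k] f z :=
    fun γ hγ z => Finset.sum_congr rfl fun k _ => by rw [hf.iterate_dz _ γ hγ z]
  have hcont : ∀ k, Continuous fun z => Q.coeff k * dz^[2 * k] f z := fun k =>
    continuous_const.mul (contDiff_iterate_dz hs _).continuous
  refine hper.eq_zero_of_coeff (continuous_finsetSum _ fun k _ => hcont k) fun n => ?_
  have hχ := (contDiff_character (b := b) n).continuous
  have h1 : ∫ z in ZSpan.fundamentalDomain b,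
      (∑ k ∈ Finset.range (Q.natDegree + 1), Q.coeff k * dz^[2 * k] f z) *
        UnitAddTorus.mFourier n (toTorus b z) = Q.eval (freq b n ^ 2) * coeff b f n := by
    have hint : ∀ k, IntegrableOn (fun z => Q.coeff k * dz^[2 * k] f z *
        UnitAddTorus.mFourier n (toTorus b z)) (ZSpan.fundamentalDomain b) :=
      fun k => integrableOn_fundamentalDomain ((hcont k).mul hχ)
    simp only [Finset.sum_mul]
    rw [integral_finsetSum _ fun k _ => hint k,
      Polynomial.eval_eq_sum_range, Finset.sum_mul]
    refine Finset.sum_congr rfl fun k _ => ?_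
    have h2 := coeff_iterate_dz hf hs n (2 * k)
    rw [pow_mul, neg_sq] at h2
    rw [mul_assoc, ← h2]
    unfold coeff
    rw [← integral_const_mul]
    congr 1
    ext z
    ring
  rw [h1]
  -- On Fourier coefficients ∂²/∂z∂z̄ is multiplication by -|ω|². So either the frequency lies on
  -- the circle and Q kills it, or the coefficient is already zero.
  have h3 : (μ - Complex.normSq (freq b n) : ℂ) * coeff b f n = 0 := by
    have h4 := coeff_dz hf.dzb (contDiff_dzb hs) n
    rw [coeff_dzb hf hs, funext hlap] at h4
    have h5 := coeff_lincomb (b := b) hs.continuous hs.continuous n (-(μ : ℂ)) 0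
    simp only [zero_mul, add_zero] at h5
    rw [h5] at h4
    rw [← Complex.mul_conj]
    linear_combination -h4
  rcases mul_eq_zero.1 h3 with h | h
  · have hn : n ∈ S := by
      simp only [S, Set.Finite.mem_toFinset, Set.mem_ofPred_eq]
      exact_mod_cast (sub_eq_zero.1 h).symm
    rw [hQ, Polynomial.eval_prod, Finset.prod_eq_zero hn (by simp), zero_mul]
  · rw [h, mul_zero]

end Fourier

end HamStat

/-! ### First variation of the area, and complex coordinates on ℝ⁴. -/

namespace HamStat

open MeasureTheory

section FirstVariation

variable {b : Module.Basis (Fin 2) ℝ ℂ}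

/-- The squared area density of the parallelogram spanned by `x + t v` and `y + t w`. -/
def gram (x y v w : E4) (t : ℝ) : ℝ :=
  ‖x + t • v‖ ^ 2 * ‖y + t • w‖ ^ 2 - (inner ℝ (x + t • v) (y + t • w)) ^ 2

/-- The derivative of `gram` with respect to `t`. -/
def gramDeriv (x y v w : E4) (t : ℝ) : ℝ :=
  2 * inner ℝ (x + t • v) v * ‖y + t • w‖ ^ 2 + ‖x + t • v‖ ^ 2 * (2 * inner ℝ (y + t • w) w)
    - 2 * inner ℝ (x + t • v) (y + t • w)
      * (inner ℝ (x + t • v) w + inner ℝ v (y + t • w))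

theorem hasDerivAt_gram (x y v w : E4) (t : ℝ) :
    HasDerivAt (gram x y v w) (gramDeriv x y v w t) t := by
  have h1 : ∀ x v : E4, HasDerivAt (fun t : ℝ => x + t • v) v t := fun x v => by
    simpa using ((hasDerivAt_id t).smul_const v).const_add x
  have h2 := ((h1 x v).norm_sq.mul (h1 y w).norm_sq).sub (((h1 x v).inner ℝ (h1 y w)).pow 2)
  refine h2.congr_deriv ?_
  simp only [gramDeriv]
  norm_num

/-- The square root is differentiable only where the density is positive. Compactness of the closed
domain gives one time interval on which positivity holds at all points, with a uniform bound for the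
derivative. -/
theorem hasDerivAt_integral_sqrt {p p' : ℝ → ℂ → ℝ}
    (hpc : Continuous fun q : ℝ × ℂ => p q.1 q.2) (hpc' : Continuous fun q : ℝ × ℂ => p' q.1 q.2)
    (hpos : ∀ z, 0 < p 0 z) (hd : ∀ t z, HasDerivAt (fun t => p t z) (p' t z) t) :
    HasDerivAt (fun t : ℝ => ∫ z in ZSpan.fundamentalDomain b, Real.sqrt (p t z))
      (∫ z in ZSpan.fundamentalDomain b, p' 0 z / (2 * Real.sqrt (p 0 z))) 0 := by
  have hK := isCompact_closure_fundamentalDomain b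
  obtain ⟨δ, hδ, hδp⟩ : ∃ δ > 0, ∀ t ∈ Metric.closedBall (0 : ℝ) δ,
      ∀ z ∈ closure (ZSpan.fundamentalDomain b), 0 < p t z := by
    have h1 : ∀ᶠ t in nhds (0 : ℝ), ∀ z ∈ closure (ZSpan.fundamentalDomain b), 0 < p t z := by
      refine hK.eventually_forall_of_forall_eventually fun z _ => ?_
      exact hpc.continuousAt.eventually (lt_mem_nhds (hpos z))
    obtain ⟨δ, hδ, h2⟩ := Metric.eventually_nhds_iff_ball.1 h1
    exact ⟨δ / 2, by positivity, fun t ht => h2 t (Metric.closedBall_subset_ball (by linarith) ht)⟩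
  obtain ⟨C, hC⟩ := ((isCompact_closedBall (0 : ℝ) δ).prod hK).exists_bound_of_continuousOn
    (f := fun q : ℝ × ℂ => p' q.1 q.2 / (2 * Real.sqrt (p q.1 q.2)))
    (hpc'.continuousOn.div (continuous_const.mul hpc.sqrt).continuousOn fun q hq => by
      have := Real.sqrt_pos.2 (hδp q.1 hq.1 q.2 hq.2)
      positivity)
  have hmeas : MeasurableSet (ZSpan.fundamentalDomain b) := ZSpan.fundamentalDomain_measurableSet b
  have hcs : ∀ t : ℝ, Continuous fun z => Real.sqrt (p t z) := fun t =>
    (hpc.comp (Continuous.prodMk_right t)).sqrt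
  have hcs' : ∀ t : ℝ, Continuous fun z => p' t z := fun t =>
    (hpc'.comp (Continuous.prodMk_right t))
  have hfin : IsFiniteMeasure (volume.restrict (ZSpan.fundamentalDomain b) : Measure ℂ) :=
    ⟨by simpa using (ZSpan.fundamentalDomain_isBounded b).measure_lt_top⟩
  exact (hasDerivAt_integral_of_dominated_loc_of_deriv_le
    (μ := volume.restrict (ZSpan.fundamentalDomain b)) (x₀ := (0 : ℝ))
    (s := Metric.closedBall (0 : ℝ) δ)
    (F := fun t z => Real.sqrt (p t z)) (F' := fun t z => p' t z / (2 * Real.sqrt (p t z)))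
    (bound := fun _ => C) (Metric.closedBall_mem_nhds _ hδ)
    (Filter.Eventually.of_forall fun t => (hcs t).aestronglyMeasurable)
    (integrableOn_fundamentalDomain (hcs 0))
    (((hcs' 0).measurable.div (measurable_const.mul (hcs 0).measurable)).aestronglyMeasurable)
    (ae_restrict_of_forall_mem hmeas fun z hz t ht => hC (t, z) ⟨ht, subset_closure hz⟩)
    (integrable_const C)
    (ae_restrict_of_forall_mem hmeas fun z hz t ht =>
      (hd t z).sqrt (hδp t ht z (subset_closure hz)).ne')).2

theorem area_add_smul {X V : ℂ → E4} (hX : ContDiff ℝ ∞ X) (hV : ContDiff ℝ ∞ V) (t : ℝ) :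
    area b (fun z => X z + t • V z) = ∫ z in ZSpan.fundamentalDomain b,
      Real.sqrt (gram (dv 1 X z) (dv Complex.I X z) (dv 1 V z) (dv Complex.I V z) t) := by
  have : ∀ v z, fderiv ℝ (fun z => X z + t • V z) z v = dv v X z + t • dv v V z := by
    intro v z
    have hs : ContDiff ℝ ∞ fun z => t • V z := hV.const_smul t
    have h1 := congrFun (dv_add hX hs v) z
    have h2 := congrFun (dv_const_smul hV t v) z
    exact h1.trans (congrArg _ h2)
  simp only [area, gram, this]

/-- At a conformal map the area density is |∂X/∂x|², and its factor cancels in the derivative of the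
square root: area and Dirichlet energy have the same first variation. -/
theorem hasDerivAt_area {X V : ℂ → E4} (hX : ContDiff ℝ ∞ X) (hV : ContDiff ℝ ∞ V)
    (hpos : ∀ z, dv 1 X z ≠ 0) (hnorm : ∀ z, ‖dv 1 X z‖ = ‖dv Complex.I X z‖)
    (horth : ∀ z, inner ℝ (dv 1 X z) (dv Complex.I X z) = 0) :
    HasDerivAt (fun t : ℝ => area b (fun z => X z + t • V z))
      (∫ z in ZSpan.fundamentalDomain b,
        (inner ℝ (dv 1 X z) (dv 1 V z) + inner ℝ (dv Complex.I X z) (dv Complex.I V z))) 0 := by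
  have c1 := (contDiff_dv hX 1).continuous
  have c2 := (contDiff_dv hX Complex.I).continuous
  have c3 := (contDiff_dv hV 1).continuous
  have c4 := (contDiff_dv hV Complex.I).continuous
  have hp0 : ∀ z, gram (dv 1 X z) (dv Complex.I X z) (dv 1 V z) (dv Complex.I V z) 0
      = (‖dv 1 X z‖ ^ 2) ^ 2 := by
    intro z
    simp only [gram, zero_smul, add_zero, horth, ← hnorm]
    ring
  have key := hasDerivAt_integral_sqrt (b := b)
    (p := fun t z => gram (dv 1 X z) (dv Complex.I X z) (dv 1 V z) (dv Complex.I V z) t)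
    (p' := fun t z => gramDeriv (dv 1 X z) (dv Complex.I X z) (dv 1 V z) (dv Complex.I V z) t)
    (by unfold gram; fun_prop) (by unfold gramDeriv; fun_prop)
    (fun z => by
      rw [hp0]
      have := norm_pos_iff.2 (hpos z)
      positivity)
    (fun t z => hasDerivAt_gram _ _ _ _ t)
  simp only [area_add_smul hX hV]
  refine key.congr_deriv ?_
  congr 1
  funext z
  rw [hp0, Real.sqrt_sq (by positivity)]
  have h3 := norm_pos_iff.2 (hpos z)
  simp only [gramDeriv, zero_smul, add_zero, horth, ← hnorm]
  rw [real_inner_comm]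
  field_simp
  simp [real_inner_comm]

end FirstVariation

section ComplexCoordinates

/-- The first complex coordinate of `ℝ⁴ ≃ ℂ²`. -/
def c₁ : E4 →L[ℝ] ℂ := LinearMap.toContinuousLinearMap
  { toFun := fun x => (x 0 : ℂ) + Complex.I * x 1
    map_add' := fun x y => by simp; ring
    map_smul' := fun t x => by simp; ring }

/-- The second complex coordinate of `ℝ⁴ ≃ ℂ²`. -/
def c₂ : E4 →L[ℝ] ℂ := LinearMap.toContinuousLinearMap
  { toFun := fun x => (x 2 : ℂ) + Complex.I * x 3
    map_add' := fun x y => by simp; ring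
    map_smul' := fun t x => by simp; ring }

theorem c₁_apply (x : E4) : c₁ x = (x 0 : ℂ) + Complex.I * x 1 := rfl

theorem c₂_apply (x : E4) : c₂ x = (x 2 : ℂ) + Complex.I * x 3 := rfl

theorem E4_ext {x y : E4} (h₁ : c₁ x = c₁ y) (h₂ : c₂ x = c₂ y) : x = y := by
  have a := congrArg Complex.re h₁
  have b := congrArg Complex.im h₁
  have c := congrArg Complex.re h₂
  have d := congrArg Complex.im h₂
  simp [c₁_apply, c₂_apply] at a b c d
  ext i
  fin_cases i <;> assumption

theorem inner_eq_re (x y : E4) :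
    inner ℝ x y = (starRingEnd ℂ (c₁ x) * c₁ y + starRingEnd ℂ (c₂ x) * c₂ y).re := by
  simp [c₁_apply, c₂_apply, PiLp.inner_apply, Fin.sum_univ_four]
  ring

theorem sympl_eq_im (x y : E4) :
    sympl x y = (starRingEnd ℂ (c₁ x) * c₁ y + starRingEnd ℂ (c₂ x) * c₂ y).im := by
  simp [c₁_apply, c₂_apply, sympl]
  ring

theorem norm_sq_eq (x : E4) : ‖x‖ ^ 2 = Complex.normSq (c₁ x) + Complex.normSq (c₂ x) := by
  rw [← real_inner_self_eq_norm_sq, inner_eq_re]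
  simp [Complex.normSq_apply]

theorem expAngle_eq (x y : E4) : expAngle x y = c₁ x * c₂ y - c₁ y * c₂ x := rfl

theorem c₁_J (x : E4) : c₁ (J x) = Complex.I * c₁ x := by
  apply Complex.ext <;> simp [c₁_apply, J]

theorem c₂_J (x : E4) : c₂ (J x) = Complex.I * c₂ x := by
  apply Complex.ext <;> simp [c₂_apply, J]

theorem inner_J_left (x y : E4) : inner ℝ (J x) y = -inner ℝ x (J y) := by
  simp only [inner_eq_re, c₁_J, c₂_J]
  simp
  ring

theorem J_J (x : E4) : J (J x) = -x := by
  apply E4_ext <;> simp [c₁_J, c₂_J, ← mul_assoc]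

/-- The complex structure as a continuous linear map. -/
def JL : E4 →L[ℝ] E4 := LinearMap.toContinuousLinearMap
  { toFun := J
    map_add' := fun x y => by apply E4_ext <;> simp [c₁_J, c₂_J, mul_add]
    map_smul' := fun t x => by
      apply E4_ext <;> simp [c₁_J, c₂_J] <;> ring }

end ComplexCoordinates

end HamStat

/-! ### The Lagrangian angle of a conformal Lagrangian immersion and its mean curvature. -/

namespace HamStat

open MeasureTheory

/-- A smooth conformal Lagrangian immersion, in terms of the partial derivatives. -/
structure IsConfLag (X : ℂ → E4) : Prop where
  smooth : ContDiff ℝ ∞ X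
  pos : ∀ z, 0 < ‖dv 1 X z‖
  norm_eq : ∀ z, ‖dv 1 X z‖ = ‖dv Complex.I X z‖
  orth : ∀ z, inner ℝ (dv 1 X z) (dv Complex.I X z) = 0
  lag : ∀ z, sympl (dv 1 X z) (dv Complex.I X z) = 0

theorem isConfLag_of_conformal {X : ℂ → E4} (hs : ContDiff ℝ ∞ X) (hc : Conformal X)
    (hl : IsLagrangian X) : IsConfLag X := by
  have key : ∀ z, ∃ c : ℝ, c ≠ 0 ∧ ∃ li : ℂ →ₗᵢ[ℝ] E4, ∀ v, dv v X z = c • li v := by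
    intro z
    obtain ⟨f', hf', c, hc0, li, rfl⟩ := hc z
    refine ⟨c, hc0, li, fun v => ?_⟩
    simp [dv, hf'.fderiv]
  refine ⟨hs, fun z => ?_, fun z => ?_, fun z => ?_, fun z => hl z 1 Complex.I⟩
  all_goals obtain ⟨c, hc0, li, h⟩ := key z; simp only [h, norm_smul, li.norm_map]
  · simpa using hc0
  · simp
  · rw [inner_smul_left, inner_smul_right, li.inner_map_map]
    simp

/-- The function `exp (iβ)`, where `β` is the Lagrangian angle of `X`. -/
def phase (X : ℂ → E4) (z : ℂ) : ℂ :=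
  ((‖dv 1 X z‖ ^ 2 : ℝ) : ℂ)⁻¹ * expAngle (dv 1 X z) (dv Complex.I X z)

/-- The differential of the Lagrangian angle of `X`, evaluated on `v`. -/
def maslov (X : ℂ → E4) (v z : ℂ) : ℝ := (starRingEnd ℂ (phase X z) * dv v (phase X) z).im

theorem ofReal_norm_sq_dv (X : ℂ → E4) (z : ℂ) : ((‖dv 1 X z‖ ^ 2 : ℝ) : ℂ) =
    c₁ (dv 1 X z) * starRingEnd ℂ (c₁ (dv 1 X z))
      + c₂ (dv 1 X z) * starRingEnd ℂ (c₂ (dv 1 X z)) := by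
  rw [norm_sq_eq, Complex.mul_conj, Complex.mul_conj]
  push_cast
  rfl

namespace IsConfLag

variable {X : ℂ → E4} (h : IsConfLag X)

include h

/-- The real part is conformality and the imaginary part is the Lagrangian condition. -/
theorem hermitian (z : ℂ) : starRingEnd ℂ (c₁ (dv 1 X z)) * c₁ (dv Complex.I X z)
    + starRingEnd ℂ (c₂ (dv 1 X z)) * c₂ (dv Complex.I X z) = 0 := by
  apply Complex.ext
  · rw [← inner_eq_re, h.orth]; rfl
  · rw [← sympl_eq_im, h.lag]; rfl

theorem ofReal_norm_sq_ne_zero (z : ℂ) : ((‖dv 1 X z‖ ^ 2 : ℝ) : ℂ) ≠ 0 := by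
  have := h.pos z
  exact_mod_cast (by positivity : ‖dv 1 X z‖ ^ 2 ≠ 0)

/-- In ℂ², a vector Hermitian-orthogonal to (p, q) is a multiple of (-q̄, p̄), and the factor is the
determinant divided by |p|² + |q|². This relation and `c₂_dv_I` let ∂X/∂y be eliminated everywhere.
-/
theorem c₁_dv_I (z : ℂ) :
    c₁ (dv Complex.I X z) = -phase X z * starRingEnd ℂ (c₂ (dv 1 X z)) := by
  have h0 := h.ofReal_norm_sq_ne_zero z
  have h1 := ofReal_norm_sq_dv X z
  have h2 := h.hermitian z
  rw [phase, expAngle_eq]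
  field_simp
  rw [h1]
  linear_combination (c₁ (dv 1 X z)) * h2

theorem c₂_dv_I (z : ℂ) :
    c₂ (dv Complex.I X z) = phase X z * starRingEnd ℂ (c₁ (dv 1 X z)) := by
  have h0 := h.ofReal_norm_sq_ne_zero z
  have h1 := ofReal_norm_sq_dv X z
  have h2 := h.hermitian z
  rw [phase, expAngle_eq]
  field_simp
  rw [h1]
  linear_combination (c₂ (dv 1 X z)) * h2

theorem conj_phase_mul (z : ℂ) : starRingEnd ℂ (phase X z) * phase X z = 1 := by
  have h0 := h.ofReal_norm_sq_ne_zero z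
  have h1 := ofReal_norm_sq_dv X z
  have h2 : ((‖dv Complex.I X z‖ ^ 2 : ℝ) : ℂ) = c₁ (dv Complex.I X z)
      * starRingEnd ℂ (c₁ (dv Complex.I X z))
      + c₂ (dv Complex.I X z) * starRingEnd ℂ (c₂ (dv Complex.I X z)) := by
    rw [norm_sq_eq, Complex.mul_conj, Complex.mul_conj]
    push_cast
    rfl
  rw [← h.norm_eq, h.c₁_dv_I, h.c₂_dv_I] at h2
  simp only [map_mul, map_neg, Complex.conj_conj] at h2
  have h3 : ((‖dv 1 X z‖ ^ 2 : ℝ) : ℂ) * (starRingEnd ℂ (phase X z) * phase X z)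
      = ((‖dv 1 X z‖ ^ 2 : ℝ) : ℂ) * 1 := by
    linear_combination (starRingEnd ℂ (phase X z) * phase X z) * h1 - h2
  exact mul_left_cancel₀ h0 h3

theorem contDiff_norm_sq : ContDiff ℝ ∞ fun z => ‖dv 1 X z‖ ^ 2 :=
  (contDiff_dv h.smooth 1).norm_sq ℝ

theorem contDiff_phase : ContDiff ℝ ∞ (phase X) := by
  have h1 := c₁.contDiff.comp (contDiff_dv h.smooth 1)
  have h2 := c₂.contDiff.comp (contDiff_dv h.smooth 1)
  have h3 := c₁.contDiff.comp (contDiff_dv h.smooth Complex.I)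
  have h4 := c₂.contDiff.comp (contDiff_dv h.smooth Complex.I)
  refine ContDiff.mul ?_ ((h1.mul h4).sub (h3.mul h2))
  exact (Complex.ofRealCLM.contDiff.comp h.contDiff_norm_sq).inv fun z =>
    h.ofReal_norm_sq_ne_zero z

theorem dv_phase (v z : ℂ) : dv v (phase X) z = Complex.I * maslov X v z * phase X z := by
  have h1 := dv_mul (contDiff_conj h.contDiff_phase) h.contDiff_phase v
  simp only [h.conj_phase_mul, dv_const, dv_conj h.contDiff_phase] at h1
  have h2 := congrFun h1 z
  have h3 : starRingEnd ℂ (phase X z) * dv v (phase X) z = Complex.I * maslov X v z := by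
    apply Complex.ext
    · have := congrArg Complex.re h2
      simp at this
      simp
      linarith
    · simp [maslov]
  linear_combination (-dv v (phase X) z) * h.conj_phase_mul z + phase X z * h3

theorem contDiff_maslov (v : ℂ) : ContDiff ℝ ∞ (maslov X v) :=
  Complex.imCLM.contDiff.comp
    ((contDiff_conj h.contDiff_phase).mul (contDiff_dv h.contDiff_phase v))

/-- The Maslov form is the differential of the angle, which is not a global function. Closedness is
therefore read off from the symmetry of the second derivatives of `phase X`. -/
theorem dv_maslov_comm (v w z : ℂ) : dv v (maslov X w) z = dv w (maslov X v) z := by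
  have key : ∀ v w, dv v (dv w (phase X)) z = Complex.I * ((dv v (maslov X w) z : ℝ) : ℂ) * phase X z
      - maslov X v z * maslov X w z * phase X z := by
    intro v w
    have e : dv w (phase X) = fun z => (Complex.I * maslov X w z) * phase X z :=
      funext fun z => h.dv_phase w z
    have hs : ContDiff ℝ ∞ fun z => (maslov X w z : ℂ) :=
      Complex.ofRealCLM.contDiff.comp (h.contDiff_maslov w)
    have e2 : dv v (fun z => (maslov X w z : ℂ)) = fun z => ((dv v (maslov X w) z : ℝ) : ℂ) :=
      dv_clm (h.contDiff_maslov w) Complex.ofRealCLM v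
    rw [e, dv_mul (contDiff_const.mul hs) h.contDiff_phase]
    have e3 : dv v (fun z => Complex.I * (maslov X w z : ℂ)) =
        fun z => Complex.I * ((dv v (maslov X w) z : ℝ) : ℂ) := by
      have := dv_const_smul hs Complex.I v
      simp only [smul_eq_mul, e2] at this
      exact this
    rw [e3]
    dsimp only
    rw [h.dv_phase]
    linear_combination (maslov X w z * maslov X v z * phase X z : ℂ) * Complex.I_mul_I
  have h1 := congrFun (dv_comm h.contDiff_phase v w) z
  rw [key, key] at h1
  have h2 : Complex.I * phase X z * (((dv v (maslov X w) z : ℝ) : ℂ) - ((dv w (maslov X v) z : ℝ) : ℂ)) = 0 := by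
    linear_combination h1
  have hne : Complex.I * phase X z ≠ 0 := by
    refine mul_ne_zero Complex.I_ne_zero fun h0 => ?_
    have := h.conj_phase_mul z
    rw [h0, mul_zero] at this
    exact zero_ne_one this
  have h3 := (mul_eq_zero.1 h2).resolve_left hne
  exact_mod_cast sub_eq_zero.1 h3

/-- The flat Laplacian of a conformal Lagrangian immersion. -/
theorem laplacian (z : ℂ) : dv 1 (dv 1 X) z + dv Complex.I (dv Complex.I X) z =
    maslov X 1 z • J (dv 1 X z) + maslov X Complex.I z • J (dv Complex.I X z) := by
  have hII := Complex.I_mul_I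
  have hg := h.contDiff_phase
  have hx := contDiff_dv h.smooth 1
  have hy := contDiff_dv h.smooth Complex.I
  have d₁ : ∀ {Y : ℂ → E4}, ContDiff ℝ ∞ Y → ∀ v, dv v (fun z => c₁ (Y z)) =
      fun z => c₁ (dv v Y z) := fun hY v => dv_clm hY c₁ v
  have d₂ : ∀ {Y : ℂ → E4}, ContDiff ℝ ∞ Y → ∀ v, dv v (fun z => c₂ (Y z)) =
      fun z => c₂ (dv v Y z) := fun hY v => dv_clm hY c₂ v
  have s₁ : ContDiff ℝ ∞ fun z => c₁ (dv 1 X z) := c₁.contDiff.comp hx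
  have s₂ : ContDiff ℝ ∞ fun z => c₂ (dv 1 X z) := c₂.contDiff.comp hx
  have e₁ : ∀ v, c₁ (dv v (dv Complex.I X) z) = -(dv v (phase X) z) *
      starRingEnd ℂ (c₂ (dv 1 X z)) - phase X z * starRingEnd ℂ (c₂ (dv v (dv 1 X) z)) := by
    intro v
    have := congrFun (d₁ hy v) z
    simp only [h.c₁_dv_I] at this
    rw [← this, dv_mul hg.neg (contDiff_conj s₂), dv_conj s₂, d₂ hx, dv_neg]
    ring
  have e₂ : ∀ v, c₂ (dv v (dv Complex.I X) z) = dv v (phase X) z *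
      starRingEnd ℂ (c₁ (dv 1 X z)) + phase X z * starRingEnd ℂ (c₁ (dv v (dv 1 X) z)) := by
    intro v
    have := congrFun (d₂ hy v) z
    simp only [h.c₂_dv_I] at this
    rw [← this, dv_mul hg (contDiff_conj s₁), dv_conj s₁, d₁ hx]
  -- The second y-derivative is expressed through the conjugate of the mixed derivative, and that,
  -- after exchanging the order, through the conjugate of the second x-derivative. As the phase is
  -- unimodular, the two conjugations return minus the latter, so only terms with the derivative of
  -- the phase survive in the Laplacian.
  have e₃ := dv_comm h.smooth Complex.I 1
  have hcp := h.conj_phase_mul z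
  apply E4_ext
  · simp only [map_add, map_smul, c₁_J, Complex.real_smul]
    rw [e₁, e₃, e₂, h.c₁_dv_I, h.dv_phase, h.dv_phase]
    simp only [map_add, map_mul, Complex.conj_conj, Complex.conj_I, Complex.conj_ofReal]
    linear_combination (Complex.I * maslov X 1 z * c₁ (dv 1 X z) - c₁ (dv 1 (dv 1 X) z)) * hcp
  · simp only [map_add, map_smul, c₂_J, Complex.real_smul]
    rw [e₂, e₃, e₁, h.c₂_dv_I, h.dv_phase, h.dv_phase]
    simp only [map_sub, map_neg, map_mul, Complex.conj_conj, Complex.conj_I, Complex.conj_ofReal]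
    linear_combination (Complex.I * maslov X 1 z * c₂ (dv 1 X z) - c₂ (dv 1 (dv 1 X) z)) * hcp

end IsConfLag

end HamStat

/-! ### The weak equation satisfied by the Laplacian of the angle. -/

namespace HamStat

open MeasureTheory

section InnerProduct

theorem contDiff_inner {U V : ℂ → E4} (hU : ContDiff ℝ ∞ U) (hV : ContDiff ℝ ∞ V) :
    ContDiff ℝ ∞ fun z => inner ℝ (U z) (V z) := hU.inner ℝ hV

theorem dv_inner {U V : ℂ → E4} (hU : ContDiff ℝ ∞ U) (hV : ContDiff ℝ ∞ V) (v z : ℂ) :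
    dv v (fun z => inner ℝ (U z) (V z)) z =
      inner ℝ (U z) (dv v V z) + inner ℝ (dv v U z) (V z) :=
  fderiv_inner_apply ℝ (differentiableAt_of_smooth hU z) (differentiableAt_of_smooth hV z) v

end InnerProduct

/-- The divergence of the Maslov form, i.e. the flat Laplacian of the Lagrangian angle. -/
def divMaslov (X : ℂ → E4) (z : ℂ) : ℝ :=
  dv 1 (maslov X 1) z + dv Complex.I (maslov X Complex.I) z

section Periodicity

variable {b : Module.Basis (Fin 2) ℝ ℂ} {X : ℂ → E4}

theorem IsPeriodic.phase (hX : IsPeriodic b X) : IsPeriodic b (phase X) :=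
  fun γ hγ z => by simp only [HamStat.phase, hX.dv _ γ hγ z]

theorem IsPeriodic.maslov (hX : IsPeriodic b X) (v : ℂ) : IsPeriodic b (maslov X v) :=
  fun γ hγ z => by simp only [HamStat.maslov, hX.phase γ hγ z, hX.phase.dv _ γ hγ z]

theorem IsPeriodic.divMaslov (hX : IsPeriodic b X) : IsPeriodic b (divMaslov X) :=
  fun γ hγ z => by
    simp only [HamStat.divMaslov, (hX.maslov 1).dv _ γ hγ z,
      (hX.maslov Complex.I).dv _ γ hγ z]

end Periodicity

section Stationarity

variable {b : Module.Basis (Fin 2) ℝ ℂ} {X : ℂ → E4}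

theorem contDiff_gradient {h : E4 → ℝ} (hh : ContDiff ℝ ∞ h) : ContDiff ℝ ∞ (∇ h) :=
  (InnerProductSpace.toDual ℝ E4).symm.toContinuousLinearEquiv.contDiff.comp
    (hh.fderiv_right (m := ∞) (by simp))

theorem inner_gradient {h : E4 → ℝ} (p v : E4) : inner ℝ (∇ h p) v = fderiv ℝ h p v := by
  simp [gradient]

theorem dv_comp {h : E4 → ℝ} (hh : ContDiff ℝ ∞ h) (hX : ContDiff ℝ ∞ X) (v z : ℂ) :
    dv v (fun z => h (X z)) z = inner ℝ (dv v X z) (∇ h (X z)) := by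
  rw [real_inner_comm, inner_gradient]
  have := ((hh.differentiable (by simp) (X z)).hasFDerivAt.comp z
    (differentiableAt_of_smooth hX z).hasFDerivAt).fderiv
  simp only [Function.comp_def] at this
  simp [dv, this]

theorem IsConfLag.contDiff_divMaslov (h : IsConfLag X) : ContDiff ℝ ∞ (divMaslov X) :=
  (contDiff_dv (h.contDiff_maslov 1) 1).add
    (contDiff_dv (h.contDiff_maslov Complex.I) Complex.I)

/-- The periodic field with components ⟨∂ᵥX, V⟩ + (∂ᵥβ) h(X) has total integral of divergence zero.
This divergence is the density of the first variation plus Δβ · h(X): the remaining terms ⟨ΔX, V⟩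
and ∑ (∂ᵥβ) ⟨∂ᵥX, ∇h⟩ cancel, because ΔX = ∑ (∂ᵥβ) J ∂ᵥX and V = -J∇h. -/
theorem IsConfLag.integral_divMaslov_mul (hX : IsConfLag X) (hper : IsPeriodic b X)
    (hstat : IsHamiltonianStationary b X) {h : E4 → ℝ} (hh : ContDiff ℝ ∞ h)
    (hc : HasCompactSupport h) :
    ∫ z in ZSpan.fundamentalDomain b, divMaslov X z * h (X z) = 0 := by
  set V : ℂ → E4 := fun z => hamField h (X z) with hV
  have hVs : ContDiff ℝ ∞ V :=
    (JL.contDiff.comp ((contDiff_gradient hh).comp hX.smooth)).neg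
  have hHs : ContDiff ℝ ∞ fun z => h (X z) := hh.comp hX.smooth
  have hfv := (hasDerivAt_area (b := b) hX.smooth hVs
    (fun z => norm_pos_iff.1 (hX.pos z)) hX.norm_eq hX.orth).unique (hstat h hh hc)
  have hVper : IsPeriodic b V := fun γ hγ z => by simp only [hV, hper γ hγ z]
  have hflux : ∀ v, IsPeriodic b (fun z => inner ℝ (dv v X z) (V z) + maslov X v z * h (X z)) :=
    fun v γ hγ z => by
      simp only [hper γ hγ z, hper.dv v γ hγ z, hVper γ hγ z, hper.maslov v γ hγ z]
  have hfs1 : ∀ v, ContDiff ℝ ∞ (fun z => inner ℝ (dv v X z) (V z)) := fun v =>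
    contDiff_inner (contDiff_dv hX.smooth v) hVs
  have hfs2 : ∀ v, ContDiff ℝ ∞ (fun z => maslov X v z * h (X z)) := fun v =>
    (hX.contDiff_maslov v).mul hHs
  have hfs := fun v => (hfs1 v).add (hfs2 v)
  have h1 := (hflux 1).integral_dv (hfs 1) 1
  have h2 := (hflux Complex.I).integral_dv (hfs Complex.I) Complex.I
  have hpt : ∀ z, divMaslov X z * h (X z) =
      (dv 1 (fun z => inner ℝ (dv 1 X z) (V z) + maslov X 1 z * h (X z)) z
      + dv Complex.I (fun z => inner ℝ (dv Complex.I X z) (V z)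
          + maslov X Complex.I z * h (X z)) z)
      - (inner ℝ (dv 1 X z) (dv 1 V z) + inner ℝ (dv Complex.I X z) (dv Complex.I V z)) := by
    intro z
    rw [dv_add (hfs1 _) (hfs2 _), dv_add (hfs1 _) (hfs2 _), dv_mul (hX.contDiff_maslov _) hHs,
      dv_mul (hX.contDiff_maslov _) hHs]
    dsimp only
    rw [dv_inner (contDiff_dv hX.smooth _) hVs, dv_inner (contDiff_dv hX.smooth _) hVs,
      dv_comp hh hX.smooth, dv_comp hh hX.smooth, divMaslov]
    have h3 : inner ℝ (dv 1 (dv 1 X) z) (V z) + inner ℝ (dv Complex.I (dv Complex.I X) z) (V z)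
        = -(maslov X 1 z * inner ℝ (dv 1 X z) (∇ h (X z))
          + maslov X Complex.I z * inner ℝ (dv Complex.I X z) (∇ h (X z))) := by
      rw [← inner_add_left, hX.laplacian, hV]
      simp only [hamField, inner_neg_right, inner_add_left, inner_smul_left, inner_J_left, J_J]
      simp
    linear_combination -h3
  have i1 : ∀ v, IntegrableOn
      (dv v (fun z => inner ℝ (dv v X z) (V z) + maslov X v z * h (X z)))
      (ZSpan.fundamentalDomain b) := fun v =>
    integrableOn_fundamentalDomain (contDiff_dv (hfs v) v).continuous
  have i2 : IntegrableOn (fun z => inner ℝ (dv 1 X z) (dv 1 V z)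
      + inner ℝ (dv Complex.I X z) (dv Complex.I V z)) (ZSpan.fundamentalDomain b) :=
    integrableOn_fundamentalDomain
      ((contDiff_inner (contDiff_dv hX.smooth _) (contDiff_dv hVs _)).add
        (contDiff_inner (contDiff_dv hX.smooth _) (contDiff_dv hVs _))).continuous
  simp only [hpt]
  have h4 := integral_sub ((i1 1).add (i1 Complex.I)) i2
  have h5 := integral_add (i1 1) (i1 Complex.I)
  rw [h1, h2] at h5
  rw [hfv] at h4
  refine h4.trans ?_
  rw [sub_zero]
  exact h5.trans (by simp)

end Stationarity

end HamStat

/-! ### Behaviour of the Laplacian of the angle under reparametrization. -/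

namespace HamStat

open MeasureTheory Filter Topology

/-- The flat Laplacian. -/
def lap {E : Type*} [NormedAddCommGroup E] [NormedSpace ℝ E] (f : ℂ → E) (z : ℂ) : E :=
  dv 1 (dv 1 f) z + dv Complex.I (dv Complex.I f) z

section Composition

variable {E : Type*} [NormedAddCommGroup E] [NormedSpace ℝ E]

theorem dv_congr {f g : ℂ → E} {z : ℂ} (h : f =ᶠ[𝓝 z] g) (v : ℂ) : dv v f =ᶠ[𝓝 z] dv v g := by
  filter_upwards [h.fderiv (𝕜 := ℝ)] with w hw
  simp [dv, hw]

theorem lap_congr {f g : ℂ → E} {z : ℂ} (h : f =ᶠ[𝓝 z] g) : lap f z = lap g z := by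
  rw [lap, lap, (dv_congr (dv_congr h 1) 1).eq_of_nhds,
    (dv_congr (dv_congr h Complex.I) Complex.I).eq_of_nhds]

theorem fderiv_apply_eq (f : ℂ → E) (v z : ℂ) :
    fderiv ℝ f z v = v.re • dv 1 f z + v.im • dv Complex.I f z := dv_eq_re_im f v z

theorem dv_comp_eventually {U : ℂ → E} (hU : ContDiff ℝ ∞ U) {φ : ℂ → ℂ} {z₀ : ℂ}
    (hφ : ContDiffAt ℝ 2 φ z₀) (v : ℂ) :
    dv v (fun z => U (φ z)) =ᶠ[𝓝 z₀] fun z => fderiv ℝ U (φ z) (dv v φ z) := by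
  filter_upwards [hφ.eventually (by simp)] with z hz
  have := ((differentiableAt_of_smooth hU (φ z)).hasFDerivAt.comp z
    (hz.differentiableAt (by simp)).hasFDerivAt).fderiv
  simp only [Function.comp_def] at this
  simp [dv, this]

theorem dv_dv_comp {U : ℂ → E} (hU : ContDiff ℝ ∞ U) {φ : ℂ → ℂ} {z₀ : ℂ}
    (hφ : ContDiffAt ℝ 2 φ z₀) (v : ℂ) :
    dv v (dv v (fun z => U (φ z))) z₀ =
      fderiv ℝ (fderiv ℝ U) (φ z₀) (dv v φ z₀) (dv v φ z₀)
        + fderiv ℝ U (φ z₀) (dv v (dv v φ) z₀) := by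
  rw [(dv_congr (dv_comp_eventually hU hφ v) v).eq_of_nhds]
  have h1 : DifferentiableAt ℝ (fderiv ℝ U) (φ z₀) :=
    ((hU.fderiv_right (m := ∞) (by simp)).differentiable (by simp)) _
  have h2 : DifferentiableAt ℝ (dv v φ) z₀ := by
    have : ContDiffAt ℝ 1 (fderiv ℝ φ) z₀ := hφ.fderiv_right (by norm_num)
    exact (this.differentiableAt (by simp)).clm_apply (differentiableAt_const v)
  have h3 := (h1.hasFDerivAt.comp z₀ (hφ.differentiableAt (by simp)).hasFDerivAt).clm_apply
    h2.hasFDerivAt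
  have h4 := h3.fderiv
  simp only [Function.comp_def] at h4
  conv_lhs => unfold dv
  change fderiv ℝ (fun z => fderiv ℝ U (φ z) (dv v φ z)) z₀ v = _
  rw [h4]
  simp [dv, add_comm]

theorem sndFDeriv_apply (U : ℂ → E) (hU : ContDiff ℝ ∞ U) (w v v' : ℂ) :
    fderiv ℝ (fderiv ℝ U) w v v' = dv v (dv v' U) w := by
  have h : DifferentiableAt ℝ (fderiv ℝ U) w :=
    ((hU.fderiv_right (m := ∞) (by simp)).differentiable (by simp)) w
  have h2 := (h.hasFDerivAt.clm_apply (hasFDerivAt_const v' w)).fderiv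
  change _ = fderiv ℝ (fun y => fderiv ℝ U y v') w v
  rw [h2]
  simp

/-- The Laplacian of a composition with a conformal map. -/
theorem lap_comp {U : ℂ → E} (hU : ContDiff ℝ ∞ U) {φ : ℂ → ℂ} {z₀ : ℂ}
    (hφ : ContDiffAt ℝ 2 φ z₀) {σ : ℝ}
    (h1 : (dv 1 φ z₀).re ^ 2 + (dv 1 φ z₀).im ^ 2 = σ)
    (h2 : (dv Complex.I φ z₀).re ^ 2 + (dv Complex.I φ z₀).im ^ 2 = σ)
    (h3 : (dv 1 φ z₀).re * (dv Complex.I φ z₀).re + (dv 1 φ z₀).im * (dv Complex.I φ z₀).im = 0) :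
    lap (fun z => U (φ z)) z₀ = σ • lap U (φ z₀) + fderiv ℝ U (φ z₀) (lap φ z₀) := by
  have hB : ∀ v : ℂ, fderiv ℝ (fderiv ℝ U) (φ z₀) v v = (v.re ^ 2) • dv 1 (dv 1 U) (φ z₀)
      + (2 * (v.re * v.im)) • dv 1 (dv Complex.I U) (φ z₀)
      + (v.im ^ 2) • dv Complex.I (dv Complex.I U) (φ z₀) := by
    intro v
    rw [sndFDeriv_apply U hU, dv_eq_re_im]
    have : ∀ w, dv w (dv v U) (φ z₀) = v.re • dv w (dv 1 U) (φ z₀)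
        + v.im • dv w (dv Complex.I U) (φ z₀) := by
      intro w
      rw [dv_comm hU, dv_eq_re_im, dv_comm hU 1 w, dv_comm hU Complex.I w]
    rw [this, this, dv_comm hU Complex.I 1]
    module
  rw [lap, dv_dv_comp hU hφ, dv_dv_comp hU hφ, hB, hB, lap, lap, map_add]
  set p := dv 1 φ z₀
  set q := dv Complex.I φ z₀
  -- A 2 × 2 matrix with orthogonal columns of equal length has orthogonal rows of the same length.
  -- As σ = 0 is not excluded here, that case is treated apart.
  have h4 : p.re ^ 2 + q.re ^ 2 = σ ∧ p.im ^ 2 + q.im ^ 2 = σ ∧ p.re * p.im + q.re * q.im = 0 := by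
    have e0 : σ * (p.re * p.im + q.re * q.im) = 0 := by
      have : σ * (p.re * p.im + q.re * q.im) =
          (p.re * q.re + p.im * q.im) * (p.re * q.im + p.im * q.re) := by
        rw [mul_add]
        conv_lhs => enter [1, 1]; rw [← h2]
        conv_lhs => enter [2, 1]; rw [← h1]
        ring
      rw [this, h3, zero_mul]
    by_cases hσ : σ = 0
    · have a1 : p.re = 0 := by nlinarith [sq_nonneg p.re, sq_nonneg p.im]
      have a2 : p.im = 0 := by nlinarith [sq_nonneg p.re, sq_nonneg p.im]
      have a3 : q.re = 0 := by nlinarith [sq_nonneg q.re, sq_nonneg q.im]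
      have a4 : q.im = 0 := by nlinarith [sq_nonneg q.re, sq_nonneg q.im]
      simp [a1, a2, a3, a4, hσ]
    · have e1 := (mul_eq_zero.1 e0).resolve_left hσ
      have e2 : σ * (p.re ^ 2 + q.re ^ 2) = σ * σ := by
        have h6 : q.im ^ 2 = σ - q.re ^ 2 := by linarith
        have h7 : p.im ^ 2 = σ - p.re ^ 2 := by linarith
        have h8 : (p.re * q.re) ^ 2 = p.im ^ 2 * q.im ^ 2 := by
          have : p.re * q.re = -(p.im * q.im) := by linarith
          rw [this]; ring
        rw [h6, h7] at h8
        linear_combination h8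
      have e3 := mul_left_cancel₀ hσ e2
      exact ⟨e3, by linarith, e1⟩
  obtain ⟨h5, h6, h7⟩ := h4
  have h8 : (p.re ^ 2) • dv 1 (dv 1 U) (φ z₀) + (q.re ^ 2) • dv 1 (dv 1 U) (φ z₀) =
      σ • dv 1 (dv 1 U) (φ z₀) := by rw [← add_smul, h5]
  have h9 : (p.im ^ 2) • dv Complex.I (dv Complex.I U) (φ z₀)
      + (q.im ^ 2) • dv Complex.I (dv Complex.I U) (φ z₀) =
      σ • dv Complex.I (dv Complex.I U) (φ z₀) := by rw [← add_smul, h6]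
  have h10 : (2 * (p.re * p.im)) • dv 1 (dv Complex.I U) (φ z₀)
      + (2 * (q.re * q.im)) • dv 1 (dv Complex.I U) (φ z₀) = 0 := by
    rw [← add_smul, ← mul_add, h7, mul_zero, zero_smul]
  rw [smul_add, ← h8, ← h9]
  have := congrArg (fun x => x + (((p.re ^ 2) • dv 1 (dv 1 U) (φ z₀)
      + (q.re ^ 2) • dv 1 (dv 1 U) (φ z₀)) + ((p.im ^ 2) • dv Complex.I (dv Complex.I U) (φ z₀)
      + (q.im ^ 2) • dv Complex.I (dv Complex.I U) (φ z₀)) + (fderiv ℝ U (φ z₀) (dv 1 (dv 1 φ) z₀)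
      + fderiv ℝ U (φ z₀) (dv Complex.I (dv Complex.I φ) z₀)))) h10
  simp only [zero_add] at this
  rw [← this]
  abel

end Composition

namespace IsConfLag

variable {X : ℂ → E4} (h : IsConfLag X)

include h

/-- ΔX is a combination of J ∂X/∂x and J ∂X/∂y, and J maps the tangent plane of a Lagrangian
immersion into the normal plane. -/
theorem inner_lap (z v : ℂ) : inner ℝ (lap X z) (dv v X z) = 0 := by
  have h0 := h.lag z
  have hJ : ∀ x y : E4, inner ℝ (J x) y = sympl x y := by
    intro x y
    simp only [inner_eq_re, sympl_eq_im, c₁_J, c₂_J]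
    simp
    ring
  have hs : ∀ x : E4, sympl x x = 0 := fun x => by simp [sympl]; ring
  have hsw : ∀ x y : E4, sympl x y = -sympl y x := fun x y => by simp [sympl]; ring
  have h1 := h.laplacian z
  rw [lap, h1, dv_eq_re_im X v z]
  simp only [inner_add_left, inner_add_right, inner_smul_left, inner_smul_right, hJ, hs, h0,
    hsw (dv Complex.I X z) (dv 1 X z)]
  simp

/-- With G = e^{2iβ} one has Ḡ ΔG = 2iΔβ - 4|dβ|². The square is used because reversing the
orientation of the parameter changes the sign of `phase X` and leaves G unchanged. -/
theorem lap_phase_sq (z : ℂ) :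
    (starRingEnd ℂ (phase X z ^ 2) * lap (fun z => phase X z ^ 2) z).im = 2 * divMaslov X z := by
  have hg := h.contDiff_phase
  have hG : ContDiff ℝ ∞ fun z => phase X z ^ 2 := hg.pow 2
  have e1 : ∀ v, dv v (fun z => phase X z ^ 2) =
      fun z => (2 * Complex.I * maslov X v z) * phase X z ^ 2 := by
    intro v
    have := dv_mul hg hg v
    simp only [← sq, h.dv_phase] at this
    rw [this]
    ext z
    ring
  have e2 : ∀ v, dv v (dv v (fun z => phase X z ^ 2)) z =
      (2 * Complex.I * ((dv v (maslov X v) z : ℝ) : ℂ) - 4 * maslov X v z ^ 2)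
        * phase X z ^ 2 := by
    intro v
    have hs : ContDiff ℝ ∞ fun z => (maslov X v z : ℂ) :=
      Complex.ofRealCLM.contDiff.comp (h.contDiff_maslov v)
    have e3 : dv v (fun z => (maslov X v z : ℂ)) = fun z => ((dv v (maslov X v) z : ℝ) : ℂ) :=
      dv_clm (h.contDiff_maslov v) Complex.ofRealCLM v
    have e4 := dv_const_smul hs (2 * Complex.I) v
    simp only [smul_eq_mul, e3] at e4
    rw [e1, dv_mul (contDiff_const.mul hs) hG, e4, e1]
    linear_combination (4 * maslov X v z ^ 2 * phase X z ^ 2 : ℂ) * Complex.I_mul_I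
  have e5 : starRingEnd ℂ (phase X z ^ 2) * phase X z ^ 2 = 1 := by
    rw [map_pow, ← mul_pow, h.conj_phase_mul, one_pow]
  rw [lap, e2, e2]
  have e6 : starRingEnd ℂ (phase X z ^ 2) *
      ((2 * Complex.I * ((dv 1 (maslov X 1) z : ℝ) : ℂ) - 4 * maslov X 1 z ^ 2) * phase X z ^ 2
      + (2 * Complex.I * ((dv Complex.I (maslov X Complex.I) z : ℝ) : ℂ)
        - 4 * maslov X Complex.I z ^ 2) * phase X z ^ 2) =
      ((2 * divMaslov X z : ℝ) : ℂ) * Complex.I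
        - ((4 * maslov X 1 z ^ 2 + 4 * maslov X Complex.I z ^ 2 : ℝ) : ℂ) := by
    simp only [divMaslov]
    push_cast
    linear_combination ((2 * Complex.I * ((dv 1 (maslov X 1) z : ℝ) : ℂ) - 4 * maslov X 1 z ^ 2)
      + (2 * Complex.I * ((dv Complex.I (maslov X Complex.I) z : ℝ) : ℂ)
        - 4 * maslov X Complex.I z ^ 2)) * e5
  rw [e6, Complex.sub_im, Complex.im_ofReal_mul, Complex.ofReal_im]
  simp

theorem inner_fderiv (z v w : ℂ) : inner ℝ (fderiv ℝ X z v) (fderiv ℝ X z w) =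
    ‖dv 1 X z‖ ^ 2 * (v.re * w.re + v.im * w.im) := by
  rw [fderiv_apply_eq, fderiv_apply_eq]
  simp only [inner_add_left, inner_add_right, inner_smul_left, inner_smul_right, h.orth,
    real_inner_comm (dv 1 X z) (dv Complex.I X z), real_inner_self_eq_norm_sq, ← h.norm_eq]
  simp
  ring

/-- The Laplacian of the Lagrangian angle is, up to a positive factor, invariant under
reparametrization. -/
theorem divMaslov_comp {φ : ℂ → ℂ} {z₀ : ℂ} (hφ : ContDiffAt ℝ 2 φ z₀)
    (hX : ∀ᶠ z in 𝓝 z₀, X (φ z) = X z) :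
    ∃ σ : ℝ, 0 < σ ∧ divMaslov X z₀ = σ * divMaslov X (φ z₀) := by
  have hXe : (fun z => X (φ z)) =ᶠ[𝓝 z₀] X := hX
  have hd : ∀ v, ∀ᶠ z in 𝓝 z₀, dv v X z = fderiv ℝ X (φ z) (dv v φ z) := by
    intro v
    filter_upwards [dv_congr hXe v, dv_comp_eventually h.smooth hφ v] with z h1 h2
    rw [← h1, h2]
  have hE := h.pos
  have hconf : ∀ᶠ z in 𝓝 z₀, ∃ σ : ℝ, 0 < σ ∧ ‖dv 1 X z‖ ^ 2 = σ * ‖dv 1 X (φ z)‖ ^ 2 ∧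
      (dv 1 φ z).re ^ 2 + (dv 1 φ z).im ^ 2 = σ ∧
      (dv Complex.I φ z).re ^ 2 + (dv Complex.I φ z).im ^ 2 = σ ∧
      (dv 1 φ z).re * (dv Complex.I φ z).re + (dv 1 φ z).im * (dv Complex.I φ z).im = 0 := by
    filter_upwards [hd 1, hd Complex.I] with z h1 h2
    have hEz := hE z
    have hEφ := hE (φ z)
    have i1 := h.inner_fderiv (φ z) (dv 1 φ z) (dv 1 φ z)
    have i2 := h.inner_fderiv (φ z) (dv Complex.I φ z) (dv Complex.I φ z)
    have i3 := h.inner_fderiv (φ z) (dv 1 φ z) (dv Complex.I φ z)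
    rw [← h1] at i1
    rw [← h2] at i2
    rw [← h1, ← h2, h.orth] at i3
    rw [real_inner_self_eq_norm_sq] at i1 i2
    rw [← h.norm_eq, i1] at i2
    have hE2 : ‖dv 1 X (φ z)‖ ^ 2 ≠ 0 := by positivity
    refine ⟨_, ?_, ?_, rfl, ?_, ?_⟩
    · have : 0 < ‖dv 1 X (φ z)‖ ^ 2 *
          ((dv 1 φ z).re * (dv 1 φ z).re + (dv 1 φ z).im * (dv 1 φ z).im) := by
        rw [← i1]; positivity
      have := pos_of_mul_pos_right this (by positivity)
      nlinarith
    · rw [i1]; ring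
    · have := mul_left_cancel₀ hE2 i2
      linarith
    · exact (mul_eq_zero.1 i3.symm).resolve_left hE2
  -- The determinant of dφ is ±σ; dividing by the conformal factor leaves a sign, which squaring
  -- removes.
  have hG : (fun z => phase X z ^ 2) =ᶠ[𝓝 z₀] fun z => phase X (φ z) ^ 2 := by
    filter_upwards [hconf, hd 1, hd Complex.I] with z h1 h2 h3
    obtain ⟨σ, hσ, a1, a2, a3, a4⟩ := h1
    have hdet : expAngle (dv 1 X z) (dv Complex.I X z) =
        (((dv 1 φ z).re * (dv Complex.I φ z).im - (dv 1 φ z).im * (dv Complex.I φ z).re : ℝ) : ℂ)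
          * expAngle (dv 1 X (φ z)) (dv Complex.I X (φ z)) := by
      rw [h2, h3, fderiv_apply_eq, fderiv_apply_eq]
      simp only [expAngle_eq, map_add, map_smul, Complex.real_smul]
      push_cast
      ring
    have hsq : ((dv 1 φ z).re * (dv Complex.I φ z).im
        - (dv 1 φ z).im * (dv Complex.I φ z).re) ^ 2 = σ ^ 2 := by
      have : σ ^ 2 = ((dv 1 φ z).re ^ 2 + (dv 1 φ z).im ^ 2)
        * ((dv Complex.I φ z).re ^ 2 + (dv Complex.I φ z).im ^ 2) := by rw [a2, a3]; ring
      rw [this]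
      linear_combination (-((dv 1 φ z).re * (dv Complex.I φ z).re
        + (dv 1 φ z).im * (dv Complex.I φ z).im)) * a4
    have hsq' : (((dv 1 φ z).re * (dv Complex.I φ z).im
        - (dv 1 φ z).im * (dv Complex.I φ z).re : ℝ) : ℂ) ^ 2 = (σ : ℂ) ^ 2 := by
      exact_mod_cast hsq
    have hσ' : (σ : ℂ) ≠ 0 := by exact_mod_cast hσ.ne'
    simp only [phase]
    rw [a1, hdet, mul_pow, mul_pow, hsq', mul_pow]
    push_cast
    field_simp
  obtain ⟨σ, hσ, -, a2, a3, a4⟩ := hconf.self_of_nhds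
  refine ⟨σ, hσ, ?_⟩
  -- φ is harmonic at z₀: the image of Δφ under dX is tangent, yet it equals ΔX(z₀) - σ ΔX(φ z₀),
  -- which is normal since both points have the same tangent plane. Immersivity then gives Δφ = 0,
  -- and `lap_comp` applied to G has no first-order term.
  have hlapφ : lap φ z₀ = 0 := by
    have h1 := lap_comp h.smooth hφ a2 a3 a4
    rw [lap_congr hXe] at h1
    have h2 : ∀ v, inner ℝ (fderiv ℝ X (φ z₀) (lap φ z₀)) (fderiv ℝ X (φ z₀) (dv v φ z₀)) = 0 := by
      intro v
      have h3 : fderiv ℝ X (φ z₀) (lap φ z₀) = lap X z₀ - σ • lap X (φ z₀) := by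
        rw [h1]; abel
      rw [h3, inner_sub_left, inner_smul_left]
      have h4 := h.inner_lap z₀ v
      rw [(hd v).self_of_nhds] at h4
      rw [h4]
      have h5 : inner ℝ (lap X (φ z₀)) (fderiv ℝ X (φ z₀) (dv v φ z₀)) = 0 :=
        h.inner_lap (φ z₀) _
      rw [h5]
      simp
    have hE2 : ‖dv 1 X (φ z₀)‖ ^ 2 ≠ 0 := by have := hE (φ z₀); positivity
    have h6 := h2 1
    have h7 := h2 Complex.I
    rw [h.inner_fderiv] at h6 h7
    have h6 := (mul_eq_zero.1 h6).resolve_left hE2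
    have h7 := (mul_eq_zero.1 h7).resolve_left hE2
    set l := lap φ z₀
    set p := dv 1 φ z₀
    set q := dv Complex.I φ z₀
    have hD : (p.re * q.im - p.im * q.re) ≠ 0 := by
      intro h0
      have : σ ^ 2 = 0 := by
        have e : σ ^ 2 = (p.re ^ 2 + p.im ^ 2) * (q.re ^ 2 + q.im ^ 2) := by rw [a2, a3]; ring
        rw [e]
        linear_combination (p.re * q.im - p.im * q.re) * h0 + (p.re * q.re + p.im * q.im) * a4
      exact hσ.ne' (pow_eq_zero_iff (by norm_num) |>.1 this)
    apply Complex.ext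
    · have : (p.re * q.im - p.im * q.re) * l.re = 0 := by
        linear_combination q.im * h6 - p.im * h7
      exact (mul_eq_zero.1 this).resolve_left hD
    · have : (p.re * q.im - p.im * q.re) * l.im = 0 := by
        linear_combination p.re * h7 - q.re * h6
      exact (mul_eq_zero.1 this).resolve_left hD
  have h1 := lap_comp (U := fun z => phase X z ^ 2) (h.contDiff_phase.pow 2) hφ a2 a3 a4
  rw [hlapφ, map_zero, add_zero, ← lap_congr hG] at h1
  have h2 := h.lap_phase_sq z₀
  have h3 := h.lap_phase_sq (φ z₀)
  have h4 : phase X z₀ ^ 2 = phase X (φ z₀) ^ 2 := hG.eq_of_nhds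
  rw [h1, h4, Complex.real_smul, mul_left_comm, Complex.im_ofReal_mul, h3] at h2
  linarith

end IsConfLag

end HamStat

/-! ### Harmonicity of the Lagrangian angle in the presence of self-intersections. -/

namespace HamStat

open MeasureTheory Filter Topology

namespace IsConfLag

variable {X : ℂ → E4} (h : IsConfLag X)

include h

/-- A conformal immersion has local smooth left inverses. -/
theorem exists_localInverse (w₀ : ℂ) : ∃ (ψ : E4 → ℂ) (S : Set ℂ), S ∈ 𝓝 w₀ ∧ IsOpen S ∧
    ContDiffAt ℝ 2 ψ (X w₀) ∧ ∀ w ∈ S, ψ (X w) = w := by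
  have hE : ‖dv 1 X w₀‖ ^ 2 ≠ 0 := by have := h.pos w₀; positivity
  -- Projection on the tangent plane at w₀ in the coordinates x, y, scaled so that L ∘ X has
  -- identity differential there. The inverse function theorem then applies to L ∘ X.
  let L : E4 →L[ℝ] ℂ := (‖dv 1 X w₀‖ ^ 2)⁻¹ • ((innerSL ℝ (dv 1 X w₀)).smulRight (1 : ℂ)
    + (innerSL ℝ (dv Complex.I X w₀)).smulRight Complex.I)
  have hL : ∀ x, L x = (‖dv 1 X w₀‖ ^ 2)⁻¹ • (inner ℝ (dv 1 X w₀) x • (1 : ℂ)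
    + inner ℝ (dv Complex.I X w₀) x • Complex.I) := fun x => rfl
  have hY : ContDiffAt ℝ 2 (fun w => L (X w)) w₀ :=
    (L.contDiff.comp (h.smooth.of_le two_le_infty)).contDiffAt
  have hd : HasFDerivAt (fun w => L (X w)) ((ContinuousLinearEquiv.refl ℝ ℂ : ℂ ≃L[ℝ] ℂ) :
      ℂ →L[ℝ] ℂ) w₀ := by
    refine (L.hasFDerivAt.comp w₀ (differentiableAt_of_smooth h.smooth w₀).hasFDerivAt).congr_fderiv
      (ContinuousLinearMap.ext fun v => ?_)
    change L (fderiv ℝ X w₀ v) = v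
    have h1 := h.inner_fderiv w₀ 1 v
    have h2 := h.inner_fderiv w₀ Complex.I v
    change inner ℝ (dv 1 X w₀) _ = _ at h1
    change inner ℝ (dv Complex.I X w₀) _ = _ at h2
    rw [hL, h1, h2, smul_add, smul_smul, smul_smul, inv_mul_cancel_left₀ hE,
      inv_mul_cancel_left₀ hE]
    apply Complex.ext <;> simp
  let e := hY.toOpenPartialHomeomorph _ hd (by norm_num)
  have he : ∀ w, e w = L (X w) := fun w => rfl
  have hsrc : w₀ ∈ e.source := hY.mem_toOpenPartialHomeomorph_source hd (by norm_num)
  refine ⟨fun x => e.symm (L x), e.source, e.open_source.mem_nhds hsrc, e.open_source, ?_, ?_⟩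
  · have h3 : ContDiffAt ℝ 2 e.symm (L (X w₀)) := hY.to_localInverse hd (by norm_num)
    exact h3.comp (X w₀) L.contDiff.contDiffAt
  · intro w hw
    change e.symm (L (X w)) = w
    rw [← he, e.left_inv hw]

theorem exists_injOn_closedBall (w₀ : ℂ) : ∃ r > 0, Set.InjOn X (Metric.closedBall w₀ r) := by
  obtain ⟨ψ, S, hS, -, -, hinv⟩ := h.exists_localInverse w₀
  obtain ⟨r, hr, hrS⟩ := Metric.nhds_basis_closedBall.mem_iff.1 hS
  exact ⟨r, hr, fun x hx y hy hxy => by rw [← hinv x (hrS hx), hxy, hinv y (hrS hy)]⟩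

/-- If the sheet of `X` around `z₀` is contained in the sheet around `w₀`, then the signs of the
Laplacian of the Lagrangian angle at `z₀` and at `w₀` agree. -/
theorem divMaslov_of_sheet {z₀ w₀ : ℂ} {K : Set ℂ} (hK : IsCompact K) (hinj : Set.InjOn X K)
    (hw₀ : w₀ ∈ K) (hX : X w₀ = X z₀) (hsheet : ∀ᶠ z in 𝓝 z₀, X z ∈ X '' K) :
    ∃ σ : ℝ, 0 < σ ∧ divMaslov X z₀ = σ * divMaslov X w₀ := by
  obtain ⟨ψ, S, hS, hSo, hψ, hinv⟩ := h.exists_localInverse w₀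
  have hXc := h.smooth.continuous
  -- On K the only preimage of X z₀ is w₀, which lies in S, so the compact image of K \ S misses a
  -- neighbourhood of X z₀. Near z₀ the preimage in K then lies in S, where ψ inverts X, and ψ ∘ X
  -- is the required change of parameter.
  have hfar : ∀ᶠ z in 𝓝 z₀, X z ∉ X '' (K \ S) := by
    have hcl : IsClosed (X '' (K \ S)) := ((hK.diff hSo).image hXc).isClosed
    refine (hXc.tendsto z₀).eventually (hcl.isOpen_compl.mem_nhds ?_)
    rintro ⟨w, hw, hwX⟩
    have : w = w₀ := hinj hw.1 hw₀ (hwX.trans hX.symm)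
    exact hw.2 (this ▸ mem_of_mem_nhds hS)
  have hφ : ContDiffAt ℝ 2 (fun z => ψ (X z)) z₀ := by
    rw [hX] at hψ
    exact hψ.comp z₀ (h.smooth.of_le two_le_infty).contDiffAt
  have hφX : ∀ᶠ z in 𝓝 z₀, X (ψ (X z)) = X z := by
    filter_upwards [hsheet, hfar] with z h1 h2
    obtain ⟨w, hwK, hwX⟩ := h1
    have hwS : w ∈ S := by
      by_contra hc
      exact h2 ⟨w, ⟨hwK, hc⟩, hwX⟩
    rw [← hwX, hinv w hwS]
  have := h.divMaslov_comp hφ hφX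
  rwa [← hX, hinv w₀ (mem_of_mem_nhds hS)] at this

/-- Generically, all the sheets of `X` through a point of its image coincide near that point. -/
theorem exists_generic {O : Set ℂ} (hO : IsOpen O) (hne : O.Nonempty) :
    ∃ z₀ ∈ O, ∀ w, X w = X z₀ → ∃ σ : ℝ, 0 < σ ∧ divMaslov X z₀ = σ * divMaslov X w := by
  have hXc := h.smooth.continuous
  let K : ℕ × ℕ → Set ℂ := fun i =>
    Metric.closedBall (TopologicalSpace.denseSeq ℂ i.1) (1 / (i.2 + 1 : ℝ))
  have hK : ∀ i, IsCompact (K i) := fun i => isCompact_closedBall _ _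
  let A : ℕ × ℕ → Set ℂ := fun i => X ⁻¹' (X '' K i)
  have hA : ∀ i, IsClosed (A i) := fun i => ((hK i).image hXc).isClosed.preimage hXc
  -- Frontiers of closed sets are nowhere dense, so Baire's theorem applies. Off all frontiers, a
  -- point z₀ of `A i` is an interior point: if the piece `K i` meets the fibre of X z₀, then its
  -- image contains the whole sheet around z₀.
  have hdense : Dense (⋂ i, (frontier (A i))ᶜ) := by
    refine dense_iInter_of_isOpen (fun i => isClosed_frontier.isOpen_compl) fun i => ?_
    rw [← interior_eq_empty_iff_dense_compl]
    exact interior_frontier (hA i)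
  obtain ⟨z₀, hz₀O, hz₀⟩ := hdense.inter_open_nonempty O hO hne
  refine ⟨z₀, hz₀O, fun w hw => ?_⟩
  obtain ⟨r, hr, hinj⟩ := h.exists_injOn_closedBall w
  obtain ⟨m, hm⟩ := exists_nat_one_div_lt (half_pos hr)
  obtain ⟨n, hn⟩ : ∃ n, TopologicalSpace.denseSeq ℂ n ∈ Metric.ball w (1 / (m + 1 : ℝ)) :=
    (TopologicalSpace.denseRange_denseSeq ℂ).exists_mem_open Metric.isOpen_ball
      ⟨w, Metric.mem_ball_self (by positivity)⟩
  rw [Metric.mem_ball] at hn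
  have hsub : K (n, m) ⊆ Metric.closedBall w r := by
    intro x hx
    have h1 : dist x (TopologicalSpace.denseSeq ℂ n) ≤ 1 / (m + 1 : ℝ) := hx
    rw [Metric.mem_closedBall]
    linarith [dist_triangle x (TopologicalSpace.denseSeq ℂ n) w]
  have hwK : w ∈ K (n, m) := by
    change dist w _ ≤ _
    rw [dist_comm]
    exact hn.le
  have hz₀A : z₀ ∈ A (n, m) := ⟨w, hwK, hw⟩
  have hnf : z₀ ∉ frontier (A (n, m)) := Set.mem_iInter.1 hz₀ (n, m)
  have hint : z₀ ∈ interior (A (n, m)) := by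
    by_contra hc
    exact hnf ⟨subset_closure hz₀A, hc⟩
  exact h.divMaslov_of_sheet (hK (n, m)) (hinj.mono hsub) hwK hw
    (mem_interior_iff_mem_nhds.1 hint)

variable {b : Module.Basis (Fin 2) ℝ ℂ}

/-- If s · Δβ is positive on the whole fibre over X z₀, compactness of the closed domain and
periodicity make it positive over a small ball around X z₀. A bump function supported there has a
nonnegative integrand with zero integral, contradicting its positivity at z₀. -/
theorem divMaslov_eq_zero_of_fiber (hper : IsPeriodic b X)
    (hstat : IsHamiltonianStationary b X) {z₀ : ℂ} {s : ℝ}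
    (hfib : ∀ w, X w = X z₀ → 0 < s * divMaslov X w) : False := by
  have hfc := h.contDiff_divMaslov.continuous
  have hXc := h.smooth.continuous
  set C := closure (ZSpan.fundamentalDomain b) ∩ {z | s * divMaslov X z ≤ 0} with hC
  have hCc : IsCompact C := (isCompact_closure_fundamentalDomain b).inter_right
    (isClosed_le (continuous_const.mul hfc) continuous_const)
  have hcl : IsClosed (X '' C) := (hCc.image hXc).isClosed
  have hmem : (X '' C)ᶜ ∈ 𝓝 (X z₀) := by
    refine hcl.isOpen_compl.mem_nhds ?_
    rintro ⟨w, hw, hwX⟩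
    exact absurd (hfib w hwX) (not_lt.2 hw.2)
  obtain ⟨ε, hε, hball⟩ := Metric.mem_nhds_iff.1 hmem
  let f : ContDiffBump (X z₀) := ⟨ε / 2, ε, by positivity, by linarith⟩
  have hint := h.integral_divMaslov_mul hper hstat (h := f) f.contDiff f.hasCompactSupport
  have hnn : ∀ z, 0 ≤ s * (divMaslov X z * f (X z)) := by
    intro z
    rcases (f.nonneg (x := X z)).eq_or_lt with h0 | h0
    · rw [← h0]; simp
    · have hz : X z ∈ Metric.ball (X z₀) ε := by
        have : X z ∈ Function.support f := h0.ne'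
        rwa [f.support_eq] at this
      have hpos : 0 < s * divMaslov X z := by
        by_contra hc
        have h1 := hper.divMaslov.fract z
        have h2 := hper.fract z
        refine hball hz ⟨ZSpan.fract b z, ⟨subset_closure
          (ZSpan.fract_mem_fundamentalDomain b z), ?_⟩, h2⟩
        change s * divMaslov X _ ≤ 0
        rw [h1]
        exact not_lt.1 hc
      rw [← mul_assoc]
      positivity
  have hp : IsPeriodic b fun z => s * (divMaslov X z * f (X z)) := fun γ hγ z => by
    simp only [hper.divMaslov γ hγ z, hper γ hγ z]
  have hz := hp.eq_zero_of_integral_eq_zero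
    (continuous_const.mul (hfc.mul (f.continuous.comp hXc))) hnn
    (by rw [integral_const_mul, hint, mul_zero]) z₀
  have h1 : f (X z₀) = 1 := f.one_of_mem_closedBall (Metric.mem_closedBall_self f.rIn_pos.le)
  simp only [h1, mul_one] at hz
  exact (hfib z₀ rfl).ne' hz

/-- The Lagrangian angle of a Hamiltonian stationary torus is harmonic. -/
theorem divMaslov_eq_zero (hper : IsPeriodic b X) (hstat : IsHamiltonianStationary b X) (z : ℂ) :
    divMaslov X z = 0 := by
  by_contra hne
  obtain ⟨z₀, hz₀, hgen⟩ := h.exists_generic (O := {z | divMaslov X z ≠ 0})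
    (isOpen_ne_fun h.contDiff_divMaslov.continuous continuous_const) ⟨z, hne⟩
  -- With s = Δβ(z₀) = σ Δβ(w), the product s · Δβ(w) is σ times a nonzero square.
  refine h.divMaslov_eq_zero_of_fiber hper hstat (z₀ := z₀) (s := divMaslov X z₀) fun w hw => ?_
  obtain ⟨σ, hσ, hσw⟩ := hgen w hw
  have h1 : divMaslov X w ≠ 0 := fun h0 => hz₀ (by rw [hσw, h0, mul_zero])
  rw [hσw, mul_assoc]
  exact mul_pos hσ (mul_self_pos.2 h1)

end IsConfLag

end HamStat

/-! ### The Lax equation for loops whose rotation part is a multiple of Lᵢ. -/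

namespace HamStat

open Filter Topology

/-- Complex vectors of the complexified `ℝ⁴`. -/
abbrev V4 : Type := Fin 4 → ℂ

/-- Multiplication by `Lᵢ` on the complexification of `ℝ⁴`. -/
def JC : V4 →L[ℂ] V4 := LinearMap.toContinuousLinearMap (Matrix.mulVecLin (Li ℂ))

/-- Multiplication by `Lⱼ` on the complexification of `ℝ⁴`. -/
def KC : V4 →L[ℂ] V4 := LinearMap.toContinuousLinearMap (Matrix.mulVecLin (Lj ℂ))

theorem JC_apply (x : V4) : JC x = Li ℂ *ᵥ x := rfl

theorem KC_apply (x : V4) : KC x = Lj ℂ *ᵥ x := rfl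

theorem JC_eq (x : V4) : JC x = ![-x 1, x 0, -x 3, x 2] := by
  rw [JC_apply]
  ext i
  fin_cases i <;> simp [Li, Matrix.mulVec, dotProduct, Fin.sum_univ_four]

theorem KC_eq (x : V4) : KC x = ![-x 2, x 3, x 0, -x 1] := by
  rw [KC_apply]
  ext i
  fin_cases i <;> simp [Lj, Matrix.mulVec, dotProduct, Fin.sum_univ_four]

theorem JC_JC (x : V4) : JC (JC x) = -x := by
  rw [JC_eq, JC_eq]
  ext i
  fin_cases i <;> simp

theorem KC_JC (x : V4) : KC (JC x) = -JC (KC x) := by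
  rw [KC_eq, JC_eq, JC_eq, KC_eq]
  ext i
  fin_cases i <;> simp

theorem star_JC (x : V4) : star (JC x) = JC (star x) := by
  rw [JC_eq, JC_eq]
  ext i
  fin_cases i <;> simp

theorem star_KC (x : V4) : star (KC x) = KC (star x) := by
  rw [KC_eq, KC_eq]
  ext i
  fin_cases i <;> simp

theorem dv_star {f : ℂ → V4} (hf : ContDiff ℝ ∞ f) (v : ℂ) :
    dv v (fun z => star (f z)) = fun z => star (dv v f z) :=
  dv_clm hf (starL' ℝ : V4 ≃L[ℝ] V4).toContinuousLinearMap v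

theorem contDiff_star {f : ℂ → V4} (hf : ContDiff ℝ ∞ f) : ContDiff ℝ ∞ fun z => star (f z) :=
  (starL' ℝ : V4 ≃L[ℝ] V4).toContinuousLinearMap.contDiff.comp hf

theorem dz_star {f : ℂ → V4} (hf : ContDiff ℝ ∞ f) :
    dz (fun z => star (f z)) = fun z => star (dzb f z) := by
  ext z
  simp [dz, dzb, dv_star hf, sub_eq_add_neg]
  ring

theorem dzb_star {f : ℂ → V4} (hf : ContDiff ℝ ∞ f) :
    dzb (fun z => star (f z)) = fun z => star (dz f z) := by
  ext z
  simp [dz, dzb, dv_star hf, sub_eq_add_neg]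
  ring

theorem tau_Li (c : ℂ) (t : V4) : tau (c • Li ℂ, t) = (-c • Li ℂ, -KC t) := by
  have h : Lj ℂ * Li ℂ * Lj ℂ = Li ℂ := by
    ext i j
    fin_cases i <;> fin_cases j <;> simp [Li, Lj, Matrix.mul_apply, Fin.sum_univ_four]
  simp [tau, h, KC_apply]

theorem br_Li (c c' : ℂ) (t t' : V4) :
    br (c • Li ℂ, t) (c' • Li ℂ, t') = (0, c • JC t' - c' • JC t) := by
  simp [br, JC_apply, Matrix.smul_mulVec, smul_comm c c']

section Extended

variable {u : V4} {b : ℂ}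

/-- The two cases s = i and s = -i serve for u and for its conjugate. Under τ, Lᵢ has eigenvalue -1
and t has eigenvalue -s. -/
theorem eigProj_Li (k : ℤ) (c s : ℂ) (t : V4) (ht : KC t = s • t) (hs : s ^ 2 = -1) :
    eigProj k (c • Li ℂ, t) = (1 / 4 : ℂ) • ((c • Li ℂ, t) + Complex.I ^ (-k) • (-c • Li ℂ, -s • t)
      + Complex.I ^ (-(k * 2)) • (c • Li ℂ, -t) + Complex.I ^ (-(k * 3)) • (-c • Li ℂ, s • t)) := by
  have h1 : tau (c • Li ℂ, t) = (-c • Li ℂ, -s • t) := by rw [tau_Li, ht, neg_smul s]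
  have h2 : tau (-c • Li ℂ, -s • t) = (c • Li ℂ, -t) := by
    rw [tau_Li, map_smul, ht, smul_smul, neg_neg, neg_mul, ← sq, hs]
    simp
  have h3 : tau (c • Li ℂ, -t) = (-c • Li ℂ, s • t) := by
    rw [tau_Li, map_neg, ht, neg_neg]
  simp only [eigProj, Finset.sum_range_succ, Finset.sum_range_zero, zero_add,
    Function.iterate_succ, Function.iterate_zero, Function.comp, id, h1, h2, h3, Nat.cast_zero,
    mul_zero, neg_zero, zpow_zero, one_smul, Nat.cast_one, mul_one, Nat.cast_ofNat]

theorem I_zpow_neg_two : Complex.I ^ (-2 : ℤ) = -1 := by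
  rw [zpow_neg, show Complex.I ^ (2 : ℤ) = -1 from by exact_mod_cast Complex.I_sq]; norm_num

theorem I_zpow_neg_one : Complex.I ^ (-1 : ℤ) = -Complex.I := by
  rw [zpow_neg_one, Complex.inv_I]

theorem I_zpow_neg_three : Complex.I ^ (-3 : ℤ) = Complex.I := by
  rw [show (-3 : ℤ) = -2 + -1 from rfl, zpow_add₀ Complex.I_ne_zero, I_zpow_neg_two,
    I_zpow_neg_one]; simp

theorem I_zpow_neg_four : Complex.I ^ (-4 : ℤ) = 1 := by
  rw [show (-4 : ℤ) = -2 + -2 from rfl, zpow_add₀ Complex.I_ne_zero, I_zpow_neg_two]; simp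

theorem I_zpow_neg_six : Complex.I ^ (-6 : ℤ) = -1 := by
  rw [show (-6 : ℤ) = -4 + -2 from rfl, zpow_add₀ Complex.I_ne_zero, I_zpow_neg_two,
    I_zpow_neg_four]; simp

theorem eigProj_two_Li (c s : ℂ) (t : V4) (ht : KC t = s • t) (hs : s ^ 2 = -1) :
    eigProj 2 (c • Li ℂ, t) = (c • Li ℂ, 0) := by
  rw [eigProj_Li 2 c s t ht hs]
  rw [show -((2 : ℤ) * 2) = -4 by norm_num, show -((2 : ℤ) * 3) = -6 by norm_num,
    I_zpow_neg_two, I_zpow_neg_four, I_zpow_neg_six]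
  refine Prod.ext ?_ ?_
  all_goals
    simp only [Prod.fst_add, Prod.snd_add, Prod.smul_fst, Prod.smul_snd]
    module

theorem eigProj_zero_Li (c s : ℂ) (t : V4) (ht : KC t = s • t) (hs : s ^ 2 = -1) :
    eigProj 0 (c • Li ℂ, t) = 0 := by
  rw [eigProj_Li 0 c s t ht hs]
  simp

theorem eigProj_neg_one_Li (c : ℂ) (t : V4) (ht : KC t = Complex.I • t) :
    eigProj (-1) (c • Li ℂ, t) = (0, t) := by
  have g2 : Complex.I ^ (2 : ℤ) = -1 := by exact_mod_cast Complex.I_sq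
  have g3 : Complex.I ^ (3 : ℤ) = -Complex.I := by exact_mod_cast Complex.I_pow_three
  rw [eigProj_Li (-1) c Complex.I t ht Complex.I_sq]
  norm_num [g2, g3, smul_smul]
  module

theorem eigProj_one_Li (c : ℂ) (t : V4) (ht : KC t = (-Complex.I) • t) :
    eigProj 1 (c • Li ℂ, t) = (0, t) := by
  rw [eigProj_Li 1 c (-Complex.I) t ht (by simp)]
  norm_num [I_zpow_neg_one, I_zpow_neg_two, I_zpow_neg_three, smul_smul]
  module

/-- Lᵢ has degree 2, u degree -1 and ū degree 1 in the grading by τ, and no component of degree 0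
occurs, so each term receives its power of μ. -/
theorem extended_eq {θ : ℂ → AffC} (hu : KC u = Complex.I • u) (h1 : onDz θ = (b • Li ℂ, u))
    (h2 : onDzbar θ = (starRingEnd ℂ b • Li ℂ, star u)) (μ v : ℂ) :
    extended θ μ v = ((μ ^ (-2 : ℤ) * v * b + μ ^ 2 * starRingEnd ℂ v * starRingEnd ℂ b) • Li ℂ,
      (μ ^ (-1 : ℤ) * v) • u + (μ * starRingEnd ℂ v) • star u) := by
  have hu' : KC (star u) = (-Complex.I) • star u := by
    rw [← star_KC, hu, star_smul]; simp
  rw [extended, h1, h2, eigProj_two_Li _ _ _ hu Complex.I_sq, eigProj_neg_one_Li _ _ hu,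
    eigProj_zero_Li _ _ _ hu Complex.I_sq, eigProj_zero_Li _ _ _ hu' (by simp),
    eigProj_one_Li _ _ hu', eigProj_two_Li _ _ _ hu' (by simp)]
  ext : 1
  · simp [add_smul, smul_smul]
  · simp

end Extended

section LaurentSums

variable {E : Type*} [AddCommGroup E] [Module ℂ E]

/-- Sums over all of ℤ make the passage from t(n + k) to a power of μ a mere change of index, with
no boundary terms at ±d. -/
theorem finsum_shift (f : ℤ → E) (k : ℤ) {μ : ℂ} (hμ : μ ≠ 0) :
    ∑ᶠ n : ℤ, μ ^ n • f (n + k) = μ ^ (-k) • ∑ᶠ n : ℤ, μ ^ n • f n := by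
  have h1 : ∑ᶠ n : ℤ, μ ^ n • f n = ∑ᶠ n : ℤ, μ ^ (n + k) • f (n + k) :=
    (finsum_comp_equiv (Equiv.addRight k) (f := fun n => μ ^ n • f n)).symm
  have h2 : ∀ n : ℤ, μ ^ (n + k) • f (n + k) = μ ^ k • (μ ^ n • f (n + k)) := fun n => by
    rw [smul_smul, zpow_add₀ hμ, mul_comm]
  rw [h1, finsum_congr h2, ← smul_finsum, smul_smul, zpow_neg, inv_mul_cancel₀ (zpow_ne_zero _ hμ),
    one_smul]

end LaurentSums

/-- Coefficients of a polynomial Killing field for the form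
`((μ⁻² b dz + μ² b̄ dz̄) Lᵢ, μ⁻¹ u dz + μ ū dz̄)`, whose rotation part `ρ n • Lᵢ` is constant. -/
structure IsKillingCoeff (u : ℂ → V4) (b : ℂ) (d : ℕ) (ρ : ℤ → ℂ) (t : ℤ → ℂ → V4) : Prop where
  smooth : ∀ n, ContDiff ℝ ∞ (t n)
  rot_zero : ∀ n, (d : ℤ) < |n| → ρ n = 0
  trans_zero : ∀ n, (d : ℤ) < |n| → t n = fun _ => 0
  eq_dz : ∀ n z, dz (t n) z = ρ (n + 1) • JC (u z) - b • JC (t (n + 2) z)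
  eq_dzb : ∀ n z, dzb (t n) z =
    ρ (n - 1) • JC (star (u z)) - starRingEnd ℂ b • JC (t (n - 2) z)
  rot_conj : ∀ n, ρ (-n) = starRingEnd ℂ (ρ n)
  trans_conj : ∀ n z, t (-n) z = star (t n z)
  rot_twist : ∀ n, Complex.I ^ n * ρ n = -ρ n
  trans_twist : ∀ n z, Complex.I ^ n • t n z = -KC (t n z)

namespace IsKillingCoeff

variable {u : ℂ → V4} {b : ℂ} {d : ℕ} {ρ : ℤ → ℂ} {t : ℤ → ℂ → V4}
  (h : IsKillingCoeff u b d ρ t)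

include h

theorem loopEval_eq (μ z : ℂ) : loopEval d (fun n => (ρ n • Li ℂ, t n z)) μ =
    ((∑ᶠ n : ℤ, μ ^ n • ρ n) • Li ℂ, ∑ᶠ n : ℤ, μ ^ n • t n z) := by
  have h1 : ∀ n : ℤ, n ∉ Finset.Icc (-(d : ℤ)) d → (d : ℤ) < |n| := by
    intro n hn
    rw [Finset.mem_Icc, ← abs_le, not_le] at hn
    exact hn
  rw [finsum_eq_finsetSum_of_support_subset (s := Finset.Icc (-(d : ℤ)) d) _ (fun n hn => by
      by_contra hc
      exact hn (by simp [h.rot_zero n (h1 n hc)])),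
    finsum_eq_finsetSum_of_support_subset (s := Finset.Icc (-(d : ℤ)) d) _ (fun n hn => by
      by_contra hc
      exact hn (by simp [h.trans_zero n (h1 n hc)]))]
  rw [loopEval, Finset.sum_smul]
  ext : 1
  · rw [Prod.fst_sum]
    simp [smul_smul]
  · rw [Prod.snd_sum]
    simp

theorem finite_rot (k : ℤ) (c : ℤ → ℂ) (x : V4) :
    (Function.support fun n : ℤ => c n • (ρ (n + k) • x)).Finite := by
  refine (Set.finite_Icc (-(d : ℤ) - k) (d - k)).subset fun n hn => ?_
  by_contra hc
  refine hn ?_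
  have : (d : ℤ) < |n + k| := by
    by_contra h2
    rw [not_lt, abs_le] at h2
    exact hc ⟨by linarith, by linarith⟩
  simp [h.rot_zero _ this]

theorem finite_trans (k : ℤ) (c : ℤ → ℂ) (L : V4 →L[ℂ] V4) (z : ℂ) :
    (Function.support fun n : ℤ => c n • L (t (n + k) z)).Finite := by
  refine (Set.finite_Icc (-(d : ℤ) - k) (d - k)).subset fun n hn => ?_
  by_contra hc
  refine hn ?_
  have : (d : ℤ) < |n + k| := by
    by_contra h2
    rw [not_lt, abs_le] at h2
    exact hc ⟨by linarith, by linarith⟩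
  simp [h.trans_zero _ this]

theorem contDiff_loop (μ : ℂ) : ContDiff ℝ ∞ fun z => ∑ᶠ n : ℤ, μ ^ n • t n z := by
  have h1 : ∀ z, ∑ᶠ n : ℤ, μ ^ n • t n z = ∑ n ∈ Finset.Icc (-(d : ℤ)) d, μ ^ n • t n z := by
    intro z
    refine finsum_eq_finsetSum_of_support_subset _ fun n hn => ?_
    by_contra hc
    rw [Finset.mem_coe, Finset.mem_Icc, ← abs_le, not_le] at hc
    exact hn (by simp [h.trans_zero n hc])
  simp only [h1]
  exact ContDiff.sum fun n _ => contDiff_const_smulC (h.smooth n) _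

theorem dv_loop (μ v z : ℂ) : dv v (fun z => ∑ᶠ n : ℤ, μ ^ n • t n z) z =
    ∑ᶠ n : ℤ, μ ^ n • dv v (t n) z := by
  have h1 : ∀ z, ∑ᶠ n : ℤ, μ ^ n • t n z = ∑ n ∈ Finset.Icc (-(d : ℤ)) d, μ ^ n • t n z := by
    intro z
    refine finsum_eq_finsetSum_of_support_subset _ fun n hn => ?_
    by_contra hc
    rw [Finset.mem_coe, Finset.mem_Icc, ← abs_le, not_le] at hc
    exact hn (by simp [h.trans_zero n hc])
  have h2 : ∑ᶠ n : ℤ, μ ^ n • dv v (t n) z =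
      ∑ n ∈ Finset.Icc (-(d : ℤ)) d, μ ^ n • dv v (t n) z := by
    refine finsum_eq_finsetSum_of_support_subset _ fun n hn => ?_
    by_contra hc
    rw [Finset.mem_coe, Finset.mem_Icc, ← abs_le, not_le] at hc
    exact hn (by simp [h.trans_zero n hc, dv_const])
  simp only [h1]
  change fderiv ℝ _ z v = _
  rw [fderiv_fun_sum fun n _ => differentiableAt_of_smooth (contDiff_const_smulC (h.smooth n) _) z]
  rw [sum_apply]
  refine (Finset.sum_congr rfl fun n _ => ?_).trans h2.symm
  exact congrFun (dv_const_smul (h.smooth n) (μ ^ n) v) z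

/-- This is the translation component of the Lax equation. Multiplying the coefficient equations by
μⁿ and summing turns their index shifts by ±1 and ±2 into the powers of μ in the extended form. -/
theorem dv_loop_eq {μ : ℂ} (hμ : μ ≠ 0) (v z : ℂ) :
    ∑ᶠ n : ℤ, μ ^ n • dv v (t n) z =
      (∑ᶠ n : ℤ, μ ^ n • ρ n) • JC ((μ ^ (-1 : ℤ) * v) • u z + (μ * starRingEnd ℂ v) • star (u z))
      - (μ ^ (-2 : ℤ) * v * b + μ ^ 2 * starRingEnd ℂ v * starRingEnd ℂ b) •
        JC (∑ᶠ n : ℤ, μ ^ n • t n z) := by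
  have hpt : ∀ n : ℤ, μ ^ n • dv v (t n) z =
      ((μ ^ n * v) • (ρ (n + 1) • JC (u z)) - (μ ^ n * (v * b)) • JC (t (n + 2) z))
      + ((μ ^ n * starRingEnd ℂ v) • (ρ (n + -1) • JC (star (u z)))
        - (μ ^ n * (starRingEnd ℂ v * starRingEnd ℂ b)) • JC (t (n + -2) z)) := by
    intro n
    rw [dv_eq_dz_dzb, h.eq_dz, h.eq_dzb, ← sub_eq_add_neg, ← sub_eq_add_neg]
    module
  have f1 := h.finite_rot 1 (fun n => μ ^ n * v) (JC (u z))
  have f2 := h.finite_trans 2 (fun n => μ ^ n * (v * b)) JC z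
  have f3 := h.finite_rot (-1) (fun n => μ ^ n * starRingEnd ℂ v) (JC (star (u z)))
  have f4 := h.finite_trans (-2) (fun n => μ ^ n * (starRingEnd ℂ v * starRingEnd ℂ b)) JC z
  have r1 : ∀ (c x) (k : ℤ), ∑ᶠ n : ℤ, (μ ^ n * c) • (ρ (n + k) • x) =
      (μ ^ (-k) * c * ∑ᶠ n : ℤ, μ ^ n • ρ n) • (x : V4) := by
    intro c x k
    have e : ∀ n : ℤ, (μ ^ n * c) • (ρ (n + k) • x) = (μ ^ n • ρ (n + k)) • (c • x) := fun n => by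
      simp only [smul_smul, smul_eq_mul]; ring_nf
    rw [finsum_congr e, ← finsum_smul, finsum_shift _ _ hμ, smul_smul, smul_eq_mul]
    ring_nf
  have r2 : ∀ (c : ℂ) (k : ℤ), ∑ᶠ n : ℤ, (μ ^ n * c) • JC (t (n + k) z) =
      (μ ^ (-k) * c) • JC (∑ᶠ n : ℤ, μ ^ n • t n z) := by
    intro c k
    have e : ∀ n : ℤ, (μ ^ n * c) • JC (t (n + k) z) = c • (μ ^ n • JC (t (n + k) z)) := fun n => by
      rw [smul_smul, mul_comm]
    have hfin := h.finite_trans 0 (fun n => μ ^ n) (ContinuousLinearMap.id ℂ V4) z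
    simp only [add_zero, ContinuousLinearMap.id_apply] at hfin
    have e2 := JC.toLinearMap.toAddMonoidHom.map_finsum hfin
    change JC (∑ᶠ n : ℤ, μ ^ n • t n z) = ∑ᶠ n : ℤ, JC (μ ^ n • t n z) at e2
    rw [finsum_congr e, ← smul_finsum, finsum_shift (fun n => JC (t n z)) _ hμ, e2]
    simp only [map_smul]
    rw [smul_smul, mul_comm]
  rw [finsum_congr hpt, finsum_add_distrib ((f1.union f2).subset (Function.support_sub _ _))
    ((f3.union f4).subset (Function.support_sub _ _)), finsum_sub_distrib f1 f2,
    finsum_sub_distrib f3 f4, r1, r1, r2, r2]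
  simp only [map_add, map_smul, neg_neg]
  rw [zpow_one, show μ ^ (2 : ℤ) = μ ^ 2 from by norm_cast]
  module

/-- The operator r sees only the rotation part at index -d + 2, which `a5` makes zero; the
translation part at that index is unconstrained. -/
theorem isAdapted {F : ℂ → Matrix (Fin 4) (Fin 4) ℝ} {X : ℂ → E4}
    (hu : ∀ z, KC (u z) = Complex.I • u z)
    (h1 : ∀ z, onDz (maurerCartan F X z) = (b • Li ℂ, u z))
    (h2 : ∀ z, onDzbar (maurerCartan F X z) = (starRingEnd ℂ b • Li ℂ, star (u z)))
    (a1 : ρ (-(d : ℤ)) = b) (a2 : ∀ z, t (-(d : ℤ)) z = 0) (a3 : ρ (-(d : ℤ) + 1) = 0)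
    (a4 : ∀ z, t (-(d : ℤ) + 1) z = u z) (a5 : ρ (-(d : ℤ) + 2) = 0) :
    IsAdaptedPolynomialKillingField F X d (fun n z => (ρ n • Li ℂ, t n z)) where
  smooth_rot n i j := contDiff_const
  smooth_trans n i := contDiff_pi.1 (h.smooth n) i
  twisted z μ hμ := by
    have hμ0 : μ ≠ 0 := by
      rintro rfl
      simp at hμ
    constructor
    -- On the unit circle conjugation inverts μ, so reality of the loop is the symmetry n ↦ -n of
    -- its coefficients.
    · have hc : ∀ n : ℤ, starRingEnd ℂ (μ ^ n) = μ ^ (-n) := by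
        intro n
        rw [map_zpow₀, ← Complex.inv_eq_conj hμ, inv_zpow, zpow_neg]
      have hr : starRingEnd ℂ (∑ᶠ n : ℤ, μ ^ n • ρ n) = ∑ᶠ n : ℤ, μ ^ n • ρ n := by
        have e := (finsum_comp_equiv (Equiv.neg ℤ) (f := fun n : ℤ => μ ^ n • ρ n)).symm
        conv_rhs => rw [e]
        have hfin : (Function.support fun n : ℤ => μ ^ n • ρ n).Finite := by
          refine (Set.finite_Icc (-(d : ℤ)) d).subset fun n hn => ?_
          by_contra hc
          rw [Set.mem_Icc, ← abs_le, not_le] at hc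
          exact hn (by simp [h.rot_zero n hc])
        have e2 := (starRingEnd ℂ).toAddMonoidHom.map_finsum hfin
        refine e2.trans (finsum_congr fun n => ?_)
        simp only [Equiv.neg_apply, h.rot_conj, ← hc]
        exact map_mul (starRingEnd ℂ) (μ ^ n) (ρ n)
      have ht : star (∑ᶠ n : ℤ, μ ^ n • t n z) = ∑ᶠ n : ℤ, μ ^ n • t n z := by
        have e := (finsum_comp_equiv (Equiv.neg ℤ) (f := fun n : ℤ => μ ^ n • t n z)).symm
        conv_rhs => rw [e]
        have hfin := h.finite_trans 0 (fun n => μ ^ n) (ContinuousLinearMap.id ℂ V4) z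
        simp only [add_zero, ContinuousLinearMap.id_apply] at hfin
        have e2 := (starAddEquiv : V4 ≃+ V4).toAddMonoidHom.map_finsum hfin
        refine e2.trans (finsum_congr fun n => ?_)
        simp only [Equiv.neg_apply, h.trans_conj, ← hc]
        exact star_smul _ _
      rw [h.loopEval_eq]
      refine ⟨(∑ᶠ n : ℤ, μ ^ n • ρ n).re, 0, 0, 0, fun i => ((∑ᶠ n : ℤ, μ ^ n • t n z) i).re, ?_⟩
      refine Prod.ext ?_ ?_
      · generalize (∑ᶠ n : ℤ, μ ^ n • ρ n) = R at hr
        simp only [Complex.conj_eq_iff_re.1 hr]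
        simp
      · ext i
        exact (Complex.conj_eq_iff_re.1 (congrFun ht i)).symm
    · rw [h.loopEval_eq, h.loopEval_eq, tau_Li]
      refine Prod.ext ?_ ?_
      · refine congrArg (fun c : ℂ => c • Li ℂ) ?_
        rw [← finsum_neg_distrib]
        refine finsum_congr fun n => ?_
        have := h.rot_twist n
        rw [mul_zpow, smul_eq_mul, smul_eq_mul]
        linear_combination μ ^ n * this
      · have hfin := h.finite_trans 0 (fun n => μ ^ n) (ContinuousLinearMap.id ℂ V4) z
        simp only [add_zero, ContinuousLinearMap.id_apply] at hfin
        have e2 := KC.toLinearMap.toAddMonoidHom.map_finsum hfin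
        change KC (∑ᶠ n : ℤ, μ ^ n • t n z) = ∑ᶠ n : ℤ, KC (μ ^ n • t n z) at e2
        change _ = -KC (∑ᶠ n : ℤ, μ ^ n • t n z)
        rw [e2, ← finsum_neg_distrib]
        refine finsum_congr fun n => ?_
        rw [mul_zpow, mul_comm, mul_smul, h.trans_twist, map_smul, smul_neg]
  lax μ hμ z v := by
    simp only [h.loopEval_eq]
    -- Both rotation components are zero: the bracket because multiples of Lᵢ commute, the
    -- differential because ρ is constant.
    rw [extended_eq (hu z) (h1 z) (h2 z), br_Li, ← h.dv_loop_eq hμ, ← h.dv_loop]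
    simp only [dAff]
    ext : 1
    · ext i j
      simp
    · funext i
      have h3 := congrFun (dv_clm (h.contDiff_loop μ)
        ((ContinuousLinearMap.proj i : V4 →L[ℝ] ℂ)) v) z
      exact h3
  adapted z := by
    rw [h1]
    simp only [a1, a2, a3, a4, a5, rOp]
    simp [projG0]

end IsKillingCoeff

end HamStat

/-! ### Construction of the Killing field from an annihilating polynomial. -/

namespace HamStat

open Filter Topology

section IterateDz

variable {E : Type*} [NormedAddCommGroup E] [NormedSpace ℂ E]

theorem iterate_dz_clm {F : Type*} [NormedAddCommGroup F] [NormedSpace ℂ F] {f : ℂ → E}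
    (hf : ContDiff ℝ ∞ f) (L : E →L[ℂ] F) (k : ℕ) :
    dz^[k] (fun z => L (f z)) = fun z => L (dz^[k] f z) := by
  induction k with
  | zero => rfl
  | succ k ih =>
    rw [Function.iterate_succ_apply', ih, Function.iterate_succ_apply',
      dz_clm (contDiff_iterate_dz hf k)]

theorem dzb_dz_iterate {f : ℂ → E} (hf : ContDiff ℝ ∞ f) {c : ℂ}
    (h : ∀ z, dz (dzb f) z = c • f z) (k : ℕ) (z : ℂ) :
    dzb (dz^[k + 1] f) z = c • dz^[k] f z := by
  induction k generalizing z with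
  | zero => rw [zero_add, Function.iterate_one, ← dz_dzb_comm hf, h]; rfl
  | succ k ih =>
    rw [Function.iterate_succ_apply' dz (k + 1), ← dz_dzb_comm (contDiff_iterate_dz hf _),
      funext ih, dz_const_smul (contDiff_iterate_dz hf _), Function.iterate_succ_apply']

theorem dz_finsetSum {ι : Type*} (s : Finset ι) {f : ι → ℂ → E} (hf : ∀ i, ContDiff ℝ ∞ (f i)) :
    dz (fun z => ∑ i ∈ s, f i z) = fun z => ∑ i ∈ s, dz (f i) z := by
  classical
  induction s using Finset.induction_on with
  | empty => simp [dz_const]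
  | insert a s ha ih =>
    simp only [Finset.sum_insert ha]
    rw [dz_add (hf a) (ContDiff.sum fun i _ => hf i), ih]

theorem dzb_finsetSum {ι : Type*} (s : Finset ι) {f : ι → ℂ → E} (hf : ∀ i, ContDiff ℝ ∞ (f i)) :
    dzb (fun z => ∑ i ∈ s, f i z) = fun z => ∑ i ∈ s, dzb (f i) z := by
  classical
  induction s using Finset.induction_on with
  | empty => simp [dzb_const]
  | insert a s ha ih =>
    simp only [Finset.sum_insert ha]
    rw [dzb_add (hf a) (ContDiff.sum fun i _ => hf i), ih]

/-- The Horner quotients `∑ₖ q_{l+k} (∂²/∂z²)ᵏ u` of a polynomial in `∂²/∂z²` applied to `u`. -/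
def horner (Q : Polynomial ℂ) (u : ℂ → E) (l : ℕ) (z : ℂ) : E :=
  ∑ k ∈ Finset.range (Q.natDegree + 1 - l), Q.coeff (l + k) • dz^[2 * k] u z

variable {Q : Polynomial ℂ} {u : ℂ → E}

theorem contDiff_horner (hu : ContDiff ℝ ∞ u) (l : ℕ) : ContDiff ℝ ∞ (horner Q u l) :=
  ContDiff.sum fun _ _ => contDiff_const_smulC (contDiff_iterate_dz hu _) _

theorem horner_of_lt {l : ℕ} (hl : Q.natDegree < l) : horner Q u l = fun _ => 0 := by
  ext z
  rw [horner, show Q.natDegree + 1 - l = 0 by omega, Finset.range_zero, Finset.sum_empty]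

theorem horner_natDegree (hQ : Q.Monic) : horner Q u Q.natDegree = u := by
  ext z
  rw [horner, show Q.natDegree + 1 - Q.natDegree = 1 by omega]
  simp [hQ]

/-- Horner's rule Q_l = x Q_{l+1} + q_l with x = ∂²/∂z². It also holds beyond the degree, where
every term vanishes. -/
theorem horner_succ (hu : ContDiff ℝ ∞ u) (l : ℕ) (z : ℂ) :
    horner Q u l z = dz (dz (horner Q u (l + 1))) z + Q.coeff l • u z := by
  have hs : ∀ k, ContDiff ℝ ∞ fun z => Q.coeff (l + 1 + k) • dz^[2 * k] u z := fun k =>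
    contDiff_const_smulC (contDiff_iterate_dz hu _) _
  have h1 : dz (dz (horner Q u (l + 1))) z = ∑ k ∈ Finset.range (Q.natDegree + 1 - (l + 1)),
      Q.coeff (l + 1 + k) • dz^[2 * (k + 1)] u z := by
    have e1 : ∀ k, dz (fun z => Q.coeff (l + 1 + k) • dz^[2 * k] u z) =
        fun z => Q.coeff (l + 1 + k) • dz^[2 * k + 1] u z := fun k => by
      rw [dz_const_smul (contDiff_iterate_dz hu _), Function.iterate_succ_apply']
    have e2 : ∀ k, dz (fun z => Q.coeff (l + 1 + k) • dz^[2 * k + 1] u z) =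
        fun z => Q.coeff (l + 1 + k) • dz^[2 * (k + 1)] u z := fun k => by
      rw [dz_const_smul (contDiff_iterate_dz hu _), ← Function.iterate_succ_apply' dz]
      rfl
    unfold horner
    rw [dz_finsetSum _ hs]
    simp only [e1]
    rw [dz_finsetSum _ fun k => contDiff_const_smulC (contDiff_iterate_dz hu _) _]
    simp only [e2]
  rw [h1]
  rcases le_or_gt l Q.natDegree with hl | hl
  · rw [horner, show Q.natDegree + 1 - l = (Q.natDegree + 1 - (l + 1)) + 1 by omega,
      Finset.sum_range_succ']
    refine congrArg₂ _ (Finset.sum_congr rfl fun k _ => ?_) rfl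
    rw [show l + (k + 1) = l + 1 + k by omega]
  · rw [horner, show Q.natDegree + 1 - l = 0 by omega,
      show Q.natDegree + 1 - (l + 1) = 0 by omega, Polynomial.coeff_eq_zero_of_natDegree_lt hl]
    simp

theorem dzb_dz_horner (hu : ContDiff ℝ ∞ u) {c : ℂ} (h : ∀ z, dz (dzb u) z = c • u z) (l : ℕ)
    (z : ℂ) : dzb (dz (horner Q u l)) z = c • horner Q u l z := by
  have hs : ∀ k, ContDiff ℝ ∞ fun z => Q.coeff (l + k) • dz^[2 * k] u z := fun k =>
    contDiff_const_smulC (contDiff_iterate_dz hu _) _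
  have e1 : ∀ k, dz (fun z => Q.coeff (l + k) • dz^[2 * k] u z) =
      fun z => Q.coeff (l + k) • dz^[2 * k + 1] u z := fun k => by
    rw [dz_const_smul (contDiff_iterate_dz hu _), Function.iterate_succ_apply']
  have e2 : ∀ k z, dzb (fun z => Q.coeff (l + k) • dz^[2 * k + 1] u z) z =
      c • (Q.coeff (l + k) • dz^[2 * k] u z) := fun k z => by
    rw [dzb_const_smul (contDiff_iterate_dz hu _)]
    dsimp only
    rw [dzb_dz_iterate hu h, smul_comm]
  unfold horner
  rw [dz_finsetSum _ hs]
  simp only [e1]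
  rw [dzb_finsetSum _ fun k => contDiff_const_smulC (contDiff_iterate_dz hu _) _]
  simp only [e2, Finset.smul_sum]

/-- The operator ∂/∂z̄ is applied to Horner's rule, and ∂²/∂z∂z̄ acts on each quotient as the scalar
c. Thus ∂/∂z̄ is expressed through ∂/∂z of the next quotient. -/
theorem dzb_horner (hu : ContDiff ℝ ∞ u) {c : ℂ} (h : ∀ z, dz (dzb u) z = c • u z) (l : ℕ)
    (z : ℂ) : dzb (horner Q u l) z = c • dz (horner Q u (l + 1)) z + Q.coeff l • dzb u z := by
  have h1 := contDiff_dz (contDiff_horner (Q := Q) hu (l + 1))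
  rw [funext (horner_succ (Q := Q) hu l), dzb_add (contDiff_dz h1) (contDiff_const_smulC hu _),
    dzb_const_smul hu]
  dsimp only
  rw [← dz_dzb_comm h1, funext (dzb_dz_horner hu h (l + 1)),
    dz_const_smul (contDiff_horner hu _)]

end IterateDz

section KillingSequence

/-- The rotation coefficients of the non-real polynomial Killing field attached to `Q`. -/
def rotSeq (Q : Polynomial ℂ) (ν b : ℂ) (n : ℤ) : ℂ :=
  if n < 0 ∧ n % 4 = 2 then
    -(ν * Q.coeff ((-n - 2) / 4).toNat * (-b ^ 2) ^ ((-n - 2) / 4).toNat) else 0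

/-- The translation coefficients of the non-real polynomial Killing field attached to `Q`. -/
def transSeq (Q : Polynomial ℂ) (ν b : ℂ) (u : ℂ → V4) (n : ℤ) (z : ℂ) : V4 :=
  if n < 0 ∧ n % 4 = 3 then
    (-(ν * (-b ^ 2) ^ ((-n - 1) / 4).toNat * b⁻¹)) • horner Q u ((-n - 1) / 4).toNat z
  else if n < 0 ∧ n % 4 = 1 then
    (ν * (-b ^ 2) ^ ((-n - 3) / 4).toNat) • JC (dz (horner Q u (((-n - 3) / 4).toNat + 1)) z)
  else 0

variable {Q : Polynomial ℂ} {ν b : ℂ} {u : ℂ → V4}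

theorem rotSeq_two (l : ℕ) :
    rotSeq Q ν b (-(4 * l + 2)) = -(ν * Q.coeff l * (-b ^ 2) ^ l) := by
  have h : ((-(-(4 * (l : ℤ) + 2)) - 2) / 4).toNat = l := by omega
  rw [rotSeq, if_pos (by omega), h]

theorem rotSeq_zero {n : ℤ} (hn : ¬(n < 0 ∧ n % 4 = 2)) : rotSeq Q ν b n = 0 := if_neg hn

theorem transSeq_one (l : ℕ) : transSeq Q ν b u (-(4 * l + 1)) =
    fun z => (-(ν * (-b ^ 2) ^ l * b⁻¹)) • horner Q u l z := by
  have h : ((-(-(4 * (l : ℤ) + 1)) - 1) / 4).toNat = l := by omega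
  ext1 z
  rw [transSeq, if_pos (by omega), h]

theorem transSeq_three (l : ℕ) : transSeq Q ν b u (-(4 * l + 3)) =
    fun z => (ν * (-b ^ 2) ^ l) • JC (dz (horner Q u (l + 1)) z) := by
  have h : ((-(-(4 * (l : ℤ) + 3)) - 3) / 4).toNat = l := by omega
  ext1 z
  rw [transSeq, if_neg (by omega), if_pos (by omega), h]

theorem transSeq_zero {n : ℤ} (hn : ¬(n < 0 ∧ n % 2 = 1)) : transSeq Q ν b u n = fun _ => 0 := by
  ext1 z
  rw [transSeq, if_neg (by omega), if_neg (by omega)]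

theorem transSeq_cases (n : ℤ) : (∃ l : ℕ, n = -(4 * l + 1)) ∨ (∃ l : ℕ, n = -(4 * l + 3)) ∨
    ¬(n < 0 ∧ n % 2 = 1) := by
  by_cases h : n < 0 ∧ n % 2 = 1
  · by_cases h4 : n % 4 = 3
    · exact Or.inl ⟨((-n - 1) / 4).toNat, by omega⟩
    · exact Or.inr (Or.inl ⟨((-n - 3) / 4).toNat, by omega⟩)
  · exact Or.inr (Or.inr h)

theorem contDiff_transSeq (hu : ContDiff ℝ ∞ u) (n : ℤ) : ContDiff ℝ ∞ (transSeq Q ν b u n) := by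
  rcases transSeq_cases n with ⟨l, rfl⟩ | ⟨l, rfl⟩ | hn
  · rw [transSeq_one]
    exact contDiff_const_smulC (contDiff_horner hu l) _
  · rw [transSeq_three]
    exact contDiff_const_smulC
      ((JC.restrictScalars ℝ).contDiff.comp (contDiff_dz (contDiff_horner hu _))) _
  · rw [transSeq_zero hn]
    exact contDiff_const

/-- The sequence ends on the left because the Horner quotients beyond the degree of Q are zero; in
particular this covers the index -(4 deg Q + 3). -/
theorem transSeq_of_lt {n : ℤ} (hn : n < -(4 * Q.natDegree + 2)) :
    transSeq Q ν b u n = fun _ => 0 := by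
  rcases transSeq_cases n with ⟨l, rfl⟩ | ⟨l, rfl⟩ | h
  · rw [transSeq_one, horner_of_lt (by omega)]
    simp
  · rw [transSeq_three, horner_of_lt (by omega), dz_const]
    simp
  · exact transSeq_zero h

theorem rotSeq_of_lt {n : ℤ} (hn : n < -(4 * Q.natDegree + 2)) : rotSeq Q ν b n = 0 := by
  rw [rotSeq]
  split_ifs with h
  · rw [Polynomial.coeff_eq_zero_of_natDegree_lt (by omega)]
    simp
  · rfl

/-- At indices -(4l + 1), with l ≥ 1, the equation holds by the choice of scalars and Lᵢ² = -1; at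
-(4l + 3) it is Horner's rule, the term q_l u being absorbed by the rotation coefficient. -/
theorem dz_transSeq (hb : b ≠ 0) (hu : ContDiff ℝ ∞ u) (h0 : ∀ z, horner Q u 0 z = 0) (n : ℤ)
    (z : ℂ) : dz (transSeq Q ν b u n) z =
      rotSeq Q ν b (n + 1) • JC (u z) - b • JC (transSeq Q ν b u (n + 2) z) := by
  rcases transSeq_cases n with ⟨l, rfl⟩ | ⟨l, rfl⟩ | hn
  · rw [transSeq_one, dz_const_smul (contDiff_horner hu l), rotSeq_zero (by omega)]
    cases l with
    -- At n = -1 the recursion would continue to n = 1, where the sequence is zero. It can stop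
    -- there because the quotient with l = 0 is Q(∂²/∂z²) u = 0.
    | zero =>
      rw [transSeq_zero (by omega), funext h0, dz_const]
      simp
    | succ l =>
      rw [show -(4 * ((l + 1 : ℕ) : ℤ) + 1) + 2 = -(4 * (l : ℤ) + 3) by push_cast; ring,
        transSeq_three, map_smul, JC_JC]
      have : ν * (-b ^ 2) ^ (l + 1) * b⁻¹ = -(b * (ν * (-b ^ 2) ^ l)) := by
        field_simp
        ring
      rw [this]
      module
  · have hs : ContDiff ℝ ∞ fun z => JC (dz (horner Q u (l + 1)) z) :=
      (JC.restrictScalars ℝ).contDiff.comp (contDiff_dz (contDiff_horner hu _))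
    rw [transSeq_three, dz_const_smul hs, dz_clm (contDiff_dz (contDiff_horner hu _)) JC,
      show -(4 * (l : ℤ) + 3) + 2 = -(4 * (l : ℤ) + 1) by ring,
      show -(4 * (l : ℤ) + 3) + 1 = -(4 * (l : ℤ) + 2) by ring, rotSeq_two, transSeq_one]
    dsimp only
    rw [horner_succ hu l z, map_smul, map_add, map_smul]
    match_scalars
    · field_simp
    · field_simp
      ring
  · rw [transSeq_zero hn, dz_const, transSeq_zero (by omega), rotSeq_zero (by omega)]
    simp

theorem dzb_transSeq (hb : b ≠ 0) (hu : ContDiff ℝ ∞ u) (h0 : ∀ z, horner Q u 0 z = 0)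
    (hzb : ∀ z, dzb u z = b • JC (star (u z)))
    (hlap : ∀ z, dz (dzb u) z = (-(b * starRingEnd ℂ b)) • u z) (n : ℤ) (z : ℂ) :
    dzb (transSeq Q ν b u n) z = rotSeq Q ν b (n - 1) • JC (star (u z))
      - starRingEnd ℂ b • JC (transSeq Q ν b u (n - 2) z) := by
  rcases transSeq_cases n with ⟨l, rfl⟩ | ⟨l, rfl⟩ | hn
  · rw [transSeq_one, dzb_const_smul (contDiff_horner hu l)]
    dsimp only
    rw [dzb_horner hu hlap, hzb,
      show -(4 * (l : ℤ) + 1) - 2 = -(4 * (l : ℤ) + 3) by ring,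
      show -(4 * (l : ℤ) + 1) - 1 = -(4 * (l : ℤ) + 2) by ring, rotSeq_two, transSeq_three,
      map_smul, JC_JC]
    match_scalars
    · field_simp
    · field_simp
  · have hs : ContDiff ℝ ∞ fun z => JC (dz (horner Q u (l + 1)) z) :=
      (JC.restrictScalars ℝ).contDiff.comp (contDiff_dz (contDiff_horner hu _))
    rw [transSeq_three, dzb_const_smul hs, dzb_clm (contDiff_dz (contDiff_horner hu _)) JC,
      rotSeq_zero (by omega),
      show -(4 * (l : ℤ) + 3) - 2 = -(4 * ((l + 1 : ℕ) : ℤ) + 1) by push_cast; ring, transSeq_one]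
    dsimp only
    rw [dzb_dz_horner hu hlap, map_smul, map_smul]
    match_scalars
    · field_simp
      ring
    · ring
  · rw [transSeq_zero hn, dzb_const, rotSeq_zero (by omega)]
    -- Index 1 is the one place outside the support where the equation refers back into it, namely
    -- to index -1; there the coefficient vanishes by `h0`.
    by_cases h1 : n = 1
    · subst h1
      have e := transSeq_one (Q := Q) (ν := ν) (b := b) (u := u) 0
      rw [show (1 : ℤ) - 2 = -(4 * ((0 : ℕ) : ℤ) + 1) by norm_num, e]
      dsimp only
      rw [h0]
      simp
    · rw [transSeq_zero (by omega)]
      simp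

theorem I_zpow_four_mul (l : ℕ) : Complex.I ^ (-(4 * (l : ℤ))) = 1 := by
  rw [← neg_mul, zpow_mul, I_zpow_neg_four, one_zpow]

theorem rotSeq_twist (n : ℤ) : Complex.I ^ n * rotSeq Q ν b n = -rotSeq Q ν b n := by
  by_cases h : n < 0 ∧ n % 4 = 2
  · obtain ⟨l, rfl⟩ : ∃ l : ℕ, n = -(4 * l + 2) := ⟨((-n - 2) / 4).toNat, by omega⟩
    rw [neg_add, zpow_add₀ Complex.I_ne_zero, I_zpow_four_mul, I_zpow_neg_two]
    ring
  · rw [rotSeq_zero h]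
    simp

theorem KC_horner (hu : ContDiff ℝ ∞ u) (hK : ∀ z, KC (u z) = Complex.I • u z) (l : ℕ) (z : ℂ) :
    KC (horner Q u l z) = Complex.I • horner Q u l z := by
  have h1 : ∀ k, KC (dz^[k] u z) = Complex.I • dz^[k] u z := by
    intro k
    have e1 := congrFun (iterate_dz_clm hu KC k) z
    have e2 := congrFun (iterate_dz_clm hu (Complex.I • ContinuousLinearMap.id ℂ V4) k) z
    simp only [hK] at e1
    simp only [smul_apply, ContinuousLinearMap.id_apply] at e2
    rw [← e1, e2]
  simp only [horner, map_sum, map_smul, h1, Finset.smul_sum, smul_comm Complex.I]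

theorem transSeq_twist (hu : ContDiff ℝ ∞ u) (hK : ∀ z, KC (u z) = Complex.I • u z) (n : ℤ)
    (z : ℂ) : Complex.I ^ n • transSeq Q ν b u n z = -KC (transSeq Q ν b u n z) := by
  rcases transSeq_cases n with ⟨l, rfl⟩ | ⟨l, rfl⟩ | hn
  · rw [transSeq_one, neg_add, zpow_add₀ Complex.I_ne_zero, I_zpow_four_mul, I_zpow_neg_one]
    dsimp only
    rw [map_smul, KC_horner hu hK]
    module
  · have h1 : KC (dz (horner Q u (l + 1)) z) = Complex.I • dz (horner Q u (l + 1)) z := by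
      have hs := contDiff_horner (Q := Q) hu (l + 1)
      have e1 := congrFun (dz_clm hs KC) z
      have e2 := congrFun (dz_clm hs (Complex.I • ContinuousLinearMap.id ℂ V4)) z
      simp only [KC_horner hu hK] at e1
      simp only [smul_apply, ContinuousLinearMap.id_apply] at e2
      rw [← e1, e2]
    rw [transSeq_three, neg_add, zpow_add₀ Complex.I_ne_zero, I_zpow_four_mul, I_zpow_neg_three]
    dsimp only
    rw [map_smul, KC_JC, h1, map_smul]
    module
  · rw [transSeq_zero hn]
    simp

theorem conj_I_zpow (n : ℤ) : starRingEnd ℂ (Complex.I ^ n) = Complex.I ^ (-n) := by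
  rw [map_zpow₀, Complex.conj_I, zpow_neg, ← inv_zpow, Complex.inv_I]

/-- The real polynomial Killing field attached to a polynomial `Q` with `Q(∂²/∂z²) u = 0`. -/
theorem isKillingCoeff_of_annihilator (hb : b ≠ 0) (hu : ContDiff ℝ ∞ u)
    (h0 : ∀ z, horner Q u 0 z = 0) (hzb : ∀ z, dzb u z = b • JC (star (u z)))
    (hlap : ∀ z, dz (dzb u) z = (-(b * starRingEnd ℂ b)) • u z)
    (hK : ∀ z, KC (u z) = Complex.I • u z) :
    IsKillingCoeff u b (4 * Q.natDegree + 2)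
      (fun n => rotSeq Q ν b n + starRingEnd ℂ (rotSeq Q ν b (-n)))
      (fun n z => transSeq Q ν b u n z + star (transSeq Q ν b u (-n) z)) where
  smooth n := (contDiff_transSeq hu n).add (contDiff_star (contDiff_transSeq hu (-n)))
  rot_zero n hn := by
    rcases lt_abs.1 hn with h | h
    · rw [rotSeq_zero (by omega), rotSeq_of_lt (by push_cast at h; omega)]
      simp
    · rw [rotSeq_of_lt (by push_cast at h; omega), rotSeq_zero (by omega)]
      simp
  trans_zero n hn := by
    rcases lt_abs.1 hn with h | h
    · rw [transSeq_zero (by omega), transSeq_of_lt (by push_cast at h; omega)]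
      simp
    · rw [transSeq_of_lt (by push_cast at h; omega), transSeq_zero (by omega)]
      simp
  -- Conjugation exchanges ∂/∂z and ∂/∂z̄, so the conjugate of one coefficient equation at -n is the
  -- other at n. The recursion is linear over ℝ, hence the two solutions may be added.
  eq_dz n z := by
    rw [dz_add (contDiff_transSeq hu n) (contDiff_star (contDiff_transSeq hu (-n))),
      dz_star (contDiff_transSeq hu (-n))]
    dsimp only
    rw [dz_transSeq hb hu h0, dzb_transSeq hb hu h0 hzb hlap, star_sub, star_smul, star_smul,
      star_JC, star_JC, star_star, map_add, show -n - 1 = -(n + 1) by ring,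
      show -n - 2 = -(n + 2) by ring]
    simp only [← starRingEnd_apply, Complex.conj_conj]
    module
  eq_dzb n z := by
    rw [dzb_add (contDiff_transSeq hu n) (contDiff_star (contDiff_transSeq hu (-n))),
      dzb_star (contDiff_transSeq hu (-n))]
    dsimp only
    rw [dz_transSeq hb hu h0, dzb_transSeq hb hu h0 hzb hlap, star_sub, star_smul, star_smul,
      star_JC, star_JC, map_add, show -n + 1 = -(n - 1) by ring,
      show -n + 2 = -(n - 2) by ring]
    simp only [← starRingEnd_apply]
    module
  rot_conj n := by
    simp only [map_add, neg_neg, Complex.conj_conj]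
    ring
  trans_conj n z := by
    simp only [star_add, neg_neg, star_star]
    rw [add_comm]
  rot_twist n := by
    have h1 := rotSeq_twist (Q := Q) (ν := ν) (b := b) n
    have h2 := congrArg (starRingEnd ℂ) (rotSeq_twist (Q := Q) (ν := ν) (b := b) (-n))
    rw [map_mul, conj_I_zpow, neg_neg, map_neg] at h2
    rw [mul_add, h1, h2]
    ring
  trans_twist n z := by
    have h1 := transSeq_twist (Q := Q) (ν := ν) (b := b) hu hK n z
    have h2 := congrArg star (transSeq_twist (Q := Q) (ν := ν) (b := b) hu hK (-n) z)
    rw [star_smul, ← starRingEnd_apply, conj_I_zpow, neg_neg, star_neg, star_KC] at h2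
    rw [smul_add, h1, h2, map_add]
    abel

end KillingSequence

end HamStat

/-! ### Affineness of the angle and the lift by rotations about Lᵢ. -/

namespace HamStat

open Filter Topology

section LiftData

/-- The affine function with differential `α dx + κ dy`. -/
def angleFun (α κ β₀ : ℝ) (z : ℂ) : ℝ := α * z.re + κ * z.im + β₀

theorem hasFDerivAt_angleFun (α κ β₀ : ℝ) (z : ℂ) :
    HasFDerivAt (angleFun α κ β₀) (α • Complex.reCLM + κ • Complex.imCLM) z :=
  ((Complex.reCLM.hasFDerivAt.const_smul α).add
    (Complex.imCLM.hasFDerivAt.const_smul κ)).add_const β₀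

theorem contDiff_angleFun (α κ β₀ : ℝ) : ContDiff ℝ ∞ (angleFun α κ β₀) :=
  ((contDiff_const.mul Complex.reCLM.contDiff).add
    (contDiff_const.mul Complex.imCLM.contDiff)).add contDiff_const

/-- The rotation `exp (β Lᵢ / 2)` for an affine angle `β`. -/
def rotLift (α κ β₀ : ℝ) (z : ℂ) : Matrix (Fin 4) (Fin 4) ℝ :=
  Real.cos (angleFun α κ β₀ z / 2) • (1 : Matrix (Fin 4) (Fin 4) ℝ)
    + Real.sin (angleFun α κ β₀ z / 2) • Li ℝ

/-- The function `exp (-iβ/2)` for an affine angle `β`. -/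
def halfPhase (α κ β₀ : ℝ) (z : ℂ) : ℂ :=
  Complex.exp ((-(angleFun α κ β₀ z / 2) : ℝ) * Complex.I)

variable {α κ β₀ : ℝ}

theorem halfPhase_re (z : ℂ) : (halfPhase α κ β₀ z).re = Real.cos (angleFun α κ β₀ z / 2) := by
  rw [halfPhase, Complex.exp_ofReal_mul_I_re, Real.cos_neg]

theorem halfPhase_im (z : ℂ) : (halfPhase α κ β₀ z).im = -Real.sin (angleFun α κ β₀ z / 2) := by
  rw [halfPhase, Complex.exp_ofReal_mul_I_im, Real.sin_neg]

theorem contDiff_halfPhase : ContDiff ℝ ∞ (halfPhase α κ β₀) :=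
  ((Complex.ofRealCLM.contDiff.comp ((contDiff_angleFun α κ β₀).div_const 2).neg).mul
    contDiff_const).cexp

theorem dv_halfPhase (v z : ℂ) : dv v (halfPhase α κ β₀) z =
    -(Complex.I / 2) * (v.re * α + v.im * κ) * halfPhase α κ β₀ z := by
  have h1 : HasFDerivAt (fun z => (-(Complex.I / 2)) • ((angleFun α κ β₀ z : ℝ) : ℂ))
      ((-(Complex.I / 2)) • (Complex.ofRealCLM ∘L (α • Complex.reCLM + κ • Complex.imCLM))) z := by
    have h2 := (Complex.ofRealCLM.hasFDerivAt.comp z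
      (hasFDerivAt_angleFun α κ β₀ z)).const_smul (-(Complex.I / 2))
    exact h2
  have h2 : halfPhase α κ β₀ =
      fun z => Complex.exp ((-(Complex.I / 2)) • ((angleFun α κ β₀ z : ℝ) : ℂ)) := by
    ext1 z
    rw [halfPhase]
    congr 1
    push_cast
    simp only [smul_eq_mul]
    ring
  rw [h2, dv, h1.cexp.fderiv]
  simp
  ring

theorem Li_mul_Li (R : Type) [CommRing R] : Li R * Li R = -1 := by
  ext i j
  fin_cases i <;> fin_cases j <;> simp [Li, Matrix.mul_apply, Fin.sum_univ_four]

theorem inv_rotLift (z : ℂ) : (rotLift α κ β₀ z)⁻¹ =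
    Real.cos (angleFun α κ β₀ z / 2) • (1 : Matrix (Fin 4) (Fin 4) ℝ)
      - Real.sin (angleFun α κ β₀ z / 2) • Li ℝ := by
  refine Matrix.inv_eq_right_inv ?_
  have h := Real.sin_sq_add_cos_sq (angleFun α κ β₀ z / 2)
  rw [rotLift]
  simp only [add_mul, mul_sub, smul_mul_smul_comm, one_mul, mul_one, Li_mul_Li]
  have h2 : (1 : Matrix (Fin 4) (Fin 4) ℝ) = (Real.sin (angleFun α κ β₀ z / 2) ^ 2
      + Real.cos (angleFun α κ β₀ z / 2) ^ 2) • 1 := by rw [h, one_smul]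
  conv_rhs => rw [h2]
  module

theorem rotLift_mem (z : ℂ) : rotLift α κ β₀ z ∈ rotGroup := by
  have h := Real.sin_sq_add_cos_sq (angleFun α κ β₀ z / 2)
  have hLt : (Li ℝ)ᵀ = -Li ℝ := by
    ext i j
    fin_cases i <;> fin_cases j <;> simp [Li]
  refine ⟨?_, ?_⟩
  · rw [Matrix.mem_specialOrthogonalGroup_iff]
    constructor
    · rw [Matrix.mem_orthogonalGroup_iff]
      change rotLift α κ β₀ z * (rotLift α κ β₀ z)ᵀ = 1
      have h1 : (rotLift α κ β₀ z)ᵀ =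
          Real.cos (angleFun α κ β₀ z / 2) • (1 : Matrix (Fin 4) (Fin 4) ℝ)
          - Real.sin (angleFun α κ β₀ z / 2) • Li ℝ := by
        rw [rotLift, Matrix.transpose_add, Matrix.transpose_smul, Matrix.transpose_smul, hLt,
          Matrix.transpose_one, smul_neg, sub_eq_add_neg]
      rw [h1, rotLift]
      simp only [add_mul, mul_sub, smul_mul_smul_comm, one_mul, mul_one, Li_mul_Li]
      have h2 : (1 : Matrix (Fin 4) (Fin 4) ℝ) = (Real.sin (angleFun α κ β₀ z / 2) ^ 2
          + Real.cos (angleFun α κ β₀ z / 2) ^ 2) • 1 := by rw [h, one_smul]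
      conv_rhs => rw [h2]
      module
    · have h1 : rotLift α κ β₀ z = !![Real.cos (angleFun α κ β₀ z / 2),
          -Real.sin (angleFun α κ β₀ z / 2), 0, 0; Real.sin (angleFun α κ β₀ z / 2),
          Real.cos (angleFun α κ β₀ z / 2), 0, 0; 0, 0, Real.cos (angleFun α κ β₀ z / 2),
          -Real.sin (angleFun α κ β₀ z / 2); 0, 0, Real.sin (angleFun α κ β₀ z / 2),
          Real.cos (angleFun α κ β₀ z / 2)] := by
        ext i j
        fin_cases i <;> fin_cases j <;> simp [rotLift, Li]
      rw [h1]
      generalize Real.cos (angleFun α κ β₀ z / 2) = c at h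
      generalize Real.sin (angleFun α κ β₀ z / 2) = s at h
      simp [Matrix.det_succ_row_zero, Fin.sum_univ_succ, Fin.succAbove]
      linear_combination (s ^ 2 + c ^ 2 + 1) * h
  · rw [rotLift, add_mul, mul_add, Matrix.smul_mul, Matrix.smul_mul, Matrix.mul_smul,
      Matrix.mul_smul, one_mul, mul_one]

theorem rotLift_apply (z : ℂ) (i j : Fin 4) : rotLift α κ β₀ z i j =
    Real.cos (angleFun α κ β₀ z / 2) * (1 : Matrix (Fin 4) (Fin 4) ℝ) i j
      + Real.sin (angleFun α κ β₀ z / 2) * Li ℝ i j := by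
  simp [rotLift]

theorem contDiff_rotLift (i j : Fin 4) : ContDiff ℝ ∞ fun z => rotLift α κ β₀ z i j := by
  have h1 := (contDiff_angleFun α κ β₀).div_const 2
  simp only [rotLift_apply]
  exact ((Real.contDiff_cos.comp h1).mul contDiff_const).add
    ((Real.contDiff_sin.comp h1).mul contDiff_const)

theorem inv_mul_fderiv_rotLift (z v : ℂ) : (rotLift α κ β₀ z)⁻¹ *
    (Matrix.of fun i j => fderiv ℝ (fun w => rotLift α κ β₀ w i j) z v) =
      ((v.re * α + v.im * κ) / 2) • Li ℝ := by
  have h := Real.sin_sq_add_cos_sq (angleFun α κ β₀ z / 2)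
  have h1 : HasFDerivAt (fun z => angleFun α κ β₀ z / 2)
      ((2 : ℝ)⁻¹ • (α • Complex.reCLM + κ • Complex.imCLM)) z := by
    have := (hasFDerivAt_angleFun α κ β₀ z).const_smul (2 : ℝ)⁻¹
    refine this.congr_of_eventuallyEq (Eventually.of_forall fun w => ?_)
    simp [div_eq_inv_mul]
  have h2 : (Matrix.of fun i j => fderiv ℝ (fun w => rotLift α κ β₀ w i j) z v) =
      ((v.re * α + v.im * κ) / 2) • (-Real.sin (angleFun α κ β₀ z / 2) •
        (1 : Matrix (Fin 4) (Fin 4) ℝ) + Real.cos (angleFun α κ β₀ z / 2) • Li ℝ) := by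
    ext i j
    simp only [rotLift_apply, Matrix.of_apply]
    generalize hc : (1 : Matrix (Fin 4) (Fin 4) ℝ) i j = c
    generalize hd : Li ℝ i j = d
    have h3 := (h1.cos.mul_const c).add (h1.sin.mul_const d)
    have h4 := h3.fderiv
    change fderiv ℝ (fun z => Real.cos (angleFun α κ β₀ z / 2) * c
      + Real.sin (angleFun α κ β₀ z / 2) * d) z = _ at h4
    rw [h4]
    simp [hc, hd]
    ring
  rw [h2, inv_rotLift, Matrix.mul_smul]
  congr 1
  simp only [sub_mul, mul_add, smul_mul_smul_comm, one_mul, mul_one, Li_mul_Li]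
  have h3 : Li ℝ = (Real.sin (angleFun α κ β₀ z / 2) ^ 2
      + Real.cos (angleFun α κ β₀ z / 2) ^ 2) • Li ℝ := by rw [h, one_smul]
  conv_rhs => rw [h3]
  module

theorem inv_rotLift_mulVec (z : ℂ) (x : E4) : (rotLift α κ β₀ z)⁻¹ *ᵥ (fun j => x j) =
    ![(halfPhase α κ β₀ z * c₁ x).re, (halfPhase α κ β₀ z * c₁ x).im,
      (halfPhase α κ β₀ z * c₂ x).re, (halfPhase α κ β₀ z * c₂ x).im] := by
  rw [inv_rotLift]
  ext i
  fin_cases i <;>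
    simp [Li, Matrix.mulVec, dotProduct, Fin.sum_univ_four, Matrix.sub_apply, Complex.mul_re,
      Complex.mul_im, halfPhase_re, halfPhase_im, c₁_apply, c₂_apply] <;> ring

end LiftData

namespace IsConfLag

variable {X : ℂ → E4} (h : IsConfLag X)

include h

/-- A harmonic Lagrangian angle on a torus is affine. -/
theorem exists_affine_angle {b : Module.Basis (Fin 2) ℝ ℂ} (hper : IsPeriodic b X)
    (hharm : ∀ z, divMaslov X z = 0) : ∃ α κ β₀ : ℝ,
      ∀ z, phase X z * halfPhase α κ β₀ z ^ 2 = 1 := by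
  -- f is 2 ∂β/∂z; closedness of the Maslov form and harmonicity are its Cauchy–Riemann equations,
  -- and periodicity makes it bounded.
  set f : ℂ → ℂ := fun z => (maslov X 1 z : ℂ) + (-Complex.I) • (maslov X Complex.I z : ℂ) with hf
  have s : ∀ v, ContDiff ℝ ∞ fun z => (maslov X v z : ℂ) := fun v =>
    Complex.ofRealCLM.contDiff.comp (h.contDiff_maslov v)
  have e : ∀ v w, dv v (fun z => (maslov X w z : ℂ)) =
      fun z => ((dv v (maslov X w) z : ℝ) : ℂ) := fun v w =>
    dv_clm (h.contDiff_maslov w) Complex.ofRealCLM v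
  have hfs : ContDiff ℝ ∞ f := (s 1).add (contDiff_const_smulC (s _) _)
  have hfz : ∀ z, dzb f z = 0 := by
    intro z
    have h1 := hharm z
    have h2 := h.dv_maslov_comm 1 Complex.I z
    have h3 : (((dv 1 (maslov X 1) z : ℝ) : ℂ)
        + ((dv Complex.I (maslov X Complex.I) z : ℝ) : ℂ)) = 0 := by exact_mod_cast h1
    simp only [dzb, hf]
    rw [dv_add (s 1) (contDiff_const_smulC (s _) _), dv_add (s 1) (contDiff_const_smulC (s _) _),
      dv_const_smul (s _), dv_const_smul (s _)]
    simp only [e, h2, smul_eq_mul]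
    linear_combination (1 / 2 : ℂ) * h3
      - (1 / 2 : ℂ) * ((dv Complex.I (maslov X Complex.I) z : ℝ) : ℂ) * Complex.I_mul_I
  have hfp : IsPeriodic b f := fun γ hγ z => by
    simp only [hf, hper.maslov _ γ hγ z]
  have hconst := fun z => hfp.const_of_dzb_eq_zero hfs hfz z 0
  have hα : ∀ z, maslov X 1 z = maslov X 1 0 := fun z => by
    simpa [hf] using congrArg Complex.re (hconst z)
  have hκ : ∀ z, maslov X Complex.I z = maslov X Complex.I 0 := fun z => by
    simpa [hf] using congrArg Complex.im (hconst z)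
  set α := maslov X 1 0 with hα'
  set κ := maslov X Complex.I 0 with hκ'
  have hm : ∀ v z, maslov X v z = v.re * α + v.im * κ := by
    intro v z
    rw [← hα z, ← hκ z, maslov, dv_eq_re_im]
    simp only [maslov, Complex.real_smul, mul_add, Complex.add_im, mul_left_comm _ (_ : ℂ),
      Complex.im_ofReal_mul]
  have hg := h.contDiff_phase
  have hE := contDiff_halfPhase (α := α) (κ := κ) (β₀ := 0)
  -- The phase and the exponential of i times the affine function αx + κy have the same logarithmic
  -- derivative, so their quotient is constant.
  have hd : ∀ z, fderiv ℝ (fun z => phase X z * (halfPhase α κ 0 z * halfPhase α κ 0 z)) z = 0 := by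
    intro z
    refine ContinuousLinearMap.ext fun v => ?_
    have := congrFun (dv_mul hg (hE.mul hE) v) z
    change dv v (fun z => phase X z * (halfPhase α κ 0 z * halfPhase α κ 0 z)) z = 0
    rw [this, dv_mul hE hE]
    dsimp only
    rw [dv_halfPhase, h.dv_phase, hm]
    push_cast
    ring
  have hc := is_const_of_fderiv_eq_zero (𝕜 := ℝ)
    ((hg.mul (hE.mul hE)).differentiable (by simp)) hd
  have hE0 : ∀ β₀, ∃ c : ℂ, ∀ z, halfPhase α κ β₀ z = c * halfPhase α κ 0 z ∧
      c = Complex.exp ((-(β₀ / 2) : ℝ) * Complex.I) := by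
    intro β₀
    refine ⟨_, fun z => ⟨?_, rfl⟩⟩
    rw [halfPhase, halfPhase, ← Complex.exp_add]
    congr 1
    simp only [angleFun]
    push_cast
    ring
  set g₀ := phase X 0 with hg₀
  have hz0 : halfPhase α κ 0 0 = 1 := by simp [halfPhase, angleFun]
  have hn : ‖g₀‖ = 1 := by
    have h1 := h.conj_phase_mul 0
    rw [mul_comm, Complex.mul_conj, Complex.normSq_eq_norm_sq] at h1
    have h2 : ‖phase X 0‖ ^ 2 = 1 := by exact_mod_cast h1
    exact (pow_eq_one_iff_of_nonneg (norm_nonneg _) two_ne_zero).1 h2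
  -- The additive constant is an argument of the unimodular number `phase X 0`.
  refine ⟨α, κ, Complex.arg g₀, fun z => ?_⟩
  obtain ⟨c, hcz⟩ := hE0 (Complex.arg g₀)
  have hz := hc z 0
  simp only [hz0, mul_one] at hz
  change phase X z * (halfPhase α κ 0 z * halfPhase α κ 0 z) = g₀ at hz
  have h3 : g₀ = Complex.exp (Complex.arg g₀ * Complex.I) := by
    have := Complex.norm_mul_exp_arg_mul_I g₀
    rw [hn] at this
    simpa using this.symm
  have h4 : g₀ * c ^ 2 = 1 := by
    rw [(hcz z).2, h3, ← Complex.exp_nat_mul, ← Complex.exp_add, ← h3]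
    rw [Complex.exp_eq_one_iff]
    exact ⟨0, by push_cast; ring⟩
  rw [(hcz z).1]
  linear_combination c ^ 2 * hz + h4

end IsConfLag

end HamStat

/-! ### The linear Dirac-type equation for the translation part of the Maurer–Cartan form. -/

namespace HamStat

section Spinor

variable (α κ β₀ : ℝ) (X : ℂ → E4)

/-- The first complex coordinate of `∂X/∂x` in the frame `rotLift`. -/
def frame₁ (z : ℂ) : ℂ := halfPhase α κ β₀ z * c₁ (dv 1 X z)

/-- The second complex coordinate of `∂X/∂x` in the frame `rotLift`. -/
def frame₂ (z : ℂ) : ℂ := halfPhase α κ β₀ z * c₂ (dv 1 X z)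

/-- The first spinor component of a conformal Lagrangian immersion. -/
def spinorA (z : ℂ) : ℂ := ((frame₁ α κ β₀ X z).re : ℂ) + Complex.I * (frame₂ α κ β₀ X z).re

/-- The second spinor component of a conformal Lagrangian immersion. -/
def spinorB (z : ℂ) : ℂ := ((frame₁ α κ β₀ X z).im : ℂ) - Complex.I * (frame₂ α κ β₀ X z).im

/-- The basis vector of the `i`-eigenspace of `KC` that carries `spinorA`. -/
def baseA : V4 := ![1 / 2, 0, -Complex.I / 2, 0]

/-- The basis vector of the `i`-eigenspace of `KC` that carries `spinorB`. -/
def baseB : V4 := ![0, 1 / 2, 0, Complex.I / 2]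

/-- The translation part of the Maurer–Cartan form of the lift `rotLift`, on `∂/∂z`. -/
def spinor (z : ℂ) : V4 := spinorA α κ β₀ X z • baseA + spinorB α κ β₀ X z • baseB

/-- The rotation part of the Maurer–Cartan form of the lift `rotLift`, on `∂/∂z`. -/
def potential : ℂ := (1 / 4 : ℂ) * (α - Complex.I * κ)

theorem JC_star_baseA : JC (star baseA) = baseB := by
  rw [JC_eq]
  ext i
  fin_cases i <;> simp [baseA, baseB]

theorem JC_star_baseB : JC (star baseB) = -baseA := by
  rw [JC_eq]
  ext i
  fin_cases i <;> simp [baseA, baseB]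

theorem KC_baseA : KC baseA = Complex.I • baseA := by
  have := Complex.I_mul_I
  rw [KC_eq]
  ext i
  fin_cases i <;> simp [baseA]
  all_goals first | ring1 | linear_combination (1 / 2 : ℂ) * this

theorem KC_baseB : KC baseB = Complex.I • baseB := by
  have := Complex.I_mul_I
  rw [KC_eq]
  ext i
  fin_cases i <;> simp [baseB]
  all_goals first | ring1 | linear_combination (-1 / 2 : ℂ) * this

variable {α κ β₀ X}

theorem conj_halfPhase_mul (z : ℂ) :
    starRingEnd ℂ (halfPhase α κ β₀ z) * halfPhase α κ β₀ z = 1 := by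
  rw [mul_comm, Complex.mul_conj, Complex.normSq_eq_norm_sq, halfPhase,
    Complex.norm_exp_ofReal_mul_I]
  simp

theorem halfPhase_mul_phase (hE : ∀ z, phase X z * halfPhase α κ β₀ z ^ 2 = 1) (z : ℂ) :
    halfPhase α κ β₀ z * phase X z = starRingEnd ℂ (halfPhase α κ β₀ z) := by
  have h1 := conj_halfPhase_mul (α := α) (κ := κ) (β₀ := β₀) z
  linear_combination starRingEnd ℂ (halfPhase α κ β₀ z) * hE z
    - (phase X z * halfPhase α κ β₀ z) * h1

theorem KC_spinor (z : ℂ) : KC (spinor α κ β₀ X z) = Complex.I • spinor α κ β₀ X z := by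
  rw [spinor, map_add, map_smul, map_smul, KC_baseA, KC_baseB]
  module

theorem halfPhase_add (z w : ℂ) :
    halfPhase α κ β₀ (z + w) = halfPhase α κ β₀ z * halfPhase α κ 0 w := by
  rw [halfPhase, halfPhase, halfPhase, ← Complex.exp_add]
  congr 1
  simp only [angleFun, Complex.add_re, Complex.add_im]
  push_cast
  ring

theorem maurerCartan_rotLift (z v : ℂ) : maurerCartan (rotLift α κ β₀) X z v =
    (((v.re * α + v.im * κ) / 2 : ℂ) • Li ℂ,
      fun i => ((![(halfPhase α κ β₀ z * c₁ (dv v X z)).re, (halfPhase α κ β₀ z * c₁ (dv v X z)).im,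
      (halfPhase α κ β₀ z * c₂ (dv v X z)).re, (halfPhase α κ β₀ z * c₂ (dv v X z)).im] i : ℝ) : ℂ)) := by
  rw [maurerCartan, inv_mul_fderiv_rotLift]
  refine Prod.ext ?_ ?_
  · ext i j
    fin_cases i <;> fin_cases j <;> simp [Li]
  · rw [← inv_rotLift_mulVec]
    rfl

end Spinor

namespace IsConfLag

variable {X : ℂ → E4} (h : IsConfLag X) {α κ β₀ : ℝ}

include h

theorem contDiff_frame₁ : ContDiff ℝ ∞ (frame₁ α κ β₀ X) :=
  contDiff_halfPhase.mul (c₁.contDiff.comp (contDiff_dv h.smooth 1))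

theorem contDiff_frame₂ : ContDiff ℝ ∞ (frame₂ α κ β₀ X) :=
  contDiff_halfPhase.mul (c₂.contDiff.comp (contDiff_dv h.smooth 1))

theorem dv_spinorA (v z : ℂ) : dv v (spinorA α κ β₀ X) z =
    ((dv v (frame₁ α κ β₀ X) z).re : ℂ) + Complex.I * (dv v (frame₂ α κ β₀ X) z).re := by
  have e1 := dv_clm h.contDiff_frame₁ (Complex.ofRealCLM ∘L Complex.reCLM) v
    (f := frame₁ α κ β₀ X)
  have e2 := dv_clm h.contDiff_frame₂ (Complex.ofRealCLM ∘L Complex.reCLM) v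
    (f := frame₂ α κ β₀ X)
  have s1 : ContDiff ℝ ∞ fun z => (Complex.ofRealCLM ∘L Complex.reCLM) (frame₁ α κ β₀ X z) :=
    ContinuousLinearMap.contDiff _ |>.comp h.contDiff_frame₁
  have s2 : ContDiff ℝ ∞ fun z => (Complex.ofRealCLM ∘L Complex.reCLM) (frame₂ α κ β₀ X z) :=
    ContinuousLinearMap.contDiff _ |>.comp h.contDiff_frame₂
  have e3 := congrFun (dv_add s1 (contDiff_const_smulC s2 Complex.I) v) z
  rw [dv_const_smul s2, e1, e2] at e3
  exact e3

theorem dv_spinorB (v z : ℂ) : dv v (spinorB α κ β₀ X) z =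
    ((dv v (frame₁ α κ β₀ X) z).im : ℂ) - Complex.I * (dv v (frame₂ α κ β₀ X) z).im := by
  have e1 := dv_clm h.contDiff_frame₁ (Complex.ofRealCLM ∘L Complex.imCLM) v
    (f := frame₁ α κ β₀ X)
  have e2 := dv_clm h.contDiff_frame₂ (Complex.ofRealCLM ∘L Complex.imCLM) v
    (f := frame₂ α κ β₀ X)
  have s1 : ContDiff ℝ ∞ fun z => (Complex.ofRealCLM ∘L Complex.imCLM) (frame₁ α κ β₀ X z) :=
    ContinuousLinearMap.contDiff _ |>.comp h.contDiff_frame₁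
  have s2 : ContDiff ℝ ∞ fun z => (Complex.ofRealCLM ∘L Complex.imCLM) (frame₂ α κ β₀ X z) :=
    ContinuousLinearMap.contDiff _ |>.comp h.contDiff_frame₂
  have e3 := congrFun (dv_sub s1 (contDiff_const_smulC s2 Complex.I) v) z
  rw [dv_const_smul s2, e1, e2] at e3
  exact e3

theorem contDiff_spinorA : ContDiff ℝ ∞ (spinorA α κ β₀ X) :=
  ((Complex.ofRealCLM ∘L Complex.reCLM).contDiff.comp h.contDiff_frame₁).add
    (contDiff_const_smulC
      ((Complex.ofRealCLM ∘L Complex.reCLM).contDiff.comp h.contDiff_frame₂) Complex.I)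

theorem contDiff_spinorB : ContDiff ℝ ∞ (spinorB α κ β₀ X) :=
  ((Complex.ofRealCLM ∘L Complex.imCLM).contDiff.comp h.contDiff_frame₁).sub
    (contDiff_const_smulC
      ((Complex.ofRealCLM ∘L Complex.imCLM).contDiff.comp h.contDiff_frame₂) Complex.I)

theorem contDiff_spinor : ContDiff ℝ ∞ (spinor α κ β₀ X) :=
  (h.contDiff_spinorA.smul contDiff_const).add (h.contDiff_spinorB.smul contDiff_const)

variable (hE : ∀ z, phase X z * halfPhase α κ β₀ z ^ 2 = 1)

include hE

/-- Since e^{-iβ/2} e^{iβ} is the conjugate of e^{-iβ/2}, the phase disappears in the rotated frame: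
∂X/∂y becomes conjugate-linear in ∂X/∂x with constant coefficients. -/
theorem halfPhase_mul_c₁ (z : ℂ) : halfPhase α κ β₀ z * c₁ (dv Complex.I X z) =
    -starRingEnd ℂ (frame₂ α κ β₀ X z) := by
  rw [h.c₁_dv_I, frame₂, map_mul, ← halfPhase_mul_phase hE]
  ring

theorem halfPhase_mul_c₂ (z : ℂ) : halfPhase α κ β₀ z * c₂ (dv Complex.I X z) =
    starRingEnd ℂ (frame₁ α κ β₀ X z) := by
  rw [h.c₂_dv_I, frame₁, map_mul, ← halfPhase_mul_phase hE]
  ring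

/-- This is the symmetry of the mixed derivative of X written in the rotated frame; the zeroth-order
terms come from differentiating e^{-iβ/2}. -/
theorem dirac₁ (z : ℂ) : dv Complex.I (frame₁ α κ β₀ X) z
    + Complex.I / 2 * κ * frame₁ α κ β₀ X z =
    -starRingEnd ℂ (dv 1 (frame₂ α κ β₀ X) z)
      - Complex.I / 2 * α * starRingEnd ℂ (frame₂ α κ β₀ X z) := by
  have hs := fun v => c₁.contDiff.comp (contDiff_dv h.smooth v)
  have e1 := congrFun (dv_mul (contDiff_halfPhase (α := α) (κ := κ) (β₀ := β₀)) (hs 1)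
    Complex.I) z
  have e2 := congrFun (dv_mul (contDiff_halfPhase (α := α) (κ := κ) (β₀ := β₀)) (hs Complex.I)
    1) z
  have e3 : dv 1 (fun z => halfPhase α κ β₀ z * c₁ (dv Complex.I X z)) z =
      -starRingEnd ℂ (dv 1 (frame₂ α κ β₀ X) z) := by
    rw [funext (h.halfPhase_mul_c₁ hE), dv_neg, dv_conj h.contDiff_frame₂]
  have e4 := h.halfPhase_mul_c₁ hE z
  have c1 := congrFun (dv_clm (contDiff_dv h.smooth 1) c₁ Complex.I) z
  have c2 := congrFun (dv_clm (contDiff_dv h.smooth Complex.I) c₁ 1) z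
  rw [dv_comm h.smooth] at c2
  simp only [Function.comp_def] at e1 e2
  rw [e3, c2, dv_halfPhase] at e2
  change dv Complex.I (frame₁ α κ β₀ X) z = _ at e1
  rw [c1, dv_halfPhase] at e1
  simp at e1 e2
  rw [e1, e2, frame₁]
  linear_combination (Complex.I / 2 * α) * e4

theorem dirac₂ (z : ℂ) : dv Complex.I (frame₂ α κ β₀ X) z
    + Complex.I / 2 * κ * frame₂ α κ β₀ X z =
    starRingEnd ℂ (dv 1 (frame₁ α κ β₀ X) z)
      + Complex.I / 2 * α * starRingEnd ℂ (frame₁ α κ β₀ X z) := by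
  have hs := fun v => c₂.contDiff.comp (contDiff_dv h.smooth v)
  have e1 := congrFun (dv_mul (contDiff_halfPhase (α := α) (κ := κ) (β₀ := β₀)) (hs 1)
    Complex.I) z
  have e2 := congrFun (dv_mul (contDiff_halfPhase (α := α) (κ := κ) (β₀ := β₀)) (hs Complex.I)
    1) z
  have e3 : dv 1 (fun z => halfPhase α κ β₀ z * c₂ (dv Complex.I X z)) z =
      starRingEnd ℂ (dv 1 (frame₁ α κ β₀ X) z) := by
    rw [funext (h.halfPhase_mul_c₂ hE), dv_conj h.contDiff_frame₁]
  have e4 := h.halfPhase_mul_c₂ hE z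
  have c1 := congrFun (dv_clm (contDiff_dv h.smooth 1) c₂ Complex.I) z
  have c2 := congrFun (dv_clm (contDiff_dv h.smooth Complex.I) c₂ 1) z
  rw [dv_comm h.smooth] at c2
  simp only [Function.comp_def] at e1 e2
  rw [e3, c2, dv_halfPhase] at e2
  change dv Complex.I (frame₂ α κ β₀ X) z = _ at e1
  rw [c1, dv_halfPhase] at e1
  simp at e1 e2
  rw [e1, e2, frame₂]
  linear_combination (Complex.I / 2 * α) * e4

/-- The real parts of the two Dirac equations concern this component, their imaginary parts the
other one. -/
theorem dzb_spinorA (z : ℂ) : dzb (spinorA α κ β₀ X) z =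
    -(potential α κ * starRingEnd ℂ (spinorB α κ β₀ X z)) := by
  have d1 := h.dirac₁ hE z
  have d2 := h.dirac₂ hE z
  have r1 := congrArg Complex.re d1
  have r2 := congrArg Complex.re d2
  simp only [dzb, h.dv_spinorA, spinorB, potential]
  apply Complex.ext <;> simp at r1 r2 ⊢ <;> linarith

theorem dzb_spinorB (z : ℂ) : dzb (spinorB α κ β₀ X) z =
    potential α κ * starRingEnd ℂ (spinorA α κ β₀ X z) := by
  have d1 := h.dirac₁ hE z
  have d2 := h.dirac₂ hE z
  have r1 := congrArg Complex.im d1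
  have r2 := congrArg Complex.im d2
  simp only [dzb, h.dv_spinorB, spinorA, potential]
  apply Complex.ext <;> simp at r1 r2 ⊢ <;> linarith

theorem dzb_spinor (z : ℂ) :
    dzb (spinor α κ β₀ X) z = potential α κ • JC (star (spinor α κ β₀ X z)) := by
  have e1 := congrFun (dzb_clm (h.contDiff_spinorA (α := α) (κ := κ) (β₀ := β₀))
    (ContinuousLinearMap.toSpanSingleton ℂ baseA)) z
  have e2 := congrFun (dzb_clm (h.contDiff_spinorB (α := α) (κ := κ) (β₀ := β₀))
    (ContinuousLinearMap.toSpanSingleton ℂ baseB)) z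
  simp only [ContinuousLinearMap.toSpanSingleton_apply] at e1 e2
  have s1 : ContDiff ℝ ∞ fun z => spinorA α κ β₀ X z • baseA :=
    h.contDiff_spinorA.smul contDiff_const
  have s2 : ContDiff ℝ ∞ fun z => spinorB α κ β₀ X z • baseB :=
    h.contDiff_spinorB.smul contDiff_const
  have e3 := congrFun (dzb_add s1 s2) z
  change dzb (spinor α κ β₀ X) z = _ at e3
  rw [e3, e1, e2, h.dzb_spinorA hE, h.dzb_spinorB hE, spinor, star_add, star_smul, star_smul,
    map_add, map_smul, map_smul, JC_star_baseA, JC_star_baseB]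
  simp only [← starRingEnd_apply]
  module

/-- The first-order equation is used twice, once conjugated; the sign comes from Lᵢ² = -1. -/
theorem dz_dzb_spinor (z : ℂ) : dz (dzb (spinor α κ β₀ X)) z =
    (-(potential α κ * starRingEnd ℂ (potential α κ))) • spinor α κ β₀ X z := by
  have hu := h.contDiff_spinor (α := α) (κ := κ) (β₀ := β₀)
  have hs := contDiff_star hu
  have hs2 : ContDiff ℝ ∞ fun z => JC (star (spinor α κ β₀ X z)) :=
    (JC.restrictScalars ℝ).contDiff.comp hs
  rw [funext (h.dzb_spinor hE), dz_const_smul hs2, dz_clm hs, dz_star hu]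
  dsimp only
  rw [h.dzb_spinor hE, star_smul, star_JC, star_star, map_smul, JC_JC, ← starRingEnd_apply]
  module

theorem onDz_maurerCartan (z : ℂ) : onDz (maurerCartan (rotLift α κ β₀) X z) =
    (potential α κ • Li ℂ, spinor α κ β₀ X z) := by
  have hI := Complex.I_mul_I
  rw [onDz, maurerCartan_rotLift, maurerCartan_rotLift, h.halfPhase_mul_c₁ hE,
    h.halfPhase_mul_c₂ hE, show halfPhase α κ β₀ z * c₁ (dv 1 X z) = frame₁ α κ β₀ X z from rfl,
    show halfPhase α κ β₀ z * c₂ (dv 1 X z) = frame₂ α κ β₀ X z from rfl]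
  refine Prod.ext ?_ ?_
  · simp [potential]
    module
  · change (1 / 2 : ℂ) • (_ - Complex.I • _) = _
    ext i
    fin_cases i <;>
      simp [spinor, baseA, baseB, spinorA, spinorB]
    all_goals apply Complex.ext <;> simp <;> ring

theorem onDzbar_maurerCartan (z : ℂ) : onDzbar (maurerCartan (rotLift α κ β₀) X z) =
    (starRingEnd ℂ (potential α κ) • Li ℂ, star (spinor α κ β₀ X z)) := by
  have hI := Complex.I_mul_I
  rw [onDzbar, maurerCartan_rotLift, maurerCartan_rotLift, h.halfPhase_mul_c₁ hE,
    h.halfPhase_mul_c₂ hE, show halfPhase α κ β₀ z * c₁ (dv 1 X z) = frame₁ α κ β₀ X z from rfl,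
    show halfPhase α κ β₀ z * c₂ (dv 1 X z) = frame₂ α κ β₀ X z from rfl]
  refine Prod.ext ?_ ?_
  · simp [potential, Complex.conj_ofNat]
    module
  · change (1 / 2 : ℂ) • (_ + Complex.I • _) = _
    ext i
    fin_cases i <;>
      simp [spinor, baseA, baseB, spinorA, spinorB]
    all_goals apply Complex.ext <;> simp <;> ring

end IsConfLag

end HamStat

/-! ### Periodicity over the doubled lattice and assembly of the proof. -/

namespace HamStat

section DoubledLattice

variable {α κ β₀ : ℝ} {b : Module.Basis (Fin 2) ℝ ℂ}

/-- The basis of the doubled lattice. -/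
def doubled (b : Module.Basis (Fin 2) ℝ ℂ) : Module.Basis (Fin 2) ℝ ℂ :=
  b.isUnitSMul (w := fun _ => (2 : ℝ)) fun _ => two_ne_zero.isUnit

theorem exists_of_mem_doubled {γ : ℂ} (hγ : γ ∈ Submodule.span ℤ (Set.range (doubled b))) :
    ∃ δ ∈ Submodule.span ℤ (Set.range b), γ = δ + δ := by
  induction hγ using Submodule.span_induction with
  | mem x hx =>
    obtain ⟨i, rfl⟩ := hx
    refine ⟨b i, Submodule.subset_span ⟨i, rfl⟩, ?_⟩
    rw [doubled, Module.Basis.isUnitSMul_apply, two_smul]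
  | zero => exact ⟨0, zero_mem _, by simp⟩
  | add x y _ _ hx hy =>
    obtain ⟨p, hp, rfl⟩ := hx
    obtain ⟨q, hq, rfl⟩ := hy
    exact ⟨p + q, add_mem hp hq, by ring⟩
  | smul n x _ hx =>
    obtain ⟨p, hp, rfl⟩ := hx
    exact ⟨n • p, Submodule.smul_mem _ _ hp, by rw [smul_add]⟩

theorem IsPeriodic.doubled {E : Type*} {f : ℂ → E} (hf : IsPeriodic b f) :
    IsPeriodic (doubled b) f := by
  intro γ hγ z
  obtain ⟨δ, hδ, rfl⟩ := exists_of_mem_doubled hγ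
  rw [← add_assoc, hf δ hδ, hf δ hδ]

/-- Since β is affine, a lattice translation multiplies e^{-iβ/2} by a constant, and periodicity of
e^{iβ} forces this constant to be ±1. Twice the translation removes the sign. -/
theorem IsPeriodic.halfPhase {X : ℂ → E4} (hper : IsPeriodic b X)
    (hE : ∀ z, HamStat.phase X z * HamStat.halfPhase α κ β₀ z ^ 2 = 1) :
    IsPeriodic (HamStat.doubled b) (HamStat.halfPhase α κ β₀) := by
  intro γ hγ z
  obtain ⟨δ, hδ, rfl⟩ := exists_of_mem_doubled hγ
  have h1 := hE (0 + δ)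
  rw [hper.phase δ hδ, halfPhase_add] at h1
  have h2 : HamStat.halfPhase α κ 0 δ ^ 2 = 1 := by
    linear_combination h1 - HamStat.halfPhase α κ 0 δ ^ 2 * hE 0
  rw [halfPhase_add, halfPhase_add]
  linear_combination HamStat.halfPhase α κ β₀ z * h2

theorem IsPeriodic.spinor {X : ℂ → E4} (hper : IsPeriodic b X)
    (hE : ∀ z, HamStat.phase X z * HamStat.halfPhase α κ β₀ z ^ 2 = 1) :
    IsPeriodic (HamStat.doubled b) (HamStat.spinor α κ β₀ X) := by
  intro γ hγ z
  simp only [HamStat.spinor, spinorA, spinorB, frame₁, frame₂, hper.halfPhase hE γ hγ z,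
    (hper.dv 1).doubled γ hγ z]

end DoubledLattice

section Assembly

variable {X : ℂ → E4} {α κ β₀ : ℝ} {b : Module.Basis (Fin 2) ℝ ℂ}

theorem IsConfLag.isLift (h : IsConfLag X)
    (hE : ∀ z, phase X z * halfPhase α κ β₀ z ^ 2 = 1) :
    IsLift (rotLift α κ β₀) X where
  smooth := contDiff_rotLift
  mem_rotGroup := rotLift_mem
  angle z := by
    change expAngle (‖dv 1 X z‖⁻¹ • dv 1 X z) (‖dv Complex.I X z‖⁻¹ • dv Complex.I X z) = _
    rw [← h.norm_eq]
    have h1 : expAngle (‖dv 1 X z‖⁻¹ • dv 1 X z) (‖dv 1 X z‖⁻¹ • dv Complex.I X z) =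
        phase X z := by
      rw [expAngle_eq, phase, expAngle_eq]
      simp only [map_smul, Complex.real_smul]
      push_cast
      ring
    have h2 : halfPhase α κ β₀ z = Real.cos (angleFun α κ β₀ z / 2)
        - Real.sin (angleFun α κ β₀ z / 2) * Complex.I := by
      apply Complex.ext
      · rw [halfPhase_re]
        simp [-Complex.ofReal_cos, -Complex.ofReal_sin]
      · rw [halfPhase_im]
        simp [-Complex.ofReal_cos, -Complex.ofReal_sin]
    have h3 : expAngle (WithLp.toLp 2 fun i => rotLift α κ β₀ z i 0)
        (WithLp.toLp 2 fun i => rotLift α κ β₀ z i 2) =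
          starRingEnd ℂ (halfPhase α κ β₀ z) ^ 2 := by
      rw [h2]
      simp [expAngle, rotLift_apply, Li, -Complex.ofReal_cos, -Complex.ofReal_sin]
      ring
    have h4 := conj_halfPhase_mul (α := α) (κ := κ) (β₀ := β₀) z
    rw [h1, h3, ← halfPhase_mul_phase hE]
    linear_combination (-phase X z) * hE z

theorem exists_horner_eq_zero {u : ℂ → V4} (hu : ContDiff ℝ ∞ u) (hp : IsPeriodic b u) {c : ℂ}
    (hlap : ∀ z, dz (dzb u) z = (-(c * starRingEnd ℂ c)) • u z) :
    ∃ Q : Polynomial ℂ, Q.Monic ∧ ∀ z, horner Q u 0 z = 0 := by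
  obtain ⟨Q, hQ, hann⟩ := exists_annihilator b (Complex.normSq c)
  refine ⟨Q, hQ, fun z => funext fun i => ?_⟩
  set L : V4 →L[ℂ] ℂ := ContinuousLinearMap.proj i
  have hs : ContDiff ℝ ∞ fun z => L (u z) := (L.restrictScalars ℝ).contDiff.comp hu
  have h1 := hann (fun z => L (u z)) (fun γ hγ z => by simp only [hp γ hγ z]) hs (fun z => by
    rw [dzb_clm hu, dz_clm (contDiff_dzb hu)]
    dsimp only
    rw [hlap, map_smul, Complex.mul_conj, smul_eq_mul]) z
  simp only [iterate_dz_clm hu] at h1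
  simp only [horner, Finset.sum_apply, Pi.smul_apply, Nat.sub_zero, zero_add, smul_eq_mul]
  exact h1

theorem const_of_dzb_eq_zero {u : ℂ → V4} (hu : ContDiff ℝ ∞ u) (hp : IsPeriodic b u)
    (h0 : ∀ z, dzb u z = 0) (z : ℂ) : u z = u 0 := by
  ext i
  set L : V4 →L[ℂ] ℂ := ContinuousLinearMap.proj i
  have hs : ContDiff ℝ ∞ fun z => L (u z) := (L.restrictScalars ℝ).contDiff.comp hu
  have hp' : IsPeriodic b fun z => L (u z) := fun γ hγ z => by simp only [hp γ hγ z]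
  exact hp'.const_of_dzb_eq_zero hs (fun z => by simp [dzb_clm hu, h0]) z 0

/-- A constant spinor gives a polynomial Killing field of degree two. -/
theorem isKillingCoeff_of_const {u₀ : V4} (hK : KC u₀ = Complex.I • u₀) :
    IsKillingCoeff (fun _ => u₀) 0 2 (fun _ => 0)
      (fun n _ => if n = -1 then u₀ else if n = 1 then star u₀ else 0) where
  smooth n := contDiff_const
  rot_zero n hn := rfl
  trans_zero n hn := by
    have h1 : n ≠ -1 := by rintro rfl; simp at hn
    have h2 : n ≠ 1 := by rintro rfl; simp at hn
    simp [h1, h2]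
  eq_dz n z := by simp [dz_const]
  eq_dzb n z := by simp [dzb_const]
  rot_conj n := by simp
  trans_conj n z := by
    by_cases h1 : n = -1
    · simp [h1]
    by_cases h2 : n = 1
    · simp [h2]
    simp [h1, h2, neg_eq_iff_eq_neg]
  rot_twist n := by simp
  trans_twist n z := by
    by_cases h1 : n = -1
    · simp [h1, hK]
    by_cases h2 : n = 1
    · have h3 : KC (star u₀) = -Complex.I • star u₀ := by
        rw [← star_KC, hK, star_smul]
        simp
      simp [h2, h3]
    simp [h1, h2]

/-- A conformal Lagrangian immersion of a torus with affine Lagrangian angle is of finite type. -/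
theorem IsConfLag.isFiniteType (h : IsConfLag X) (hper : IsPeriodic b X)
    (hE : ∀ z, phase X z * halfPhase α κ β₀ z ^ 2 = 1) : IsFiniteType X := by
  refine ⟨rotLift α κ β₀, h.isLift hE, ?_⟩
  have hu := h.contDiff_spinor (α := α) (κ := κ) (β₀ := β₀)
  have hp := hper.spinor hE
  have hK := KC_spinor (α := α) (κ := κ) (β₀ := β₀) (X := X)
  have m1 := h.onDz_maurerCartan hE
  have m2 := h.onDzbar_maurerCartan hE
  have hzb := h.dzb_spinor hE
  have hlap := h.dz_dzb_spinor hE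
  set u := spinor α κ β₀ X
  set c := potential α κ
  by_cases hc : c = 0
  -- If b = 0, the spinor is holomorphic and periodic, hence constant.
  · have hconst := const_of_dzb_eq_zero hu hp fun z => by rw [hzb, hc, zero_smul]
    have hu0 : u = fun _ => u 0 := funext hconst
    have hk := isKillingCoeff_of_const (hK 0)
    refine ⟨0, _, hk.isAdapted (fun _ => hK 0) (fun z => ?_) (fun z => ?_) rfl (fun _ => ?_) rfl
      (fun _ => ?_) rfl⟩
    · rw [m1, hc, hconst]
    · rw [m2, hc, hconst]
    · simp
    · simp
  · obtain ⟨Q, hQ, h0⟩ := exists_horner_eq_zero hu hp hlap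
    set N := Q.natDegree with hN
    -- This normalization makes the rotation coefficient at -d equal to b; since Q is monic, the
    -- same choice makes the translation coefficient at -d + 1 equal to u.
    set ν : ℂ := -c / (-c ^ 2) ^ N with hν
    have hne : (-c ^ 2) ^ N ≠ 0 := pow_ne_zero _ (neg_ne_zero.2 (pow_ne_zero _ hc))
    have hk := isKillingCoeff_of_annihilator (ν := ν) hc hu h0 hzb hlap hK
    refine ⟨N, _, hk.isAdapted hK m1 m2 ?_ (fun z => ?_) ?_ (fun z => ?_) ?_⟩
    · rw [show -((4 * Q.natDegree + 2 : ℕ) : ℤ) = -(4 * (N : ℤ) + 2) by push_cast; ring,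
        rotSeq_two, rotSeq_zero (by omega), hQ.coeff_natDegree, hν]
      field_simp
      simp
    · rw [transSeq_zero (by omega), transSeq_zero (by omega)]
      simp
    · rw [rotSeq_zero (by omega), rotSeq_zero (by omega)]
      simp
    · rw [show -((4 * Q.natDegree + 2 : ℕ) : ℤ) + 1 = -(4 * (N : ℤ) + 1) by push_cast; ring,
        transSeq_one, transSeq_zero (by omega), horner_natDegree hQ]
      have e : -(ν * (-c ^ 2) ^ N * c⁻¹) = 1 := by
        rw [hν, div_mul_cancel₀ _ hne, neg_mul, mul_inv_cancel₀ hc, neg_neg]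
      simp only [e, one_smul, star_zero, add_zero]
    · rw [rotSeq_zero (by omega), rotSeq_zero (by omega)]
      simp

end Assembly

end HamStat

end

/-- A torus is `ℂ / Γ` with `Γ` the lattice spanned by `b`; maps from it are `Γ`-periodic maps on
`ℂ`. `Conformal` means that every differential is a nonzero multiple of a linear isometry, so that
`X` is an immersion. -/
theorem mainTheorem2 (b : Module.Basis (Fin 2) ℝ ℂ) (X : ℂ → HamStat.E4)
    (hper : ∀ γ ∈ Submodule.span ℤ (Set.range b), ∀ z : ℂ, X (z + γ) = X z)
    (hsmooth : ContDiff ℝ ∞ X)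
    (hconf : Conformal X)
    (hlag : HamStat.IsLagrangian X)
    (hstat : HamStat.IsHamiltonianStationary b X) :
    HamStat.IsFiniteType X := by
  have h := HamStat.isConfLag_of_conformal hsmooth hconf hlag
  obtain ⟨α, κ, β₀, hE⟩ :=
    h.exists_affine_angle hper (h.divMaslov_eq_zero hper hstat)
  exact h.isFiniteType hper hE
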